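/- Let $K$ be an algebraically closed field of arbitrary characteristic. **Definitions.** A *plane sequence* is a non-increasing sequence $e=(e_0,e_1,\dots)$ of positive integers with $e_i=1$ for all large $i$, such that whenever $e_i>e_{i+1}$ and $e_i=q_ie_{i+1}+r_i$ with $0\le r_i<e_{i+1}$, one has $e_{i+j}=e_{i+1}$ for $1\le j\le q_i$ and, if $r_i\ne0$, $e_{i+q_i+1}=r_i$. For such $e$ and every $i$ there is a unique $h(i)\ge1$ with $e_i=\sum_{l=1}^{h(i)}e_{i+l}$; the *restriction number* $r(e_j)$ is the number of $i$ with $i<j\le i+h(i)$. For two plane sequences $e,e'$, an integer $k\ge-1$ is *admissible* if $k=-1$, or $k\ge0$ and 1. for $1\le i\le k-1$: $e_{i-1}=e_i$ if and only if $e'_{i-1}=e'_i$; 2. $r(e_j)=r(e'_j)$ for all $0\le j\le k$; 3. if $k\ge1$ and $e_{k-1}>e_k$, then $e'_{k-1}=e'_k$; 4. if $k\ge1$, $r(e_k)=r(e'_k)=r(e_{k+1})=r(e'_{k+1})=2$ and $e_{k-1}=e_k$, then $e'_{k-1}>e'_k$. A *branch* is a one-dimensional ring $C=K[[X,Y]]/P$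 with $P$ a prime ideal. For a ring $R$ with total ring of fractions $Q(R)$ put $R^{(0)}=R$ and let $R^{(j+1)}=\bigcup_n(J^n:J^n)\subseteq Q(R)$, where $J$ is the Jacobson radical of $R^{(j)}$ (blowing up). The *multiplicity sequence* of a branch $C$ is $(e_0,e_1,\dots)$, where $e_j$ is the least value $\nu(x)$ of a non-unit $x$ of $C^{(j)}$, $\nu$ being the valuation of the integral closure $\overline C\cong K[[t]]$ of $C$. A curve with the branches $C=K[[X,Y]]/P$ and $C'=K[[X,Y]]/P'$ has as its ring $R$ either the local ring $K[[X,Y]]/(P\cap P')$, where $P\ne P'$, or the (non-local) product $C\times C'$. Its *splitting number* is $-1$ if $R$ is not local, and otherwise the largest $k\ge0$ such that $R^{(k)}$ is local. **Proposition.** Let $e,e'$ be plane sequences and $k$ an integer. (a) If $k\ge-1$ is admissible for $e,e'$ and $C$ is a branch with multiplicity sequence $e$, then there is a branch $C'$ with multiplicity sequence $e'$ such that $k$ is the splitting number of a curve with the branches $C$ and $C'$. (b) There are branches $C,C'$ with multiplicity sequences $e,e'$ such that $k$ is the splitting number of a curve with the branches $C$ and $C'$ if and only if $k\ge-1$ and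 $k$ is admissible for $e,e'$. -/

import Mathlib

namespace PlaneCurve

universe u

/-! ### Sequences of multiplicities -/

/-- Plane sequences: non-increasing sequences of positive integers that are eventually equal to `1`
and satisfy the proximity relation. -/
structure IsPlaneSequence (e : ℕ → ℕ) : Prop where
  pos : ∀ i, 0 < e i
  antitone : Antitone e
  eventually_one : ∃ n, ∀ i, n ≤ i → e i = 1
  proximity : ∀ i, e (i + 1) < e i →
    (∀ j, 1 ≤ j → j ≤ e i / e (i + 1) → e (i + j) = e (i + 1)) ∧
      (e i % e (i + 1) ≠ 0 → e (i + e i / e (i + 1) + 1) = e i % e (i + 1))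

/-- The restriction number `r(e_j)`: the number of sums `e_i = e_{i+1} + ⋯ + e_{i+h}` in which
`e_j` appears as a summand (for positive `e` the number `h` is determined by `i`). -/
noncomputable def restrictionNumber (e : ℕ → ℕ) (j : ℕ) : ℕ :=
  Set.ncard {i : ℕ | ∃ h : ℕ, e i = ∑ l ∈ Finset.Icc 1 h, e (i + l) ∧ i < j ∧ j ≤ i + h}

/-- Admissible integers for a pair of sequences. Conditions (3) and (4) involve `e_{k-1}`, and are
void for `k = 0`; there `k = l + 1`, and in (1) the index `i + 1` runs through `1, …, k - 1`. -/
def IsAdmissible (e e' : ℕ → ℕ) (k : ℤ) : Prop :=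
  k = -1 ∨ ∃ n : ℕ, k = n ∧
    (∀ i, i + 1 < n → (e i = e (i + 1) ↔ e' i = e' (i + 1))) ∧
    (∀ j, j ≤ n → restrictionNumber e j = restrictionNumber e' j) ∧
    (∀ l, n = l + 1 → e (l + 1) < e l → e' l = e' (l + 1)) ∧
    (∀ l, n = l + 1 →
      restrictionNumber e n = 2 → restrictionNumber e' n = 2 →
      restrictionNumber e (n + 1) = 2 → restrictionNumber e' (n + 1) = 2 →
      e l = e (l + 1) → e' (l + 1) < e' l)

/-! ### Blowing up -/

section Blowup

variable {Q : Type u} [CommRing Q]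

/-- `z` multiplies the `n`-th power of the Jacobson radical `J` of `S` into itself. -/
def Stabilizes (S : Subring Q) (n : ℕ) (z : Q) : Prop :=
  ∀ a ∈ Ring.jacobson S ^ n, ∃ b ∈ Ring.jacobson S ^ n, z * (a : Q) = (b : Q)

theorem Stabilizes.succ {S : Subring Q} {n : ℕ} {z : Q} (h : Stabilizes S n z) :
    Stabilizes S (n + 1) z := by
  intro a ha
  rw [pow_succ] at ha ⊢
  induction ha using Submodule.mul_induction_on' with
  | mem_mul_mem m hm c hc =>
    obtain ⟨b, hb, e⟩ := h m hm
    refine ⟨b * c, Ideal.mul_mem_mul hb hc, ?_⟩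
    push_cast
    rw [← e, mul_assoc]
  | add x _ y _ hx hy =>
    obtain ⟨b, hb, e⟩ := hx
    obtain ⟨c, hc, e'⟩ := hy
    refine ⟨b + c, Ideal.add_mem _ hb hc, ?_⟩
    push_cast
    rw [mul_add, e, e']

theorem Stabilizes.mono {S : Subring Q} {n m : ℕ} {z : Q} (h : Stabilizes S n z) (hnm : n ≤ m) :
    Stabilizes S m z := by
  induction hnm with
  | refl => exact h
  | step _ ih => exact ih.succ

/-- The blow-up of a ring `S` inside its total ring of fractions `Q`, with centre the Jacobson
radical `J` of `S`: the union of the rings `(J ^ n : J ^ n)`. -/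
def blowup (S : Subring Q) : Subring Q where
  carrier := {z | ∃ n, Stabilizes S n z}
  one_mem' := ⟨0, fun a ha => ⟨a, ha, one_mul _⟩⟩
  zero_mem' := ⟨0, fun _ _ => ⟨0, Ideal.zero_mem _, by simp⟩⟩
  mul_mem' := by
    rintro z w ⟨n, hz⟩ ⟨m, hw⟩
    refine ⟨max n m, fun a ha => ?_⟩
    obtain ⟨b, hb, e⟩ := hw.mono (le_max_right n m) a ha
    obtain ⟨c, hc, e'⟩ := hz.mono (le_max_left n m) b hb
    exact ⟨c, hc, by rw [mul_assoc, e, e']⟩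
  add_mem' := by
    rintro z w ⟨n, hz⟩ ⟨m, hw⟩
    refine ⟨max n m, fun a ha => ?_⟩
    obtain ⟨b, hb, e⟩ := hw.mono (le_max_right n m) a ha
    obtain ⟨c, hc, e'⟩ := hz.mono (le_max_left n m) a ha
    exact ⟨c + b, Ideal.add_mem _ hc hb, by push_cast; rw [add_mul, e, e']⟩
  neg_mem' := by
    rintro z ⟨n, hz⟩
    refine ⟨n, fun a ha => ?_⟩
    obtain ⟨b, hb, e⟩ := hz a ha
    exact ⟨-b, (Ideal.neg_mem_iff _).2 hb, by push_cast; rw [neg_mul, e]⟩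

end Blowup

/-- The ring `R^{(j)}` obtained from `R` by `j` successive blow-ups, as a subring of the total ring
of fractions of `R`. -/
noncomputable def neighbourhood (R : Type u) [CommRing R] (j : ℕ) : Subring (FractionRing R) :=
  blowup^[j] (algebraMap R (FractionRing R)).range

/-! ### Branches and their multiplicity sequences -/

/-- The order of `x`, an element of the total ring of fractions of `R`, with respect to the maximal
ideal `𝔪` of the integral closure of `R`, i.e. the largest `n` with `x ∈ 𝔪 ^ n` (and `⊤` for
`x = 0`). For a branch `R` the integral closure is a discrete valuation ring, isomorphic to `K[[t]]`,
and this is the valuation of the branch. -/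
noncomputable def value (R : Type u) [CommRing R] (x : FractionRing R) : ℕ∞ :=
  ⨆ (n : ℕ) (_ : ∃ a ∈ Ring.jacobson (integralClosure R (FractionRing R)) ^ n,
    (a : FractionRing R) = x), (n : ℕ∞)

/-- The multiplicity of `R^{(j)}`, for a branch `R`: the minimal value of its non-units. -/
noncomputable def multiplicity (R : Type u) [CommRing R] (j : ℕ) : ℕ∞ :=
  ⨅ (x : neighbourhood R j) (_ : ¬ IsUnit x), value R (x : FractionRing R)

/-- A plane algebroid branch over `K`, i.e. a one-dimensional ring `K[[X,Y]]/P` with `P` prime. As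
`K[[X,Y]]` is a two-dimensional local domain, one-dimensionality of the quotient by the prime `P`
means that `P` is neither zero nor maximal. -/
structure Branch (K : Type u) [Field K] where
  ideal : Ideal (MvPowerSeries (Fin 2) K)
  isPrime : ideal.IsPrime
  ne_bot : ideal ≠ ⊥
  not_isMaximal : ¬ ideal.IsMaximal

variable {K : Type u} [Field K]

/-- The ring `K[[X,Y]]/P` of a branch. -/
abbrev Branch.Ring (C : Branch K) : Type u := MvPowerSeries (Fin 2) K ⧸ C.ideal

/-- `e` is the sequence of multiplicities of the branch `C`. -/
def Branch.HasMultiplicitySequence (C : Branch K) (e : ℕ → ℕ) : Prop :=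
  ∀ j, multiplicity C.Ring j = (e j : ℕ∞)

/-! ### Splitting numbers -/

/-- `k` is the splitting number of the ring `R` of a curve with two branches: `-1` if `R` is not
local, and otherwise the largest `n` for which `R^{(n)}` is local. -/
def IsSplittingNumber (R : Type u) [CommRing R] (k : ℤ) : Prop :=
  (¬ IsLocalRing R ∧ k = -1) ∨
    (IsLocalRing R ∧ ∃ n : ℕ, k = n ∧ IsGreatest {j : ℕ | IsLocalRing (neighbourhood R j)} n)

/-- `k` is the splitting number of a plane curve with the two branches `C` and `C'`. Such a curve is
either local, namely `K[[X,Y]]/(P ∩ P')` with `P ≠ P'`, or it is the disjoint union of the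
branches, with ring `C × C'`. -/
def IsPairSplittingNumber (C C' : Branch K) (k : ℤ) : Prop :=
  (C.ideal ≠ C'.ideal ∧
      IsSplittingNumber (MvPowerSeries (Fin 2) K ⧸ (C.ideal ⊓ C'.ideal)) k) ∨
    IsSplittingNumber (C.Ring × C'.Ring) k

end PlaneCurve

/-! Everything is read off from primitive parametrizations. A branch K[[X,Y]]/P is the image of a
substitution (X,Y) ↦ (u,v) into K[[t]] with kernel P whose image contains some t^N K[[t]]
(`Branch.exists_parametrizes`). To get it without Puiseux series, in any characteristic, take a
valuation ring of the fraction field dominating the branch. It is finite over a power series ring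
K[[x]], hence a discrete valuation ring, with residue field K because K is algebraically closed, and
so it embeds into K[[t]].

Blowing up replaces (u,v) by (u, v/u - c), or by (v, u/v) when the tangent is c = ∞
(`blowup_ring_of_step`). So a branch has a sequence s of tangents in K ∪ {∞}, determined by its
ideal, and e_j is the smaller order of the two coordinates of the j-th strict transform. For two
branches the j-th blow-up is the image of one local ring K[[X,Y]] as long as all earlier tangents
agree. Once tangents differ the ring has an element with different residues on the two branches, and
it is never local again. Hence the splitting number of a local curve is the first n with s_n ≠ s'_n
(`isLocalRing_neighbourhood_of_step`).

It remains to see which s occur for a given e. After a blow-up u = 0 is the newest exceptional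
divisor and has intersection number e_j with the curve at the point j+1. If an older exceptional
divisor passes through that point, it is v = 0 and its intersection number is `contact e (j+1)`. The
restriction number counts the exceptional divisors through the point, so for a positive index it is
2 or 1 according as the contact is nonzero or zero. Thus s_{j+1} = ∞ exactly when e drops. Otherwise
s_{j+1} is forced to be 0 if the next contact is nonzero, must be nonzero if the present contact is
nonzero and the next one vanishes, and is free if the present contact vanishes; s_0 is free as well.
These are the conditions `StepCompat`. Conversely, blowing down from a smooth axis realizes every
compatible sequence that is eventually 0 (`exists_branch_of_stepCompat`).

Admissibility of n ≥ 0 says precisely that compatible s and s' can agree before n and differ at n.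
Conditions (1) and (2) transfer compatibility below n; (3) and (4) exclude that both n-th tangents
are forced to be ∞, or both forced to be 0. In all other cases the second one can be chosen
different from the first, K being infinite. -/

namespace PlaneCurve

universe u
variable {K : Type u} [Field K]

/-! ### Power series in one and two variables, and finiteness over K[[x]] -/

section PowerSeriesGeneralities

open PowerSeries

/-- A power series in two variables splits into a series in one variable and a multiple of the other
variable. -/
theorem exists_eq_toMvPowerSeries_add_X_mul {i j : Fin 2} (hij : i ≠ j)
    (h : MvPowerSeries (Fin 2) K) :
    ∃ (g : K⟦X⟧) (h' : MvPowerSeries (Fin 2) K),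
      h = g.toMvPowerSeries j + MvPowerSeries.X i * h' ∧
        constantCoeff g = MvPowerSeries.constantCoeff h := by
  let g : K⟦X⟧ := PowerSeries.mk fun n => MvPowerSeries.coeff (Finsupp.single j n) h
  have hd : MvPowerSeries.X i ∣ h - g.toMvPowerSeries j := by
    rw [MvPowerSeries.X_dvd_iff]
    intro m hm
    have hm' : m = Finsupp.single j (m j) := by
      ext k
      rcases eq_or_ne k j with rfl | hk
      · simp
      · have : k = i := by omega
        subst this
        simp [hm, hk]
    have h1 : MvPowerSeries.coeff m (g.toMvPowerSeries j) = PowerSeries.coeff (m j) g := by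
      have := MvPowerSeries.coeff_embDomain_rename (Function.Embedding.punit j) g
        (Finsupp.single () (m j))
      rw [Finsupp.embDomain_single, show (Function.Embedding.punit j) () = j from rfl, ← hm'] at this
      exact this
    rw [map_sub, h1, PowerSeries.coeff_mk, sub_eq_zero]
    rw [← hm']
  obtain ⟨h', hh'⟩ := hd
  refine ⟨g, h', by rw [← hh']; ring, ?_⟩
  rw [← PowerSeries.coeff_zero_eq_constantCoeff_apply, PowerSeries.coeff_mk, Finsupp.single_zero,
    MvPowerSeries.coeff_zero_eq_constantCoeff_apply]

theorem exists_eq_C_add (h : MvPowerSeries (Fin 2) K) :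
    ∃ h₀ h₁ : MvPowerSeries (Fin 2) K,
      h = algebraMap K _ (MvPowerSeries.constantCoeff h) +
        (MvPowerSeries.X 0 * h₀ + MvPowerSeries.X 1 * h₁) := by
  obtain ⟨g, h', e, e'⟩ := exists_eq_toMvPowerSeries_add_X_mul (i := 0) (j := 1) (by simp) h
  obtain ⟨g', hg'⟩ := PowerSeries.X_dvd_iff (φ := g - PowerSeries.C (constantCoeff g)).2 (by simp)
  refine ⟨h', g'.toMvPowerSeries 1, ?_⟩
  have : g = PowerSeries.C (constantCoeff g) + PowerSeries.X * g' := by rw [← hg']; ring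
  conv_lhs => rw [e, this]
  rw [map_add, map_mul, toMvPowerSeries_C, toMvPowerSeries_X, e']
  simp only [MvPowerSeries.algebraMap_apply, Algebra.algebraMap_self, RingHom.id_apply]
  ring

variable (K) in
/-- The maximal ideal of `K[[X,Y]]`. -/
noncomputable abbrev maxIdeal : Ideal (MvPowerSeries (Fin 2) K) :=
  IsLocalRing.maximalIdeal (MvPowerSeries (Fin 2) K)

theorem mem_maxIdeal {h : MvPowerSeries (Fin 2) K} :
    h ∈ maxIdeal K ↔ MvPowerSeries.constantCoeff h = 0 := by
  rw [IsLocalRing.mem_maximalIdeal, mem_nonunits_iff, MvPowerSeries.isUnit_iff_constantCoeff,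
    isUnit_iff_ne_zero, not_not]

theorem maxIdeal_eq_span :
    maxIdeal K = Ideal.span {MvPowerSeries.X 0, MvPowerSeries.X 1} := by
  apply le_antisymm
  · intro h hh
    obtain ⟨a, b, e⟩ := exists_eq_C_add h
    rw [mem_maxIdeal] at hh
    rw [e, hh, map_zero, zero_add]
    exact Ideal.mem_span_pair.2 ⟨a, b, by ring⟩
  · rw [Ideal.span_le]
    rintro x (rfl | rfl) <;> exact mem_maxIdeal.2 (by simp)

theorem X_mem_maxIdeal (i : Fin 2) : (MvPowerSeries.X i : MvPowerSeries (Fin 2) K) ∈ maxIdeal K :=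
  mem_maxIdeal.2 (by simp)

/-- Power series are polynomials modulo any power of the maximal ideal. -/
theorem exists_polynomial_sub_mem (h : MvPowerSeries (Fin 2) K) (N : ℕ) :
    ∃ p ∈ Algebra.adjoin K {MvPowerSeries.X 0, (MvPowerSeries.X 1 : MvPowerSeries (Fin 2) K)},
      h - p ∈ maxIdeal K ^ N := by
  set S := Algebra.adjoin K {MvPowerSeries.X 0, (MvPowerSeries.X 1 : MvPowerSeries (Fin 2) K)}
  have h0 : (MvPowerSeries.X 0 : MvPowerSeries (Fin 2) K) ∈ S := Algebra.subset_adjoin (by simp)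
  have h1 : (MvPowerSeries.X 1 : MvPowerSeries (Fin 2) K) ∈ S := Algebra.subset_adjoin (by simp)
  induction N generalizing h with
  | zero => exact ⟨0, S.zero_mem, by simp⟩
  | succ N ih =>
    obtain ⟨a, b, e⟩ := exists_eq_C_add h
    obtain ⟨p, hp, hp'⟩ := ih a
    obtain ⟨q, hq, hq'⟩ := ih b
    refine ⟨algebraMap K _ (MvPowerSeries.constantCoeff h) +
      (MvPowerSeries.X 0 * p + MvPowerSeries.X 1 * q), S.add_mem (S.algebraMap_mem _)
        (S.add_mem (S.mul_mem h0 hp) (S.mul_mem h1 hq)), ?_⟩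
    have : h - (algebraMap K _ (MvPowerSeries.constantCoeff h) +
        (MvPowerSeries.X 0 * p + MvPowerSeries.X 1 * q)) =
        MvPowerSeries.X 0 * (a - p) + MvPowerSeries.X 1 * (b - q) := by
      linear_combination e
    rw [this, pow_succ']
    exact Ideal.add_mem _ (Ideal.mul_mem_mul (X_mem_maxIdeal 0) hp')
      (Ideal.mul_mem_mul (X_mem_maxIdeal 1) hq')

/-- No continuity is assumed: if the image of h had constant term c ≠ 0, the unit h - c would be
mapped to a non-unit. -/
theorem constantCoeff_algHom (φ : MvPowerSeries (Fin 2) K →ₐ[K] K⟦X⟧)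
    {h : MvPowerSeries (Fin 2) K} (hh : h ∈ maxIdeal K) : constantCoeff (φ h) = 0 := by
  by_contra hc
  set c := constantCoeff (φ h)
  have h1 : IsUnit (h - algebraMap K _ c) := by
    rw [MvPowerSeries.isUnit_iff_constantCoeff, map_sub, mem_maxIdeal.1 hh]
    simpa [MvPowerSeries.algebraMap_apply] using hc
  have h2 := h1.map φ
  rw [map_sub, AlgHom.commutes, PowerSeries.isUnit_iff_constantCoeff] at h2
  simp [c] at h2

theorem X_pow_dvd_algHom (φ : MvPowerSeries (Fin 2) K →ₐ[K] K⟦X⟧) {N : ℕ}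
    {h : MvPowerSeries (Fin 2) K} (hh : h ∈ maxIdeal K ^ N) : (X : K⟦X⟧) ^ N ∣ φ h := by
  have : Ideal.map φ (maxIdeal K ^ N) ≤ Ideal.span {X ^ N} := by
    rw [Ideal.map_pow, ← Ideal.span_singleton_pow]
    apply Ideal.pow_right_mono
    rw [Ideal.map_le_iff_le_comap]
    intro a ha
    exact Ideal.mem_span_singleton.2 (PowerSeries.X_dvd_iff.2 (constantCoeff_algHom φ ha))
  exact Ideal.mem_span_singleton.1 (this (Ideal.mem_map_of_mem _ hh))

theorem eq_of_forall_X_pow_dvd {a b : K⟦X⟧} (h : ∀ N : ℕ, (X : K⟦X⟧) ^ N ∣ a - b) : a = b := by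
  ext n
  have := PowerSeries.X_pow_dvd_iff.1 (h (n + 1)) n (by omega)
  rwa [map_sub, sub_eq_zero] at this

/-- Homomorphisms from `K[[X,Y]]` to `K[[t]]` are determined by the images of `X` and `Y`. -/
theorem algHom_ext_of_X {φ ψ : MvPowerSeries (Fin 2) K →ₐ[K] K⟦X⟧}
    (h0 : φ (MvPowerSeries.X 0) = ψ (MvPowerSeries.X 0))
    (h1 : φ (MvPowerSeries.X 1) = ψ (MvPowerSeries.X 1)) : φ = ψ := by
  ext1 h
  refine eq_of_forall_X_pow_dvd fun N => ?_
  obtain ⟨p, hp, hp'⟩ := exists_polynomial_sub_mem h N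
  have e : φ p = ψ p := by
    have : Algebra.adjoin K {MvPowerSeries.X 0, (MvPowerSeries.X 1 : MvPowerSeries (Fin 2) K)} ≤
        AlgHom.equalizer φ ψ := by
      rw [Algebra.adjoin_le_iff]
      rintro x (rfl | rfl) <;> assumption
    exact this hp
  have : φ h - ψ h = φ (h - p) - ψ (h - p) := by rw [map_sub, map_sub, e]; ring
  rw [this]
  exact dvd_sub (X_pow_dvd_algHom φ hp') (X_pow_dvd_algHom ψ hp')

theorem X_pow_dvd_of_ne_zero {x : K⟦X⟧} (hx : x ≠ 0) : x ∣ X ^ x.order.toNat := by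
  obtain ⟨y, hy⟩ := PowerSeries.X_pow_order_dvd (φ := x)
  have hu : IsUnit y := by
    rw [PowerSeries.isUnit_iff_constantCoeff, isUnit_iff_ne_zero]
    intro h0
    obtain ⟨z, rfl⟩ := PowerSeries.X_dvd_iff.2 h0
    have h1 : X ^ (x.order.toNat + 1) ∣ x := ⟨z, by rw [pow_succ, mul_assoc]; exact hy⟩
    have h2 := PowerSeries.nat_le_order _ _ fun i hi => PowerSeries.X_pow_dvd_iff.1 h1 i hi
    have h3 := ENat.toNat_le_toNat h2 (PowerSeries.order_eq_top.not.2 hx)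
    rw [ENat.toNat_natCast] at h3
    omega
  obtain ⟨v, rfl⟩ := hu
  exact ⟨(v⁻¹ : (K⟦X⟧)ˣ), by conv_rhs => rw [hy]
                             rw [mul_assoc, Units.mul_inv, mul_one]⟩

/-- A separated `K[[X]]`-algebra is generated as a module by elements generating it modulo `X`. -/
theorem exists_sum_mul_of_separated {S : Type*} [CommRing S] (ρ : K⟦X⟧ →+* S)
    (hsep : ∀ m : S, (∀ N : ℕ, ρ X ^ N ∣ m) → m = 0) {n : ℕ} (v : Fin n → S)
    (hv : ∀ m : S, ∃ (c : Fin n → K) (m' : S), m = ∑ i, ρ (C (c i)) * v i + ρ X * m') (m : S) :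
    ∃ a : Fin n → K⟦X⟧, m = ∑ i, ρ (a i) * v i := by
  -- Successive division by `ρ X`: `z N` is the N-th remainder, and `tl N` collects the digits from
  -- the N-th on. Only K[[X]] has to be complete; for S separatedness suffices.
  choose c f hf using hv
  let z : ℕ → S := fun k => f^[k] m
  let tl : ℕ → Fin n → K⟦X⟧ := fun N i => PowerSeries.mk fun k => c (z (N + k)) i
  have ha : ∀ N i, tl N i = C (c (z N) i) + X * tl (N + 1) i := by
    intro N i
    ext k
    cases k with
    | zero => simp [tl]
    | succ k =>
      rw [map_add, PowerSeries.coeff_succ_X_mul]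
      simp only [coeff_mk, coeff_C, Nat.add_eq_zero_iff, one_ne_zero, and_false, ↓reduceIte,
        zero_add, tl]
      congr 2
      ring
  have key : ∀ N, m - ∑ i, ρ (tl 0 i) * v i = ρ X ^ N * (z N - ∑ i, ρ (tl N i) * v i) := by
    intro N
    induction N with
    | zero => simp [z]
    | succ N ih =>
      have h1 : z N = ∑ i, ρ (C (c (z N) i)) * v i + ρ X * z (N + 1) := by
        conv_lhs => rw [hf (z N)]
        simp only [z, Function.iterate_succ_apply']
      have h2 : ∑ i, ρ (tl N i) * v i =
          ∑ i, ρ (C (c (z N) i)) * v i + ρ X * ∑ i, ρ (tl (N + 1) i) * v i := by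
        rw [Finset.mul_sum, ← Finset.sum_add_distrib]
        refine Finset.sum_congr rfl fun i _ => ?_
        rw [ha N i, map_add, map_mul]
        ring
      rw [ih, h2]
      linear_combination ρ X ^ N * h1
  exact ⟨tl 0, sub_eq_zero.1 (hsep _ fun N => ⟨_, key N⟩)⟩

theorem _root_.RingHom.Finite.of_forall_exists_sum {A S : Type*} [CommRing A] [CommRing S]
    {ρ : A →+* S} {n : ℕ} (v : Fin n → S) (h : ∀ z, ∃ a : Fin n → A, z = ∑ i, ρ (a i) * v i) :
    ρ.Finite := by
  classical
  let := ρ.toAlgebra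
  refine ⟨⟨Finset.univ.image v, ?_⟩⟩
  rw [eq_top_iff]
  rintro z -
  obtain ⟨a, rfl⟩ := h z
  exact Submodule.sum_mem _ fun i _ => Submodule.smul_mem _ (a i) (Submodule.subset_span (by simp))

theorem _root_.RingHom.Finite.pi {ι A : Type*} [Finite ι] [CommRing A] {S : ι → Type*}
    [∀ i, CommRing (S i)] {ρ : ∀ i, A →+* S i} (h : ∀ i, (ρ i).Finite) :
    (RingHom.pi ρ).Finite := by
  let (i : ι) := (ρ i).toAlgebra
  have (i : ι) : Module.Finite A (S i) := h i
  exact (inferInstance : Module.Finite A (∀ i, S i))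

theorem map_C_algHom {S : Type*} [CommRing S] [Algebra K S] (ρ : K⟦X⟧ →ₐ[K] S) (c : K) :
    ρ (C c) = algebraMap K S c := by
  rw [← ρ.commutes c, PowerSeries.algebraMap_apply, Algebra.algebraMap_self, RingHom.id_apply]

/-- `K[[t]]` is generated by `1, …, t^{n-1}` over `K[[x]]` when `x` has order `n > 0`. -/
theorem exists_sum_mul_X_pow {ρ : K⟦X⟧ →ₐ[K] K⟦X⟧} (h0 : constantCoeff (ρ X) = 0) (h : ρ X ≠ 0)
    (z : K⟦X⟧) : ∃ a : Fin (ρ X).order.toNat → K⟦X⟧, z = ∑ i, ρ (a i) * X ^ (i : ℕ) := by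
  set n := (ρ X).order.toNat
  refine exists_sum_mul_of_separated (ρ : K⟦X⟧ →+* K⟦X⟧) (fun m hm => ?_)
    (fun i : Fin n => X ^ (i : ℕ)) (fun m => ?_) z
  · refine eq_of_forall_X_pow_dvd fun N => ?_
    rw [sub_zero]
    exact (pow_dvd_pow_of_dvd (PowerSeries.X_dvd_iff.2 h0) N).trans (hm N)
  · have hd : X ^ n ∣ m - ∑ i : Fin n, C (coeff (i : ℕ) m) * X ^ (i : ℕ) := by
      rw [PowerSeries.X_pow_dvd_iff]
      intro k hk
      rw [map_sub, map_sum, Finset.sum_eq_single (⟨k, hk⟩ : Fin n)]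
      · simp
      · intro b _ hb
        simp only [PowerSeries.coeff_C_mul, PowerSeries.coeff_X_pow]
        rw [if_neg, mul_zero]
        rintro rfl
        exact hb rfl
      · simp
    obtain ⟨q, hq⟩ := (X_pow_dvd_of_ne_zero h).trans hd
    refine ⟨fun i => coeff (i : ℕ) m, q, ?_⟩
    simp only [RingHom.coe_coe, map_C_algHom]
    exact (eq_add_of_sub_eq' hq).trans (by simp)

theorem finite_of_order_pos {ρ : K⟦X⟧ →ₐ[K] K⟦X⟧} (h0 : constantCoeff (ρ X) = 0) (h : ρ X ≠ 0) :
    (ρ : K⟦X⟧ →+* K⟦X⟧).Finite :=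
  .of_forall_exists_sum _ (exists_sum_mul_X_pow h0 h)

/-- Subalgebras of a finite algebra over a Noetherian local ring are closed. -/
theorem mem_of_forall_exists_add_pow_mul {A S : Type*} [CommRing A] [IsNoetherianRing A]
    [IsLocalRing A] [CommRing S] {ρ : A →+* S} (hρ : ρ.Finite) (D : Subring S) (hD : ρ.range ≤ D)
    {r : A} (hr : r ∈ IsLocalRing.maximalIdeal A) {w : S}
    (h : ∀ N : ℕ, ∃ d ∈ D, ∃ s, w = d + ρ r ^ N * s) : w ∈ D := by
  let := ρ.toAlgebra
  have : Module.Finite A S := hρ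
  let D' : Submodule A S :=
    { D.toAddSubgroup with
      smul_mem' := fun a x hx => D.mul_mem (hD ⟨a, rfl⟩) hx }
  -- Krull's intersection theorem for the finite A-module S / D.
  have h1 := Ideal.iInf_pow_smul_eq_bot_of_isLocalRing (M := S ⧸ D') (IsLocalRing.maximalIdeal A)
    (Ideal.IsPrime.ne_top inferInstance)
  have h2 : D'.mkQ w ∈ ⨅ i : ℕ, IsLocalRing.maximalIdeal A ^ i • (⊤ : Submodule A (S ⧸ D')) := by
    rw [Submodule.mem_iInf]
    intro N
    obtain ⟨d, hd, s, e⟩ := h N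
    have h3 : D'.mkQ w = r ^ N • D'.mkQ s := by
      rw [← map_smul, Submodule.mkQ_apply, Submodule.mkQ_apply, Submodule.Quotient.eq,
        show r ^ N • s = ρ r ^ N * s by rw [← map_pow]; rfl, e, add_sub_cancel_right]
      exact hd
    rw [h3]
    exact Submodule.smul_mem_smul (Ideal.pow_mem_pow hr N) trivial
  rw [h1, Submodule.mem_bot, Submodule.mkQ_apply, Submodule.Quotient.mk_eq_zero] at h2
  exact h2

end PowerSeriesGeneralities

end PlaneCurve

namespace PlaneCurve

universe u
variable {K : Type u} [Field K]

/-! ### Families of parametrizations and the rings K[[x]][z] -/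

section Parametrizations

open PowerSeries

variable (K) in
/-- A parametrized (possibly degenerate) plane curve germ. -/
structure Param where
  u : K⟦X⟧
  v : K⟦X⟧
  hu : constantCoeff u = 0
  hv : constantCoeff v = 0

namespace Param

theorem hasSubst (p : Param K) :
    MvPowerSeries.HasSubst (![p.u, p.v] : Fin 2 → MvPowerSeries Unit K) :=
  MvPowerSeries.hasSubst_of_constantCoeff_zero fun i => by
    fin_cases i
    · exact p.hu
    · exact p.hv

/-- Substitution of a parametrization into power series in two variables. -/
noncomputable def ev (p : Param K) : MvPowerSeries (Fin 2) K →ₐ[K] K⟦X⟧ :=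
  MvPowerSeries.substAlgHom p.hasSubst

@[simp]
theorem ev_X_zero (p : Param K) : p.ev (MvPowerSeries.X 0) = p.u :=
  MvPowerSeries.substAlgHom_X p.hasSubst 0

@[simp]
theorem ev_X_one (p : Param K) : p.ev (MvPowerSeries.X 1) = p.v :=
  MvPowerSeries.substAlgHom_X p.hasSubst 1

theorem ev_toMvPowerSeries_zero (p : Param K) (a : K⟦X⟧) :
    p.ev (a.toMvPowerSeries 0) = a.subst p.u := by
  rw [ev, MvPowerSeries.substAlgHom_apply, PowerSeries.subst_toMvPowerSeries p.hasSubst]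
  rfl

variable {ι : Type*}

/-- Simultaneous substitution of several parametrizations. -/
noncomputable def evPi (P : ι → Param K) : MvPowerSeries (Fin 2) K →ₐ[K] (ι → K⟦X⟧) :=
  AlgHom.pi fun i => (P i).ev

@[simp]
theorem evPi_apply (P : ι → Param K) (h : MvPowerSeries (Fin 2) K) (i : ι) :
    evPi P h i = (P i).ev h := rfl

/-- Substitution of the first coordinates into power series in one variable. -/
noncomputable def base (P : ι → Param K) : K⟦X⟧ →ₐ[K] (ι → K⟦X⟧) :=
  (evPi P).comp (toMvPowerSeries 0)

theorem base_apply (P : ι → Param K) (a : K⟦X⟧) :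
    base P a = evPi P (a.toMvPowerSeries 0) := rfl

@[simp]
theorem base_X (P : ι → Param K) : base P X = fun i => (P i).u := by
  ext1 i
  rw [base_apply, toMvPowerSeries_X, evPi_apply, ev_X_zero]

theorem base_congr {P Q : ι → Param K} (h : ∀ i, (Q i).u = (P i).u) : base Q = base P := by
  ext1 a
  ext1 i
  simp only [base_apply, evPi_apply, ev_toMvPowerSeries_zero, h]

theorem base_finite [Finite ι] {P : ι → Param K} (h : ∀ i, (P i).u ≠ 0) :
    (base P : K⟦X⟧ →+* (ι → K⟦X⟧)).Finite := by
  have : (base P : K⟦X⟧ →+* (ι → K⟦X⟧)) =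
      RingHom.pi fun i => ((((P i).ev).comp (toMvPowerSeries 0) : K⟦X⟧ →ₐ[K] K⟦X⟧) :
        K⟦X⟧ →+* K⟦X⟧) := rfl
  rw [this]
  refine .pi fun i => finite_of_order_pos ?_ ?_ <;>
    rw [AlgHom.comp_apply, toMvPowerSeries_X, ev_X_zero]
  exacts [(P i).hu, h i]

theorem exists_evPi_eq_add_pow_mul [Finite ι] (P : ι → Param K) {x : ι → K⟦X⟧}
    (hx : ∀ i, x i ≠ 0) (h : MvPowerSeries (Fin 2) K) (N : ℕ) :
    ∃ p ∈ Algebra.adjoin K {MvPowerSeries.X 0, (MvPowerSeries.X 1 : MvPowerSeries (Fin 2) K)},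
      ∃ s, evPi P h = evPi P p + x ^ N * s := by
  have := Fintype.ofFinite ι
  obtain ⟨p, hp, hp'⟩ := exists_polynomial_sub_mem h ((∑ i, (x i).order.toNat) * N)
  have hd : ∀ i, x i ^ N ∣ (P i).ev (h - p) := fun i => by
    refine dvd_trans ?_ (X_pow_dvd_algHom _ hp')
    rw [pow_mul]
    exact pow_dvd_pow_of_dvd ((X_pow_dvd_of_ne_zero (hx i)).trans
      (pow_dvd_pow _ (Finset.single_le_sum (f := fun i => (x i).order.toNat)
        (fun _ _ => Nat.zero_le _) (Finset.mem_univ i)))) N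
  choose s hs using hd
  refine ⟨p, hp, s, ?_⟩
  ext1 i
  have := hs i
  rw [map_sub] at this
  exact eq_add_of_sub_eq' this

theorem map_adjoin_le (P : ι → Param K) {D : Subring (ι → K⟦X⟧)}
    (hD : (base P : K⟦X⟧ →+* (ι → K⟦X⟧)).range ≤ D) (hv : (fun i => (P i).v) ∈ D)
    {p : MvPowerSeries (Fin 2) K} (hp : p ∈ Algebra.adjoin K
      {MvPowerSeries.X 0, (MvPowerSeries.X 1 : MvPowerSeries (Fin 2) K)}) : evPi P p ∈ D := by
  induction hp using Algebra.adjoin_induction with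
  | mem x hx =>
    rcases hx with rfl | rfl
    · exact hD ⟨X, by simp only [RingHom.coe_coe, base_X]; ext1 i; simp⟩
    · have : evPi P (MvPowerSeries.X 1) = fun i => (P i).v := by ext1 i; simp
      rwa [this]
  | algebraMap r =>
    rw [AlgHom.commutes, ← (base P).commutes]
    exact hD ⟨_, rfl⟩
  | add x y _ _ hx hy => rw [map_add]; exact D.add_mem hx hy
  | mul x y _ _ hx hy => rw [map_mul]; exact D.mul_mem hx hy

/-- The ring generated over `K[[x]]` by an element `z`, where `x` is the first coordinate. -/
noncomputable def adjoin (P : ι → Param K) (z : ι → K⟦X⟧) : Subring (ι → K⟦X⟧) :=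
  (Polynomial.eval₂RingHom (base P : K⟦X⟧ →+* (ι → K⟦X⟧)) z).range

theorem base_range_le_adjoin (P : ι → Param K) (z : ι → K⟦X⟧) :
    (base P : K⟦X⟧ →+* (ι → K⟦X⟧)).range ≤ adjoin P z := by
  rintro _ ⟨a, rfl⟩
  exact ⟨Polynomial.C a, by simp⟩

theorem self_mem_adjoin (P : ι → Param K) (z : ι → K⟦X⟧) : z ∈ adjoin P z :=
  ⟨Polynomial.X, by simp⟩

theorem algebraMap_mem_adjoin (P : ι → Param K) (z : ι → K⟦X⟧) (c : K) :
    algebraMap K _ c ∈ adjoin P z :=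
  base_range_le_adjoin P z ⟨C c, map_C_algHom (base P) c⟩

theorem evPi_mem_of_mem [Finite ι] {P Q : ι → Param K} (h : ∀ i, (P i).u ≠ 0)
    (hu : ∀ i, (Q i).u = (P i).u) {z : ι → K⟦X⟧} (hv : (fun i => (Q i).v) ∈ adjoin P z)
    (g : MvPowerSeries (Fin 2) K) : evPi Q g ∈ adjoin P z := by
  refine mem_of_forall_exists_add_pow_mul (base_finite h) (adjoin P z) (base_range_le_adjoin P z)
    (r := X) ?_ fun N => ?_
  · rw [PowerSeries.maximalIdeal_eq_span_X]
    exact Ideal.mem_span_singleton_self _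
  · obtain ⟨p, hp, s, e⟩ := exists_evPi_eq_add_pow_mul Q (x := fun i => (P i).u) h g N
    refine ⟨_, map_adjoin_le Q ?_ hv hp, s, ?_⟩
    · rw [base_congr hu]
      exact base_range_le_adjoin P z
    · rw [e, RingHom.coe_coe, base_X]

/-- The product of the K[[t]] is finite over K[[x]], so K[[x]][z] is closed in it and contains all
power series in x and z - c, not only the polynomials in z. The constant c has to be the same for
all components. -/
theorem range_evPi_eq_adjoin [Finite ι] {P Q : ι → Param K} (h : ∀ i, (P i).u ≠ 0)
    (hu : ∀ i, (Q i).u = (P i).u) {z : ι → K⟦X⟧} {c : K} (hv : ∀ i, z i = (Q i).v + C c) :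
    (evPi Q : MvPowerSeries (Fin 2) K →+* (ι → K⟦X⟧)).range = adjoin P z := by
  apply le_antisymm
  · rintro _ ⟨g, rfl⟩
    refine evPi_mem_of_mem h hu ?_ g
    have : (fun i => (Q i).v) = z - algebraMap K _ c := by
      ext1 i
      rw [Pi.sub_apply, hv i, Pi.algebraMap_apply, PowerSeries.algebraMap_apply]
      simp
    rw [this]
    exact sub_mem (self_mem_adjoin P z) (algebraMap_mem_adjoin P z c)
  · rintro _ ⟨p, rfl⟩
    rw [Polynomial.coe_eval₂RingHom, Polynomial.eval₂_eq_sum_range]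
    refine Subring.sum_mem _ fun i _ => Subring.mul_mem _ ?_ (Subring.pow_mem _ ?_ _)
    · rw [← base_congr hu]
      exact ⟨_, rfl⟩
    · refine ⟨MvPowerSeries.X 1 + algebraMap K _ c, ?_⟩
      rw [RingHom.coe_coe, map_add, AlgHom.commutes]
      ext1 i
      rw [Pi.add_apply, evPi_apply, ev_X_one, hv i, Pi.algebraMap_apply,
        PowerSeries.algebraMap_apply]
      simp

/-- Since z = y/x is integral over K[[x]], every element of K[[x]][z] is a polynomial in z of degree
less than m; multiplication by x^m turns z^l into x^(m-l) y^l. -/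
theorem exists_pow_mul_mem [Finite ι] {P : ι → Param K} (h : ∀ i, (P i).u ≠ 0) {z : ι → K⟦X⟧}
    (hz : ∀ i, (P i).v = (P i).u * z i) :
    ∃ m : ℕ, ∀ d ∈ adjoin P z, ∃ g ∈ maxIdeal K ^ m, evPi P g = (fun i => (P i).u) ^ m * d := by
  obtain ⟨q, hq, hq0⟩ := (base_finite h).to_isIntegral z
  refine ⟨q.natDegree + 1, ?_⟩
  rintro _ ⟨p, rfl⟩
  set m := q.natDegree + 1
  have hr : (p %ₘ q).natDegree < m := Nat.lt_succ_of_le (Polynomial.natDegree_modByMonic_le _ hq)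
  have e : Polynomial.eval₂ (base P : K⟦X⟧ →+* (ι → K⟦X⟧)) z p =
      Polynomial.eval₂ (base P : K⟦X⟧ →+* (ι → K⟦X⟧)) z (p %ₘ q) := by
    conv_lhs => rw [← Polynomial.modByMonic_add_div p q]
    rw [Polynomial.eval₂_add, Polynomial.eval₂_mul, hq0, zero_mul, add_zero]
  refine ⟨∑ l ∈ Finset.range m, ((p %ₘ q).coeff l).toMvPowerSeries 0 *
    (MvPowerSeries.X 0 ^ (m - l) * MvPowerSeries.X 1 ^ l), ?_, ?_⟩
  · refine Ideal.sum_mem _ fun l hl => Ideal.mul_mem_left _ _ ?_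
    have : maxIdeal K ^ m = maxIdeal K ^ (m - l) * maxIdeal K ^ l := by
      rw [← pow_add, Nat.sub_add_cancel (Finset.mem_range.1 hl).le]
    rw [this]
    exact Ideal.mul_mem_mul (Ideal.pow_mem_pow (X_mem_maxIdeal 0) _)
      (Ideal.pow_mem_pow (X_mem_maxIdeal 1) _)
  · rw [Polynomial.coe_eval₂RingHom, e, Polynomial.eval₂_eq_sum_range' _ hr, Finset.mul_sum,
      map_sum]
    refine Finset.sum_congr rfl fun l hl => ?_
    ext1 i
    simp only [map_mul, map_pow, RingHom.coe_coe, base_apply, Pi.mul_apply, Pi.pow_apply,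
      evPi_apply, ev_X_zero, ev_X_one, hz]
    rw [mul_pow, ← mul_assoc ((P i).u ^ _), ← pow_add,
      Nat.sub_add_cancel (Finset.mem_range.1 hl).le]
    ring

/-- The n-th power of the maximal ideal is generated by monomials of degree n in x and y = xz, each
of which is x^n times a power of z. -/
theorem exists_eq_pow_mul_of_mem [Finite ι] {P : ι → Param K} (h : ∀ i, (P i).u ≠ 0)
    {z : ι → K⟦X⟧} (hz : ∀ i, (P i).v = (P i).u * z i) (n : ℕ) {g : MvPowerSeries (Fin 2) K}
    (hg : g ∈ maxIdeal K ^ n) : ∃ d ∈ adjoin P z, evPi P g = (fun i => (P i).u) ^ n * d := by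
  have hv : (fun i => (P i).v) ∈ adjoin P z := by
    have : (fun i => (P i).v) = (fun i => (P i).u) * z := funext hz
    rw [this, ← base_X]
    exact mul_mem (base_range_le_adjoin P z ⟨X, rfl⟩) (self_mem_adjoin P z)
  have hall := evPi_mem_of_mem h (fun _ => rfl) hv
  induction n generalizing g with
  | zero => exact ⟨_, hall g, by simp⟩
  | succ n ih =>
    rw [pow_succ] at hg
    induction hg using Submodule.mul_induction_on' with
    | mem_mul_mem a ha b hb =>
      obtain ⟨d, hd, e⟩ := ih ha
      rw [maxIdeal_eq_span] at hb
      obtain ⟨b₀, b₁, rfl⟩ := Ideal.mem_span_pair.1 hb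
      refine ⟨d * (evPi P b₀ + z * evPi P b₁),
        mul_mem hd (add_mem (hall b₀) (mul_mem (self_mem_adjoin P z) (hall b₁))), ?_⟩
      rw [map_mul, e]
      ext1 i
      simp only [map_add, map_mul, Pi.mul_apply, Pi.pow_apply, Pi.add_apply, evPi_apply, ev_X_zero,
        ev_X_one, hz]
      ring
    | add a _ b _ ha hb =>
      obtain ⟨c, hc, e⟩ := ha
      obtain ⟨d, hd, e'⟩ := hb
      exact ⟨c + d, add_mem hc hd, by rw [map_add, e, e', mul_add]⟩

end Param

end Parametrizations

/-! ### The blow-up as K[[x]][y/x] -/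

section BlowupOfParametrizations

open PowerSeries

/-- The image of a local ring is local, and its Jacobson radical is the image of the maximal ideal.
-/
theorem stabilizes_range_iff {O Q : Type*} [CommRing O] [IsLocalRing O] [CommRing Q] [Nontrivial Q]
    (f : O →+* Q) (n : ℕ) (z : Q) :
    Stabilizes f.range n z ↔ ∀ h ∈ IsLocalRing.maximalIdeal O ^ n,
      ∃ h' ∈ IsLocalRing.maximalIdeal O ^ n, z * f h = f h' := by
  have hs := f.rangeRestrict_surjective
  have : IsLocalRing f.range := IsLocalRing.of_surjective' f.rangeRestrict hs
  have hJ : Ring.jacobson f.range ^ n =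
      (IsLocalRing.maximalIdeal O ^ n).map f.rangeRestrict := by
    rw [IsLocalRing.ringJacobson_eq_maximalIdeal, Ideal.map_pow,
      IsLocalRing.map_maximalIdeal_of_surjective _ hs]
  rw [Stabilizes, hJ]
  constructor
  · intro H h hh
    obtain ⟨b, hb, e⟩ := H _ (Ideal.mem_map_of_mem _ hh)
    obtain ⟨h', hh', rfl⟩ := (Ideal.mem_map_iff_of_surjective _ hs).1 hb
    exact ⟨h', hh', e⟩
  · intro H a ha
    obtain ⟨h, hh, rfl⟩ := (Ideal.mem_map_iff_of_surjective _ hs).1 ha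
    obtain ⟨h', hh', e⟩ := H h hh
    exact ⟨_, Ideal.mem_map_of_mem _ hh', e⟩

variable {ι : Type*}

variable (K ι) in
/-- The inclusion of a product of power series rings into its total ring of fractions. -/
noncomputable def emb : (ι → K⟦X⟧) →+* (ι → FractionRing K⟦X⟧) :=
  RingHom.pi fun i => (algebraMap K⟦X⟧ (FractionRing K⟦X⟧)).comp (Pi.evalRingHom _ i)

@[simp]
theorem emb_apply (z : ι → K⟦X⟧) (i : ι) : emb K ι z i = algebraMap _ _ (z i) := rfl

theorem emb_injective : Function.Injective (emb K ι) := fun a b h => by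
  ext1 i
  exact IsFractionRing.injective K⟦X⟧ (FractionRing K⟦X⟧) (congrFun h i)

/-- The ring of a family of parametrizations, in the total ring of fractions. -/
noncomputable def Param.ring (P : ι → Param K) : Subring (ι → FractionRing K⟦X⟧) :=
  ((emb K ι).comp (Param.evPi P : MvPowerSeries (Fin 2) K →+* (ι → K⟦X⟧))).range

/-- Always J^n ⊆ x^n K[[x]][z], and equality holds for the exponent m of `exists_pow_mul_mem`. Hence
K[[x]][z] stabilizes J^m, while an element that stabilizes J^n sends x^n into x^n K[[x]][z]. -/
theorem blowup_ring_eq [Finite ι] [Nonempty ι] {P : ι → Param K} (h : ∀ i, (P i).u ≠ 0)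
    {z : ι → K⟦X⟧} (hz : ∀ i, (P i).v = (P i).u * z i) :
    blowup (Param.ring P) = (Param.adjoin P z).map (emb K ι) := by
  obtain ⟨m, hm⟩ := Param.exists_pow_mul_mem h hz
  have hn := fun n {g} => Param.exists_eq_pow_mul_of_mem h hz n (g := g)
  ext y
  constructor
  · rintro ⟨n, hy⟩
    obtain ⟨g, hg, e⟩ := (stabilizes_range_iff _ n y).1 hy (MvPowerSeries.X 0 ^ n)
      (Ideal.pow_mem_pow (X_mem_maxIdeal 0) n)
    obtain ⟨d, hd, e'⟩ := hn n hg
    refine ⟨d, hd, ?_⟩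
    ext1 i
    have := congrFun e i
    simp only [RingHom.comp_apply, RingHom.coe_coe, e', map_pow, Pi.mul_apply, Pi.pow_apply,
      emb_apply, Param.evPi_apply, Param.ev_X_zero, map_mul] at this
    have h0 : algebraMap K⟦X⟧ (FractionRing K⟦X⟧) (P i).u ^ n ≠ 0 :=
      pow_ne_zero _ (IsFractionRing.to_map_eq_zero_iff.not.2 (h i))
    rw [mul_comm] at this
    exact (mul_left_cancel₀ h0 this).symm
  · rintro ⟨d, hd, rfl⟩
    refine ⟨m, (stabilizes_range_iff _ m _).2 fun g hg => ?_⟩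
    obtain ⟨d', hd', e⟩ := hn m hg
    obtain ⟨g', hg', e'⟩ := hm (d * d') (mul_mem hd hd')
    refine ⟨g', hg', ?_⟩
    rw [RingHom.comp_apply, RingHom.comp_apply, RingHom.coe_coe, e, e', ← map_mul]
    congr 1
    ring

end BlowupOfParametrizations

end PlaneCurve

namespace PlaneCurve

universe u
variable {K : Type u} [Field K]

/-! ### Strict transforms, with equal or different tangents -/

section Steps

open PowerSeries

variable {ι : Type*}

namespace Param

/-- `q` is the strict transform of `p` in the chart of the blow-up belonging to its tangent, given by
the ratio `v / u ∈ K ∪ {∞}`. The first coordinate of `q` defines the exceptional divisor. -/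
def Step : Option K → Param K → Param K → Prop
  | some c, p, q => q.u = p.u ∧ p.v = p.u * (q.v + C c)
  | none, p, q => q.u = p.v ∧ p.u = p.v * q.v

/-- A parametrization is nondegenerate if it is not constant. -/
def Nondeg (p : Param K) : Prop := p.u ≠ 0 ∨ p.v ≠ 0

theorem Step.u_ne_zero {s : Option K} {p q : Param K} (h : Step s p q) (hp : p.Nondeg) :
    q.u ≠ 0 := by
  intro h0
  cases s with
  | none =>
    obtain ⟨h1, h2⟩ := h
    rw [← h1, h0, zero_mul] at h2
    rcases hp with hp | hp
    exacts [hp h2, hp (h1 ▸ h0)]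
  | some c =>
    obtain ⟨h1, h2⟩ := h
    rw [← h1, h0, zero_mul] at h2
    rcases hp with hp | hp
    exacts [hp (h1 ▸ h0), hp h2]

theorem Step.nondeg {s : Option K} {p q : Param K} (h : Step s p q) (hp : p.Nondeg) :
    q.Nondeg := Or.inl (h.u_ne_zero hp)

theorem ring_le_of_eq_ev {P Q : ι → Param K} {a b : MvPowerSeries (Fin 2) K} (ha : a ∈ maxIdeal K)
    (hb : b ∈ maxIdeal K) (hu : ∀ i, (Q i).u = (P i).ev a) (hv : ∀ i, (Q i).v = (P i).ev b) :
    ring Q ≤ ring P := by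
  have hs : MvPowerSeries.HasSubst (![a, b] : Fin 2 → MvPowerSeries (Fin 2) K) :=
    MvPowerSeries.hasSubst_of_constantCoeff_zero fun i => by
      fin_cases i
      exacts [mem_maxIdeal.1 ha, mem_maxIdeal.1 hb]
  let σ : MvPowerSeries (Fin 2) K →ₐ[K] MvPowerSeries (Fin 2) K := MvPowerSeries.substAlgHom hs
  have h0 : σ (MvPowerSeries.X 0) = a := MvPowerSeries.substAlgHom_X hs 0
  have h1 : σ (MvPowerSeries.X 1) = b := MvPowerSeries.substAlgHom_X hs 1
  have key : ∀ i, (Q i).ev = (P i).ev.comp σ := fun i => by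
    apply algHom_ext_of_X
    · rw [AlgHom.comp_apply, h0, ev_X_zero, hu]
    · rw [AlgHom.comp_apply, h1, ev_X_one, hv]
  rintro _ ⟨g, rfl⟩
  refine ⟨σ g, ?_⟩
  simp only [RingHom.comp_apply, RingHom.coe_coe]
  congr 1
  ext1 i
  rw [evPi_apply, evPi_apply, key i, AlgHom.comp_apply]

/-- Interchanging the coordinates. -/
def swap (p : Param K) : Param K := ⟨p.v, p.u, p.hv, p.hu⟩

theorem ring_swap (P : ι → Param K) : ring (fun i => (P i).swap) = ring P :=
  le_antisymm
    (ring_le_of_eq_ev (X_mem_maxIdeal 1) (X_mem_maxIdeal 0) (fun i => by simp [swap])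
      fun i => by simp [swap])
    (ring_le_of_eq_ev (X_mem_maxIdeal 1) (X_mem_maxIdeal 0) (fun i => by simp [swap])
      fun i => by simp [swap])

/-- The linear coordinate change `u ↦ u + l v`. -/
noncomputable def shear (l : K) (p : Param K) : Param K :=
  ⟨p.u + C l * p.v, p.v, by simp [p.hu, p.hv], p.hv⟩

theorem ev_C (p : Param K) (c : K) : p.ev (algebraMap K _ c) = C c := by
  rw [AlgHom.commutes, PowerSeries.algebraMap_apply, Algebra.algebraMap_self, RingHom.id_apply]

theorem ring_shear (l : K) (P : ι → Param K) : ring (fun i => (P i).shear l) = ring P := by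
  refine le_antisymm
    (ring_le_of_eq_ev (a := MvPowerSeries.X 0 + algebraMap K _ l * MvPowerSeries.X 1)
      (Ideal.add_mem _ (X_mem_maxIdeal 0) (Ideal.mul_mem_left _ _ (X_mem_maxIdeal 1)))
      (X_mem_maxIdeal 1) (fun i => ?_) fun i => ?_)
    (ring_le_of_eq_ev (a := MvPowerSeries.X 0 - algebraMap K _ l * MvPowerSeries.X 1)
      (Ideal.sub_mem _ (X_mem_maxIdeal 0) (Ideal.mul_mem_left _ _ (X_mem_maxIdeal 1)))
      (X_mem_maxIdeal 1) (fun i => ?_) fun i => ?_)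
  · rw [map_add, map_mul, ev_C]; simp [shear]
  · simp [shear]
  · rw [map_sub, map_mul, ev_C]; simp [shear]
  · simp [shear]

theorem ring_eq_map (P : ι → Param K) :
    ring P = ((evPi P : MvPowerSeries (Fin 2) K →+* (ι → K⟦X⟧)).range).map (emb K ι) :=
  (RingHom.map_range _ _).symm

end Param

open Param

/-- Blowing up parametrizations with a common tangent. -/
theorem blowup_ring_of_step [Finite ι] [Nonempty ι] {P Q : ι → Param K} {s : Option K}
    (h : ∀ i, Step s (P i) (Q i)) (hP : ∀ i, (P i).Nondeg) : blowup (ring P) = ring Q := by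
  have hQ : ∀ i, (Q i).u ≠ 0 := fun i => (h i).u_ne_zero (hP i)
  cases s with
  | none =>
    have hv : ∀ i, (P i).swap.u ≠ 0 := fun i => (h i).1.symm.trans_ne (hQ i)
    rw [← ring_swap P, blowup_ring_eq (z := fun i => (Q i).v) hv (fun i => (h i).2), ring_eq_map,
      range_evPi_eq_adjoin (c := 0) (P := fun i => (P i).swap) hv (fun i => (h i).1)
        (z := fun i => (Q i).v) (by simp)]
  | some c =>
    rw [blowup_ring_eq (z := fun i => (Q i).v + C c) (fun i => (h i).1 ▸ hQ i)
      (fun i => (h i).2), ring_eq_map, range_evPi_eq_adjoin (c := c) (P := P)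
      (fun i => (h i).1 ▸ hQ i) (fun i => (h i).1) (fun _ => rfl)]

/-- Blowing up parametrizations with different tangents. -/
theorem exists_mem_blowup_of_step_ne [Infinite K] [Finite ι] {P Q : ι → Param K}
    {s : ι → Option K} (h : ∀ i, Step (s i) (P i) (Q i)) (hP : ∀ i, (P i).Nondeg) {i j : ι}
    (hij : s i ≠ s j) :
    ∃ d : ι → K⟦X⟧, emb K ι d ∈ blowup (ring P) ∧ constantCoeff (d i) ≠ constantCoeff (d j) := by
  have := Fintype.ofFinite ι
  have : Nonempty ι := ⟨i⟩
  classical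
  -- With l ≠ 0 and 1 + lc ≠ 0 for all finite tangents c, the coordinate u + lv is transversal to
  -- every component, so one chart serves all of them. For the tangents 0 and ∞ the value excluded
  -- by the image is again 0.
  obtain ⟨l, hl⟩ := Infinite.exists_notMem_finset
    (insert (0 : K) (Finset.univ.image fun i => - ((s i).getD 0)⁻¹))
  simp only [Finset.mem_insert, Finset.mem_image, Finset.mem_univ, true_and, not_or,
    not_exists] at hl
  obtain ⟨hl0, hl⟩ := hl
  have key : ∀ i, ∃ (z w : K⟦X⟧), (P i).v = ((P i).u + C l * (P i).v) * z ∧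
      (Q i).u = ((P i).u + C l * (P i).v) * w ∧
      constantCoeff z = (s i).elim l⁻¹ fun c => c / (1 + l * c) := by
    intro i
    have hi := h i
    have hli := hl i
    cases hs : s i with
    | none =>
      rw [hs] at hi
      have hc : constantCoeff ((Q i).v + C l) ≠ 0 := by simpa [(Q i).hv] using hl0
      refine ⟨((Q i).v + C l)⁻¹, ((Q i).v + C l)⁻¹, ?_, ?_, ?_⟩
      · conv_rhs => rw [hi.2, show (P i).v * (Q i).v + C l * (P i).v =
          (P i).v * ((Q i).v + C l) by ring, mul_assoc, PowerSeries.mul_inv_cancel _ hc, mul_one]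
      · rw [hi.1]
        conv_rhs => rw [hi.2, show (P i).v * (Q i).v + C l * (P i).v =
          (P i).v * ((Q i).v + C l) by ring, mul_assoc, PowerSeries.mul_inv_cancel _ hc, mul_one]
      · simp [(Q i).hv]
    | some c =>
      rw [hs] at hi hli
      have hc0 : 1 + l * c ≠ 0 := by
        intro h0
        have hc : c ≠ 0 := by rintro rfl; simp at h0
        apply hli
        rw [Option.getD_some]
        field_simp
        linear_combination -h0
      have hc : constantCoeff (1 + C l * ((Q i).v + C c)) ≠ 0 := by simpa [(Q i).hv] using hc0
      have e : (P i).u + C l * (P i).v = (P i).u * (1 + C l * ((Q i).v + C c)) := by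
        rw [hi.2]; ring
      refine ⟨((Q i).v + C c) * (1 + C l * ((Q i).v + C c))⁻¹, (1 + C l * ((Q i).v + C c))⁻¹,
        ?_, ?_, ?_⟩
      · rw [e, mul_mul_mul_comm, PowerSeries.mul_inv_cancel _ hc, mul_one, hi.2]
      · rw [e, mul_assoc, PowerSeries.mul_inv_cancel _ hc, mul_one, hi.1]
      · simp [(Q i).hv, div_eq_mul_inv]
  choose z w hz hw hc using key
  refine ⟨z, ?_, fun h0 => hij ?_⟩
  · rw [← ring_shear l, blowup_ring_eq (z := z) (fun i hi => ?_) hz]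
    · exact ⟨z, self_mem_adjoin _ z, rfl⟩
    · have := (h i).u_ne_zero (hP i)
      rw [hw i] at this
      exact this (by rw [show (P i).u + C l * (P i).v = 0 from hi, zero_mul])
  -- The Möbius map c ↦ c / (1 + lc), ∞ ↦ 1/l is injective, so different tangents give different
  -- residues of z.
  · rw [hc, hc] at h0
    have hd : ∀ i c, s i = some c → 1 + l * c ≠ 0 := by
      intro i c hs h1
      have hc : c ≠ 0 := by rintro rfl; simp at h1
      apply hl i
      rw [hs, Option.getD_some]
      field_simp
      linear_combination -h1
    have h3 := inv_mul_cancel₀ hl0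
    cases hi : s i with
    | none =>
      cases hj : s j with
      | none => rfl
      | some c =>
        rw [hi, hj, Option.elim_none, Option.elim_some, eq_div_iff (hd j c hj)] at h0
        exact absurd (by linear_combination h0 - c * h3) (inv_ne_zero hl0)
    | some c =>
      cases hj : s j with
      | none =>
        rw [hi, hj, Option.elim_none, Option.elim_some, eq_comm, eq_div_iff (hd i c hi)] at h0
        exact absurd (by linear_combination h0 - c * h3) (inv_ne_zero hl0)
      | some c' =>
        rw [hi, hj, Option.elim_some, Option.elim_some, div_eq_div_iff (hd i c hi) (hd j c' hj)]
          at h0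
        congr 1
        linear_combination h0

theorem isLocalRing_ring [Nonempty ι] (P : ι → Param K) : IsLocalRing (ring P) :=
  IsLocalRing.of_surjective' _ (RingHom.rangeRestrict_surjective
    ((emb K ι).comp (evPi P : MvPowerSeries (Fin 2) K →+* (ι → K⟦X⟧))))

end Steps

/-! ### Conductors, total rings of fractions, and persistence of non-locality -/

section Conductor

open PowerSeries

variable {ι : Type*}

/-- The conductor of `S` in the product of power series rings is not contained in any minimal prime. -/
def HasConductor (S : Subring (ι → FractionRing K⟦X⟧)) : Prop :=
  ∃ N : ℕ, ∀ z : ι → K⟦X⟧, emb K ι (fun i => X ^ N * z i) ∈ S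

theorem HasConductor.mono {S S' : Subring (ι → FractionRing K⟦X⟧)} (h : HasConductor S)
    (hS : S ≤ S') : HasConductor S' :=
  h.imp fun _ h z => hS (h z)

theorem le_blowup {Q : Type*} [CommRing Q] (S : Subring Q) : S ≤ blowup S :=
  fun z hz => ⟨0, fun a _ => ⟨⟨z, hz⟩ * a, by simp, rfl⟩⟩

/-- The element t^(N+1) lies in the Jacobson radical: the inverse of 1 + t^(N+1) b in the product of
power series rings is 1 - t^(N+1) b g for some g, and this belongs to S because t^N times anything
does. -/
theorem exists_ne_zero_of_jacobson {S : Subring (ι → FractionRing K⟦X⟧)} (hS : S ≤ (emb K ι).range)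
    (h : HasConductor S) (n : ℕ) (i : ι) :
    ∃ a : ι → K⟦X⟧, a i ≠ 0 ∧ ∃ ha : emb K ι a ∈ S, (⟨_, ha⟩ : S) ∈ Ring.jacobson S ^ n := by
  obtain ⟨N, hN⟩ := h
  let τ : ι → K⟦X⟧ := fun _ => X ^ N * X
  have hτ : (⟨_, hN fun _ => X⟩ : S) ∈ Ring.jacobson S := by
    rw [← Ideal.jacobson_bot, Ideal.mem_jacobson_bot]
    rintro ⟨y, hy⟩
    obtain ⟨b, rfl⟩ := hS hy
    have hc : ∀ j, constantCoeff (X ^ N * X * b j + 1) ≠ 0 := fun j => by simp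
    let g : ι → K⟦X⟧ := fun j => (X ^ N * X * b j + 1)⁻¹
    refine IsUnit.of_mul_eq_one
      (⟨_, sub_mem S.one_mem (hN fun j => X * b j * g j)⟩ : S) (Subtype.ext ?_)
    simp only [Subring.coe_mul, Subring.coe_add, Subring.coe_one, ← map_mul, ← map_sub, ← map_add,
      ← map_one (emb K ι)]
    congr 1
    ext1 j
    have := PowerSeries.mul_inv_cancel _ (hc j)
    simp only [Pi.mul_apply, Pi.sub_apply, Pi.add_apply, Pi.one_apply, g]
    linear_combination (-(X ^ N * X * b j)) * this
  refine ⟨τ ^ n, by simp [τ], ?_, ?_⟩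
  · rw [map_pow]
    exact pow_mem (hN _) n
  · have := Ideal.pow_mem_pow hτ n
    convert this using 1
    ext1
    simp [τ]

/-- Take a in J^n whose i-th component is nonzero of minimal order. If z stabilizes J^n, then za is
in J^n, so the i-th component of za vanishes or has at least this order, and z_i is a power series.
-/
theorem blowup_le_range {S : Subring (ι → FractionRing K⟦X⟧)} (hS : S ≤ (emb K ι).range)
    (h : HasConductor S) : blowup S ≤ (emb K ι).range := by
  rintro z ⟨n, hz⟩
  have key : ∀ i, ∃ w, algebraMap K⟦X⟧ (FractionRing K⟦X⟧) w = z i := by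
    intro i
    obtain ⟨a, ⟨ha0, haS, haJ⟩, hmin⟩ := WellFounded.has_min
      (InvImage.wf (fun a : ι → K⟦X⟧ => (a i).order) wellFounded_lt)
      {a | a i ≠ 0 ∧ ∃ ha : emb K ι a ∈ S, (⟨_, ha⟩ : S) ∈ Ring.jacobson S ^ n}
      (exists_ne_zero_of_jacobson hS h n i)
    obtain ⟨⟨_, hb⟩, hbJ, e⟩ := hz _ haJ
    obtain ⟨b, rfl⟩ := hS hb
    have ei := congrFun e i
    simp only [Pi.mul_apply, emb_apply] at ei
    have ha0' : algebraMap K⟦X⟧ (FractionRing K⟦X⟧) (a i) ≠ 0 :=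
      IsFractionRing.to_map_eq_zero_iff.not.2 ha0
    rcases eq_or_ne (b i) 0 with hb0 | hb0
    · refine ⟨0, ?_⟩
      rw [hb0, map_zero] at ei
      rw [map_zero]
      exact ((mul_eq_zero.1 ei).resolve_right ha0').symm
    · have hle : (a i).order ≤ (b i).order := not_lt.1 (hmin b ⟨hb0, hb, hbJ⟩)
      have hd : a i ∣ b i := (X_pow_dvd_of_ne_zero ha0).trans
        ((pow_dvd_pow _ (ENat.toNat_le_toNat hle (PowerSeries.order_eq_top.not.2 hb0))).trans
          PowerSeries.X_pow_order_dvd)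
      obtain ⟨w, hw⟩ := hd
      refine ⟨w, mul_right_cancel₀ ha0' ?_⟩
      rw [ei, hw, map_mul, mul_comm]
  choose w hw using key
  exact ⟨w, funext hw⟩

theorem iterate_blowup_le_range {S : Subring (ι → FractionRing K⟦X⟧)} (hS : S ≤ (emb K ι).range)
    (h : HasConductor S) (n : ℕ) :
    blowup^[n] S ≤ (emb K ι).range ∧ S ≤ blowup^[n] S := by
  induction n with
  | zero => exact ⟨hS, le_rfl⟩
  | succ n ih =>
    rw [Function.iterate_succ_apply']
    exact ⟨blowup_le_range ih.1 (h.mono ih.2), ih.2.trans (le_blowup _)⟩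

/-- With a and b the two residues of d, the elements d - a and b - d each have a component without
constant term, so they are non-units; their sum is the unit b - a. -/
theorem not_isLocalRing_of_mem {S : Subring (ι → FractionRing K⟦X⟧)} (hS : S ≤ (emb K ι).range)
    (hK : ∀ c : K, emb K ι (algebraMap K _ c) ∈ S) {d : ι → K⟦X⟧} (hd : emb K ι d ∈ S) {i j : ι}
    (hij : constantCoeff (d i) ≠ constantCoeff (d j)) : ¬ IsLocalRing S := by
  intro hloc
  set a := constantCoeff (d i)
  set b := constantCoeff (d j)
  have hnu : ∀ (w : ι → K⟦X⟧) (hw : emb K ι w ∈ S) (k : ι), constantCoeff (w k) = 0 →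
      ¬ IsUnit (⟨_, hw⟩ : S) := by
    intro w hw k h0 hu
    obtain ⟨⟨_, hy⟩, e⟩ := hu.exists_right_inv
    obtain ⟨y, rfl⟩ := hS hy
    have e' : emb K ι (w * y) = emb K ι 1 := by
      rw [map_mul, map_one]
      exact congrArg Subtype.val e
    have := congrArg constantCoeff (congrFun (emb_injective e') k)
    simp [h0] at this
  have h1 : emb K ι (d - algebraMap K _ a) ∈ S := by rw [map_sub]; exact sub_mem hd (hK a)
  have h2 : emb K ι (algebraMap K _ b - d) ∈ S := by rw [map_sub]; exact sub_mem (hK b) hd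
  have hsum : IsUnit ((⟨_, h1⟩ : S) + ⟨_, h2⟩) := by
    refine IsUnit.of_mul_eq_one (⟨_, hK (b - a)⁻¹⟩ : S) (Subtype.ext ?_)
    simp only [Subring.coe_mul, Subring.coe_add, Subring.coe_one, ← map_mul, ← map_add]
    rw [sub_add_sub_cancel', ← map_sub, ← map_mul, mul_inv_cancel₀ (sub_ne_zero.2 hij.symm),
      map_one, map_one]
  rcases IsLocalRing.isUnit_or_isUnit_of_isUnit_add hsum with h | h
  · exact hnu _ h1 i (by simp [a]) h
  · exact hnu _ h2 j (by simp [b]) h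

theorem algebraMap_mem_ring (P : ι → Param K) (c : K) : emb K ι (algebraMap K _ c) ∈ Param.ring P :=
  ⟨algebraMap K _ c, by simp⟩

theorem ring_le_range (P : ι → Param K) : Param.ring P ≤ (emb K ι).range := by
  rintro _ ⟨g, rfl⟩
  exact ⟨_, rfl⟩

/-- Identification of the total ring of fractions. -/
theorem exists_fractionRing_equiv {R : Type*} [CommRing R] [Finite ι] (f : R →+* (ι → K⟦X⟧))
    (hf : Function.Injective f) (h : ∃ N : ℕ, ∀ z : ι → K⟦X⟧, ∃ r, f r = fun i => X ^ N * z i) :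
    ∃ e : FractionRing R ≃+* (ι → FractionRing K⟦X⟧), ∀ r, e (algebraMap _ _ r) = emb K ι (f r) := by
  classical
  obtain ⟨N, hN⟩ := h
  have hX : (X : K⟦X⟧) ^ N ≠ 0 := pow_ne_zero _ PowerSeries.X_ne_zero
  let := ((emb K ι).comp f).toAlgebra
  have : IsFractionRing R (ι → FractionRing K⟦X⟧) :=
    { map_units := by
        rintro ⟨r, hr⟩
        change IsUnit (emb K ι (f r))
        rw [Pi.isUnit_iff]
        intro i
        rw [emb_apply, isUnit_iff_ne_zero, Ne, IsFractionRing.to_map_eq_zero_iff]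
        intro h0
        -- If a component of r vanishes, a conductor element supported on this component annihilates
        -- r.
        obtain ⟨r', hr'⟩ := hN (Pi.single i 1)
        have : r' * r = 0 := hf (by
          rw [map_mul, hr', map_zero]
          ext1 j
          rcases eq_or_ne j i with rfl | hj
          · simp [h0]
          · simp [hj])
        rw [(mem_nonZeroDivisors_iff_right.1 hr) r' this, map_zero] at hr'
        have := congrFun hr' i
        simp only [Pi.zero_apply, Pi.single_eq_same, mul_one] at this
        exact hX this.symm
      surj := by
        intro z
        choose a b hb e using fun i => IsFractionRing.div_surjective (A := K⟦X⟧) (z i)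
        obtain ⟨r, hr⟩ := hN a
        obtain ⟨s, hs⟩ := hN b
        have hs0 : ∀ i, b i ≠ 0 := fun i => nonZeroDivisors.ne_zero (hb i)
        refine ⟨⟨r, ⟨s, ?_⟩⟩, ?_⟩
        · rw [mem_nonZeroDivisors_iff_right]
          intro t ht
          apply hf
          rw [map_zero]
          ext1 i
          have := congrFun (congrArg f ht) i
          rw [map_mul, Pi.mul_apply, hs, map_zero, Pi.zero_apply, mul_eq_zero] at this
          exact this.resolve_right (mul_ne_zero hX (hs0 i))
        · change z * emb K ι (f s) = emb K ι (f r)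
          ext1 i
          have h0 : algebraMap K⟦X⟧ (FractionRing K⟦X⟧) (b i) ≠ 0 :=
            IsFractionRing.to_map_eq_zero_iff.not.2 (hs0 i)
          rw [Pi.mul_apply, emb_apply, emb_apply, hr, hs, map_mul, map_mul, ← e i]
          field_simp
      exists_of_eq := by
        intro x y hxy
        exact ⟨1, by rw [hf (emb_injective hxy)]⟩ }
  exact ⟨(FractionRing.algEquiv R (ι → FractionRing K⟦X⟧)).toRingEquiv, fun r =>
    (FractionRing.algEquiv R (ι → FractionRing K⟦X⟧)).commutes r⟩

theorem blowup_map {Q Q' : Type*} [CommRing Q] [CommRing Q'] (e : Q ≃+* Q') (S : Subring Q) :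
    (blowup S).map (e : Q →+* Q') = blowup (S.map (e : Q →+* Q')) := by
  let g : S ≃+* S.map (e : Q →+* Q') := e.subringMap
  have hg : ∀ a, ((g a : S.map (e : Q →+* Q')) : Q') = e a := fun _ => rfl
  have hJ : ∀ n, Ring.jacobson (S.map (e : Q →+* Q')) ^ n = (Ring.jacobson S ^ n).map g := by
    intro n
    have := Ideal.map_jacobson_of_bijective (I := ⊥)
      (f := (g : S →+* S.map (e : Q →+* Q'))) g.bijective
    rw [Ideal.map_bot, Ideal.jacobson_bot, Ideal.jacobson_bot] at this
    rw [Ideal.map_pow, ← this]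
    rfl
  have key : ∀ n z, Stabilizes S n z ↔ Stabilizes (S.map (e : Q →+* Q')) n (e z) := by
    intro n z
    rw [Stabilizes, Stabilizes, hJ]
    constructor
    · intro h a ha
      obtain ⟨a', ha', rfl⟩ := (Ideal.mem_map_iff_of_surjective _ g.surjective).1 ha
      obtain ⟨b, hb, eb⟩ := h a' ha'
      exact ⟨g b, Ideal.mem_map_of_mem _ hb, by rw [hg, hg, ← map_mul, eb]⟩
    · intro h a ha
      obtain ⟨b, hb, eb⟩ := h (g a) (Ideal.mem_map_of_mem _ ha)
      obtain ⟨b', hb', rfl⟩ := (Ideal.mem_map_iff_of_surjective _ g.surjective).1 hb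
      exact ⟨b', hb', e.injective (by rw [map_mul, ← hg a, eb, hg])⟩
  ext y
  constructor
  · rintro ⟨z, ⟨n, hz⟩, rfl⟩
    exact ⟨n, (key n z).1 hz⟩
  · rintro ⟨n, hy⟩
    refine ⟨e.symm y, ⟨n, (key n _).2 (by rwa [e.apply_symm_apply])⟩, e.apply_symm_apply y⟩

theorem neighbourhood_map {R : Type u} [CommRing R] {Q' : Type*} [CommRing Q']
    (e : FractionRing R ≃+* Q') (j : ℕ) :
    (neighbourhood R j).map (e : FractionRing R →+* Q') =
      blowup^[j] ((algebraMap R (FractionRing R)).range.map (e : FractionRing R →+* Q')) := by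
  induction j with
  | zero => rfl
  | succ j ih =>
    rw [neighbourhood, Function.iterate_succ_apply', Function.iterate_succ_apply', blowup_map,
      ← ih, neighbourhood]

theorem isLocalRing_neighbourhood_iff {R : Type u} [CommRing R] {Q' : Type*} [CommRing Q']
    (e : FractionRing R ≃+* Q') (j : ℕ) :
    IsLocalRing (neighbourhood R j) ↔
      IsLocalRing ((neighbourhood R j).map (e : FractionRing R →+* Q')) := by
  let g : neighbourhood R j ≃+* (neighbourhood R j).map (e : FractionRing R →+* Q') :=
    e.subringMap
  exact ⟨fun _ => g.isLocalRing, fun _ => g.symm.isLocalRing⟩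

end Conductor

end PlaneCurve

namespace PlaneCurve

universe u
variable {K : Type u} [Field K]

open PowerSeries Param

/-! ### Neighbourhood rings of quotients of K[[X,Y]] as rings of strict transforms -/

section Identification

variable {ι : Type*}

theorem exists_equiv_of_evPi [Finite ι] {P : ι → Param K} {I : Ideal (MvPowerSeries (Fin 2) K)}
    (hI : ∀ g, g ∈ I ↔ evPi P g = 0)
    (hc : ∃ N : ℕ, ∀ z : ι → K⟦X⟧, ∃ g, evPi P g = fun i => X ^ N * z i) :
    ∃ e : FractionRing (MvPowerSeries (Fin 2) K ⧸ I) ≃+* (ι → FractionRing K⟦X⟧),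
      ∀ g, e (algebraMap _ _ (Ideal.Quotient.mk I g)) = emb K ι (evPi P g) := by
  let f : MvPowerSeries (Fin 2) K ⧸ I →+* (ι → K⟦X⟧) :=
    Ideal.Quotient.lift I (evPi P : MvPowerSeries (Fin 2) K →+* (ι → K⟦X⟧)) fun g hg => (hI g).1 hg
  have hf : ∀ g, f (Ideal.Quotient.mk I g) = evPi P g := fun g => Ideal.Quotient.lift_mk _ _ _
  obtain ⟨e, he⟩ := exists_fractionRing_equiv f
    (by
      rw [injective_iff_map_eq_zero]
      intro r hr
      obtain ⟨g, rfl⟩ := Ideal.Quotient.mk_surjective r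
      rw [hf] at hr
      exact Ideal.Quotient.eq_zero_iff_mem.2 ((hI g).2 hr))
    (hc.imp fun N h z => (h z).imp' (Ideal.Quotient.mk I) fun g hg => (hf g).trans hg)
  exact ⟨e, fun g => by rw [he, hf]⟩

theorem neighbourhood_map_eq_ring [Finite ι] [Nonempty ι] {I : Ideal (MvPowerSeries (Fin 2) K)}
    {P : ℕ → ι → Param K}
    {e : FractionRing (MvPowerSeries (Fin 2) K ⧸ I) ≃+* (ι → FractionRing K⟦X⟧)}
    (he : ∀ g, e (algebraMap _ _ (Ideal.Quotient.mk I g)) = emb K ι (evPi (P 0) g))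
    (hP : ∀ i, (P 0 i).Nondeg) {n : ℕ}
    (hs : ∀ j < n, ∃ s, ∀ i, Step s (P j i) (P (j + 1) i)) {j : ℕ} (hj : j ≤ n) :
    (neighbourhood (MvPowerSeries (Fin 2) K ⧸ I) j).map
      (e : FractionRing (MvPowerSeries (Fin 2) K ⧸ I) →+* (ι → FractionRing K⟦X⟧)) =
      Param.ring (P j) ∧ ∀ i, (P j i).Nondeg := by
  induction j with
  | zero =>
    refine ⟨?_, hP⟩
    rw [neighbourhood_map]
    ext y
    constructor
    · rintro ⟨_, ⟨r, rfl⟩, rfl⟩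
      obtain ⟨g, rfl⟩ := Ideal.Quotient.mk_surjective r
      exact ⟨g, (he g).symm⟩
    · rintro ⟨g, rfl⟩
      exact ⟨_, ⟨_, rfl⟩, he g⟩
  | succ j ih =>
    obtain ⟨h1, h2⟩ := ih (by omega)
    obtain ⟨s, hs⟩ := hs j (by omega)
    refine ⟨?_, fun i => (hs i).nondeg (h2 i)⟩
    rw [neighbourhood_map] at h1 ⊢
    rw [Function.iterate_succ_apply', h1, blowup_ring_of_step hs h2]

end Identification

/-! ### One branch: integral closure, multiplicities, uniqueness of tangents -/

section SingleBranch

/-- `p` is a primitive parametrization of the curve with ideal `I`. -/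
structure Param.Parametrizes (p : Param K) (I : Ideal (MvPowerSeries (Fin 2) K)) : Prop where
  mem_iff : ∀ g, g ∈ I ↔ p.ev g = 0
  conductor : ∃ N : ℕ, ∀ z : K⟦X⟧, ∃ g, p.ev g = X ^ N * z

variable {p : Param K} {I : Ideal (MvPowerSeries (Fin 2) K)}

theorem Param.ev_mem_of_dvd (p : Param K) {x : K⟦X⟧} (hu : x ∣ p.u) (hv : x ∣ p.v)
    {g : MvPowerSeries (Fin 2) K} (hg : g ∈ maxIdeal K) : x ∣ p.ev g := by
  rw [maxIdeal_eq_span] at hg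
  obtain ⟨a, b, rfl⟩ := Ideal.mem_span_pair.1 hg
  rw [map_add, map_mul, map_mul, ev_X_zero, ev_X_one]
  exact dvd_add (hu.mul_left _) (hv.mul_left _)

theorem Param.Parametrizes.nondeg (hp : p.Parametrizes I) : p.Nondeg := by
  by_contra h
  rw [Nondeg, not_or, not_not, not_not] at h
  obtain ⟨N, hN⟩ := hp.conductor
  obtain ⟨g, hg⟩ := hN X
  have h1 : p.ev (g - algebraMap K _ (MvPowerSeries.constantCoeff g)) = 0 := by
    refine zero_dvd_iff.1 (p.ev_mem_of_dvd (by simp [h.1]) (by simp [h.2]) (mem_maxIdeal.2 ?_))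
    rw [map_sub, MvPowerSeries.algebraMap_apply]
    simp
  rw [map_sub, hg, ev_C, sub_eq_zero] at h1
  have h2 := congrArg constantCoeff h1
  simp only [map_mul, constantCoeff_X, mul_zero, constantCoeff_C] at h2
  rw [← h2, map_zero] at h1
  exact mul_ne_zero (pow_ne_zero _ X_ne_zero) X_ne_zero h1

theorem Param.Parametrizes.exists_equiv (hp : p.Parametrizes I) :
    ∃ e : FractionRing (MvPowerSeries (Fin 2) K ⧸ I) ≃+* (Unit → FractionRing K⟦X⟧),
      ∀ g, e (algebraMap _ _ (Ideal.Quotient.mk I g)) = emb K Unit (evPi (fun _ => p) g) := by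
  refine exists_equiv_of_evPi (fun g => ?_) ?_
  · rw [hp.mem_iff]
    exact ⟨fun h => funext fun _ => h, fun h => congrFun h ()⟩
  · obtain ⟨N, hN⟩ := hp.conductor
    refine ⟨N, fun z => ?_⟩
    obtain ⟨g, hg⟩ := hN (z ())
    exact ⟨g, funext fun _ => hg⟩

variable {e : FractionRing (MvPowerSeries (Fin 2) K ⧸ I) ≃+* (Unit → FractionRing K⟦X⟧)}

/-- K[[t]] is integrally closed, and it is finite over K[[u]] or over K[[v]], whichever coordinate
is nonzero. -/
theorem mem_integralClosure_iff_exists (hp : p.Nondeg)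
    (he : ∀ g, e (algebraMap _ _ (Ideal.Quotient.mk I g)) = emb K Unit (evPi (fun _ => p) g))
    (x : FractionRing (MvPowerSeries (Fin 2) K ⧸ I)) :
    x ∈ integralClosure (MvPowerSeries (Fin 2) K ⧸ I)
      (FractionRing (MvPowerSeries (Fin 2) K ⧸ I)) ↔ ∃ z, e x = emb K Unit z := by
  rw [mem_integralClosure_iff]
  constructor
  · intro hx
    let f : MvPowerSeries (Fin 2) K ⧸ I →+* K⟦X⟧ :=
      Ideal.Quotient.lift I (p.ev : MvPowerSeries (Fin 2) K →+* K⟦X⟧) fun g hg => by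
        have h0 := he g
        rw [Ideal.Quotient.eq_zero_iff_mem.2 hg, map_zero, map_zero, ← map_zero (emb K Unit)] at h0
        exact (congrFun (emb_injective h0) ()).symm
    let ψ : FractionRing (MvPowerSeries (Fin 2) K ⧸ I) →+* FractionRing K⟦X⟧ :=
      (Pi.evalRingHom (fun _ : Unit => FractionRing K⟦X⟧) ()).comp e
    have h1 : IsIntegral K⟦X⟧ (ψ x) := by
      refine hx.map_of_comp_eq f ψ (Ideal.Quotient.ringHom_ext (RingHom.ext fun g => ?_))
      exact (congrFun (he g) ()).symm
    obtain ⟨z, hz⟩ := IsIntegrallyClosed.isIntegral_iff.1 h1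
    exact ⟨fun _ => z, funext fun _ => hz.symm⟩
  · rintro ⟨z, hz⟩
    have key : ∃ i : Fin 2, ((p.ev.comp (toMvPowerSeries i) : K⟦X⟧ →ₐ[K] K⟦X⟧) :
        K⟦X⟧ →+* K⟦X⟧).Finite := by
      rcases hp with h | h
      · refine ⟨0, finite_of_order_pos ?_ ?_⟩ <;>
          rw [AlgHom.comp_apply, toMvPowerSeries_X, ev_X_zero]
        exacts [p.hu, h]
      · refine ⟨1, finite_of_order_pos ?_ ?_⟩ <;>
          rw [AlgHom.comp_apply, toMvPowerSeries_X, ev_X_one]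
        exacts [p.hv, h]
    obtain ⟨i, hi⟩ := key
    obtain ⟨q, hq, hq0⟩ := hi.to_isIntegral (z ())
    let φ : K⟦X⟧ →+* MvPowerSeries (Fin 2) K ⧸ I :=
      (Ideal.Quotient.mk I).comp (toMvPowerSeries i : K⟦X⟧ →ₐ[K] MvPowerSeries (Fin 2) K)
    let c : K⟦X⟧ →+* (Unit → K⟦X⟧) := RingHom.pi fun _ => RingHom.id _
    let ψ : K⟦X⟧ →+* FractionRing (MvPowerSeries (Fin 2) K ⧸ I) :=
      (e.symm : _ →+* FractionRing (MvPowerSeries (Fin 2) K ⧸ I)).comp ((emb K Unit).comp c)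
    refine ⟨q.map φ, hq.map _, ?_⟩
    have hx : x = ψ (z ()) := by
      apply e.injective
      rw [hz]
      simp [ψ]
      rfl
    have := congrArg ψ hq0
    rw [Polynomial.hom_eval₂, map_zero] at this
    rw [Polynomial.eval₂_map, hx, ← this]
    congr 1
    ext1 a
    apply e.injective
    simp only [RingHom.comp_apply, φ, ψ, RingHom.coe_coe, he, RingEquiv.apply_symm_apply]
    rfl

/-- The integral closure is a copy of K[[t]], so the powers of its Jacobson radical are the ideals
(t^n). -/
theorem value_eq_order (hp : p.Nondeg)
    (he : ∀ g, e (algebraMap _ _ (Ideal.Quotient.mk I g)) = emb K Unit (evPi (fun _ => p) g))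
    {x : FractionRing (MvPowerSeries (Fin 2) K ⧸ I)} {z : Unit → K⟦X⟧} (hx : e x = emb K Unit z) :
    value (MvPowerSeries (Fin 2) K ⧸ I) x = (z ()).order := by
  let B := integralClosure (MvPowerSeries (Fin 2) K ⧸ I)
    (FractionRing (MvPowerSeries (Fin 2) K ⧸ I))
  let ψ : K⟦X⟧ →+* FractionRing (MvPowerSeries (Fin 2) K ⧸ I) :=
    (e.symm : _ →+* FractionRing (MvPowerSeries (Fin 2) K ⧸ I)).comp
      ((emb K Unit).comp (RingHom.pi fun _ => RingHom.id _))
  have heψ : ∀ w, e (ψ w) = emb K Unit (fun _ => w) := fun w => e.apply_symm_apply _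
  let G : K⟦X⟧ →+* B := ψ.codRestrict B fun w =>
    (mem_integralClosure_iff_exists hp he _).2 ⟨_, heψ w⟩
  have hG : Function.Bijective G := by
    constructor
    · intro a b hab
      have : ψ a = ψ b := congrArg Subtype.val hab
      have := congrArg e this
      rw [heψ, heψ] at this
      exact congrFun (emb_injective this) ()
    · rintro ⟨y, hy⟩
      obtain ⟨w, hw⟩ := (mem_integralClosure_iff_exists hp he _).1 hy
      exact ⟨w (), Subtype.ext (e.injective ((heψ _).trans hw.symm))⟩
  have hJ : ∀ n : ℕ, Ring.jacobson B ^ n = (Ideal.span {(X : K⟦X⟧) ^ n}).map G := by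
    intro n
    have := Ideal.map_jacobson_of_bijective (I := ⊥) hG
    rw [Ideal.map_bot, Ideal.jacobson_bot, Ideal.jacobson_bot,
      IsLocalRing.ringJacobson_eq_maximalIdeal, PowerSeries.maximalIdeal_eq_span_X] at this
    rw [← this, ← Ideal.map_pow, Ideal.span_singleton_pow]
  have key : ∀ n : ℕ, (∃ a ∈ Ring.jacobson B ^ n,
      (a : FractionRing (MvPowerSeries (Fin 2) K ⧸ I)) = x) ↔ (n : ℕ∞) ≤ (z ()).order := by
    intro n
    have hz : X ^ n ∣ z () ↔ (n : ℕ∞) ≤ (z ()).order := by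
      rw [PowerSeries.X_pow_dvd_iff]
      exact ⟨PowerSeries.nat_le_order _ _, fun h m hm => PowerSeries.coeff_of_lt_order m
        (lt_of_lt_of_le (by exact_mod_cast hm) h)⟩
    rw [← hz, hJ]
    constructor
    · rintro ⟨a, ha, rfl⟩
      obtain ⟨w, hw, rfl⟩ := (Ideal.mem_map_iff_of_surjective _ hG.2).1 ha
      have : emb K Unit (fun _ => w) = emb K Unit z := (heψ w).symm.trans hx
      rw [← congrFun (emb_injective this) ()]
      exact Ideal.mem_span_singleton.1 hw
    · intro h
      exact ⟨G (z ()), Ideal.mem_map_of_mem _ (Ideal.mem_span_singleton.2 h),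
        e.injective ((heψ _).trans hx.symm)⟩
  rw [value]
  apply le_antisymm
  · exact iSup₂_le fun n hn => (key n).1 hn
  · refine ENat.forall_natCast_le_iff_le.1 fun n hn => ?_
    exact le_iSup₂_of_le n ((key n).2 hn) le_rfl

/-- The non-units are the images of the maximal ideal (X,Y), hence combinations of the two
coordinates, so no order is smaller than the smaller of theirs. -/
theorem multiplicity_eq (hp : p.Nondeg)
    (he : ∀ g, e (algebraMap _ _ (Ideal.Quotient.mk I g)) = emb K Unit (evPi (fun _ => p) g))
    {j : ℕ} {q : Param K} (hj : (neighbourhood (MvPowerSeries (Fin 2) K ⧸ I) j).map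
      (e : FractionRing (MvPowerSeries (Fin 2) K ⧸ I) →+* (Unit → FractionRing K⟦X⟧)) =
      Param.ring fun _ => q) :
    multiplicity (MvPowerSeries (Fin 2) K ⧸ I) j = min q.u.order q.v.order := by
  have hmem : ∀ x, x ∈ neighbourhood (MvPowerSeries (Fin 2) K ⧸ I) j ↔
      ∃ g, e x = emb K Unit (evPi (fun _ => q) g) := by
    intro x
    have h1 : x ∈ neighbourhood (MvPowerSeries (Fin 2) K ⧸ I) j ↔
        e x ∈ (neighbourhood (MvPowerSeries (Fin 2) K ⧸ I) j).map
      (e : FractionRing (MvPowerSeries (Fin 2) K ⧸ I) →+* (Unit → FractionRing K⟦X⟧)) :=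
      ⟨fun h => ⟨x, h, rfl⟩, fun ⟨y, hy, h⟩ => e.injective h ▸ hy⟩
    rw [h1, hj]
    exact ⟨fun ⟨g, hg⟩ => ⟨g, hg.symm⟩, fun ⟨g, hg⟩ => ⟨g, hg.symm⟩⟩
  have hunit : ∀ (x : neighbourhood (MvPowerSeries (Fin 2) K ⧸ I) j) g,
      e x = emb K Unit (evPi (fun _ => q) g) → (¬ IsUnit x ↔ g ∈ maxIdeal K) := by
    rintro x g hg
    constructor
    · intro hx
      by_contra h
      rw [IsLocalRing.mem_maximalIdeal, mem_nonunits_iff, not_not] at h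
      obtain ⟨g', hg'⟩ := h.exists_right_inv
      refine hx (IsUnit.of_mul_eq_one (⟨e.symm (emb K Unit (evPi (fun _ => q) g')),
        (hmem _).2 ⟨g', e.apply_symm_apply _⟩⟩ : neighbourhood _ j) (Subtype.ext ?_))
      apply e.injective
      rw [Subring.coe_mul, map_mul, e.apply_symm_apply, hg, ← map_mul, ← map_mul, hg']
      simp
    · intro h hx
      obtain ⟨y, hy⟩ := hx.exists_right_inv
      obtain ⟨g', hg'⟩ := (hmem _).1 y.2
      have h1 := congrArg e (congrArg Subtype.val hy)
      rw [Subring.coe_mul, map_mul, hg, hg', ← map_mul, ← map_mul, Subring.coe_one, map_one,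
        ← map_one (emb K Unit)] at h1
      have h2 := congrArg constantCoeff (congrFun (emb_injective h1) ())
      rw [evPi_apply, map_mul, map_mul, constantCoeff_algHom _ h] at h2
      simp at h2
  rw [multiplicity]
  apply le_antisymm
  · have key : ∀ i : Fin 2, (⨅ (x : neighbourhood (MvPowerSeries (Fin 2) K ⧸ I) j)
        (_ : ¬ IsUnit x), value (MvPowerSeries (Fin 2) K ⧸ I)
          (x : FractionRing (MvPowerSeries (Fin 2) K ⧸ I))) ≤
        (q.ev (MvPowerSeries.X i)).order := by
      intro i
      have h1 := e.apply_symm_apply (emb K Unit (evPi (fun _ => q) (MvPowerSeries.X i)))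
      refine iInf₂_le_of_le (⟨_, (hmem _).2 ⟨_, h1⟩⟩ : neighbourhood _ j)
        ((hunit _ _ h1).2 (X_mem_maxIdeal i)) ?_
      rw [value_eq_order hp he h1, evPi_apply]
    exact le_min (by simpa using key 0) (by simpa using key 1)
  · refine le_iInf₂ fun x hx => ?_
    obtain ⟨g, hg⟩ := (hmem _).1 x.2
    rw [value_eq_order hp he hg, evPi_apply]
    have := (hunit x g hg).1 hx
    rw [maxIdeal_eq_span] at this
    obtain ⟨a, b, rfl⟩ := Ideal.mem_span_pair.1 this
    rw [map_add, map_mul, map_mul, ev_X_zero, ev_X_one]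
    refine le_trans (min_le_min ?_ ?_) (PowerSeries.min_order_le_order_add _ _) <;>
      rw [PowerSeries.order_mul] <;> exact le_add_self

theorem Param.Parametrizes.multiplicity_eq {P : ℕ → Param K} {s : ℕ → Option K}
    (hp : (P 0).Parametrizes I) (hs : ∀ j, Step (s j) (P j) (P (j + 1))) (j : ℕ) :
    multiplicity (MvPowerSeries (Fin 2) K ⧸ I) j = min (P j).u.order (P j).v.order := by
  obtain ⟨e, he⟩ := hp.exists_equiv
  exact PlaneCurve.multiplicity_eq hp.nondeg he (neighbourhood_map_eq_ring
    (P := fun j _ => P j) he (fun _ => hp.nondeg) (fun j _ => ⟨s j, fun _ => hs j⟩)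
    (le_refl j)).1

theorem Param.Step.eq_none_iff {s : Option K} {p q : Param K} (h : Step s p q) (hp : p.Nondeg) :
    s = none ↔ p.v.order < p.u.order := by
  have hq := h.u_ne_zero hp
  cases s with
  | none =>
    refine ⟨fun _ => ?_, fun _ => rfl⟩
    rw [h.2, PowerSeries.order_mul]
    rw [h.1] at hq
    have h1 : 1 ≤ q.v.order := PowerSeries.one_le_order_iff_constCoeff_eq_zero.2 q.hv
    exact lt_of_lt_of_le ((ENat.lt_add_one_iff (PowerSeries.order_eq_top.not.2 hq)).2 le_rfl)
      (add_le_add_right h1 _)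
  | some c =>
    simp only [reduceCtorEq, false_iff, not_lt]
    rw [h.2, PowerSeries.order_mul]
    exact le_self_add

/-- The steps are determined by the ideal of the curve. -/
theorem Param.Parametrizes.step_eq {P P' : ℕ → Param K} {s s' : ℕ → Option K}
    (hp : (P 0).Parametrizes I) (hs : ∀ j, Step (s j) (P j) (P (j + 1)))
    (hp' : (P' 0).Parametrizes I) (hs' : ∀ j, Step (s' j) (P' j) (P' (j + 1))) : s = s' := by
  obtain ⟨e, he⟩ := hp.exists_equiv
  obtain ⟨e', he'⟩ := hp'.exists_equiv
  have hnd : ∀ j, (P j).Nondeg := fun j => by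
    induction j with
    | zero => exact hp.nondeg
    | succ j ih => exact (hs j).nondeg ih
  have hnd' : ∀ j, (P' j).Nondeg := fun j => by
    induction j with
    | zero => exact hp'.nondeg
    | succ j ih => exact (hs' j).nondeg ih
  -- The two parametrizations are compared through elements of the common fraction field: both
  -- orders of such an element are its intrinsic value.
  have hv : ∀ {x z z'}, e x = emb K Unit z → e' x = emb K Unit z' →
      (z ()).order = (z' ()).order := fun h h' =>
    (value_eq_order hp.nondeg he h).symm.trans (value_eq_order hp'.nondeg he' h')
  have hdiv : ∀ {x y : FractionRing (MvPowerSeries (Fin 2) K ⧸ I)} {a b b' c' : K⟦X⟧},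
      e x = emb K Unit (fun _ => b) → e y = emb K Unit (fun _ => b * a) →
      e' x = emb K Unit (fun _ => b') → e' y = emb K Unit (fun _ => b' * c') → b' ≠ 0 →
      e' (e.symm (emb K Unit fun _ => a)) = emb K Unit (fun _ => c') := by
    intro x y a b b' c' h1 h2 h3 h4 hb
    have h5 : x * e.symm (emb K Unit fun _ => a) = y := by
      apply e.injective
      rw [map_mul, e.apply_symm_apply, h1, h2, ← map_mul]
      rfl
    have h6 := congrArg e' h5
    rw [map_mul, h3, h4] at h6
    ext1 i
    have h7 := congrFun h6 i
    simp only [Pi.mul_apply, emb_apply, map_mul] at h7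
    exact mul_left_cancel₀ (IsFractionRing.to_map_eq_zero_iff.not.2 hb) h7
  have hC : ∀ c : K, ∃ x, e x = emb K Unit (fun _ => C c) ∧ e' x = emb K Unit (fun _ => C c) := by
    refine fun c => ⟨algebraMap _ _ (Ideal.Quotient.mk I (algebraMap K _ c)), ?_, ?_⟩
    · rw [he]; congr 1; ext1 i; rw [evPi_apply, ev_C]
    · rw [he']; congr 1; ext1 i; rw [evPi_apply, ev_C]
  have main : ∀ j, (∃ x y, (e x = emb K Unit (fun _ => (P j).u) ∧
      e' x = emb K Unit (fun _ => (P' j).u)) ∧ e y = emb K Unit (fun _ => (P j).v) ∧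
      e' y = emb K Unit (fun _ => (P' j).v)) → s j = s' j ∧
      ∃ x y, (e x = emb K Unit (fun _ => (P (j + 1)).u) ∧
      e' x = emb K Unit (fun _ => (P' (j + 1)).u)) ∧ e y = emb K Unit (fun _ => (P (j + 1)).v) ∧
      e' y = emb K Unit (fun _ => (P' (j + 1)).v) := by
    rintro j ⟨x, y, ⟨h1, h2⟩, h3, h4⟩
    have hj := hs j
    have hj' := hs' j
    have hu := hj.u_ne_zero (hnd j)
    have hu' := hj'.u_ne_zero (hnd' j)
    have hnone : s j = none ↔ s' j = none := by
      rw [hj.eq_none_iff (hnd j), hj'.eq_none_iff (hnd' j)]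
      have e1 : (P j).u.order = (P' j).u.order := hv h1 h2
      have e2 : (P j).v.order = (P' j).v.order := hv h3 h4
      rw [e1, e2]
    cases h5 : s j with
    | none =>
      have h6 := hnone.1 h5
      rw [h5] at hj
      rw [h6] at hj'
      refine ⟨h6.symm, y, _, ⟨by rw [h3, hj.1], by rw [h4, hj'.1]⟩, e.apply_symm_apply _, ?_⟩
      exact hdiv h3 (by rw [h1, hj.2]) h4 (by rw [h2, hj'.2]) (hj'.1 ▸ hu')
    | some c =>
      cases h6 : s' j with
      | none => rw [hnone.2 h6] at h5; simp at h5
      | some c' =>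
        rw [h5] at hj
        rw [h6] at hj'
        obtain ⟨k, hk, hk'⟩ := hC c
        have h7 : e (y - k * x) = emb K Unit (fun _ => (P j).u * (P (j + 1)).v) := by
          rw [map_sub, map_mul, hk, h1, h3, hj.2, ← map_mul, ← map_sub]
          congr 1
          ext1 i
          simp only [Pi.sub_apply, Pi.mul_apply]
          ring
        have h8 : e' (y - k * x) =
            emb K Unit (fun _ => (P' j).u * ((P' (j + 1)).v + C (c' - c))) := by
          rw [map_sub, map_mul, hk', h2, h4, hj'.2, ← map_mul, ← map_sub]
          congr 1
          ext1 i
          simp only [Pi.sub_apply, Pi.mul_apply, map_sub]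
          ring
        -- For c ≠ c' the element y - cx would have order greater than that of x in the first
        -- parametrization and equal to it in the second.
        have hc : c = c' := by
          by_contra hc
          have h9 := hv h7 h8
          have h10 := hv h1 h2
          have h11 : ((P' (j + 1)).v + C (c' - c)).order = 0 := by
            rw [PowerSeries.order_zero_of_unit]
            rw [PowerSeries.isUnit_iff_constantCoeff, isUnit_iff_ne_zero]
            simpa [(P' (j + 1)).hv, sub_eq_zero] using Ne.symm hc
          simp only [PowerSeries.order_mul, h11, add_zero] at h9 h10
          rw [← h10] at h9
          have h12 : 1 ≤ (P (j + 1)).v.order :=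
            PowerSeries.one_le_order_iff_constCoeff_eq_zero.2 (P (j + 1)).hv
          rw [hj.1] at hu
          have h13 := lt_of_lt_of_le ((ENat.lt_add_one_iff (PowerSeries.order_eq_top.not.2 hu)).2
            (le_refl (P j).u.order)) (add_le_add_right h12 _)
          rw [h9] at h13
          exact lt_irrefl _ h13
        subst hc
        refine ⟨rfl, x, _, ⟨by rw [h1, hj.1], by rw [h2, hj'.1]⟩, e.apply_symm_apply _, ?_⟩
        refine hdiv h1 h7 h2 ?_ (hj'.1 ▸ hu')
        rw [h8]
        simp
  have all : ∀ j, s j = s' j ∧ ∃ x y, (e x = emb K Unit (fun _ => (P (j + 1)).u) ∧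
      e' x = emb K Unit (fun _ => (P' (j + 1)).u)) ∧ e y = emb K Unit (fun _ => (P (j + 1)).v) ∧
      e' y = emb K Unit (fun _ => (P' (j + 1)).v) := by
    intro j
    induction j with
    | zero =>
      refine main 0 ⟨algebraMap _ _ (Ideal.Quotient.mk I (MvPowerSeries.X 0)),
        algebraMap _ _ (Ideal.Quotient.mk I (MvPowerSeries.X 1)), ⟨?_, ?_⟩, ?_, ?_⟩
      · rw [he]; congr 1; ext1 i; simp
      · rw [he']; congr 1; ext1 i; simp
      · rw [he]; congr 1; ext1 i; simp
      · rw [he']; congr 1; ext1 i; simp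
    | succ j ih => exact main (j + 1) ih.2
  exact funext fun j => (all j).1

end SingleBranch

end PlaneCurve

namespace PlaneCurve

universe u
variable {K : Type u} [Field K]

open PowerSeries Param

/-! ### Two branches: the ring is local exactly until the tangents differ -/

section TwoBranches

variable {p p' : Param K} {I I' : Ideal (MvPowerSeries (Fin 2) K)}

/-- The ideals of distinct branches are incomparable. -/
theorem Param.Parametrizes.eq_of_le (hp : p.Parametrizes I) (hI' : I'.IsPrime)
    (hmax : ¬ I'.IsMaximal) (h : I ≤ I') : I = I' := by
  refine le_antisymm h fun f hf => ?_
  by_contra hfI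
  rw [hp.mem_iff] at hfI
  obtain ⟨N, hN⟩ := hp.conductor
  obtain ⟨w, hw⟩ := X_pow_dvd_of_ne_zero hfI
  -- Because of the conductor, a high power of any g in the maximal ideal is, modulo I, a multiple
  -- of f, which lies in I'.
  have hX : ∀ g ∈ maxIdeal K, g ∈ I' := by
    intro g hg
    obtain ⟨y, hy⟩ := X_pow_dvd_algHom p.ev
      (Ideal.pow_mem_pow hg ((p.ev f).order.toNat + N))
    obtain ⟨g', hg'⟩ := hN (w * y)
    have h1 : g ^ ((p.ev f).order.toNat + N) - f * g' ∈ I := by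
      rw [hp.mem_iff, map_sub, hy, map_mul, hg', pow_add]
      linear_combination X ^ N * y * hw
    have h2 := I'.add_mem (h h1) (I'.mul_mem_right g' hf)
    rw [sub_add_cancel] at h2
    exact hI'.mem_of_pow_mem _ h2
  apply hmax
  have : I' = maxIdeal K := le_antisymm (IsLocalRing.le_maximalIdeal hI'.ne_top) hX
  rw [this]
  infer_instance

theorem Param.Parametrizes.exists_ev_eq (hp : p.Parametrizes I) {h : MvPowerSeries (Fin 2) K}
    (hh : p.ev h ≠ 0) : ∃ N : ℕ, ∀ z : K⟦X⟧, ∃ g, p.ev (h * g) = X ^ N * z := by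
  obtain ⟨N, hN⟩ := hp.conductor
  obtain ⟨w, hw⟩ := X_pow_dvd_of_ne_zero hh
  refine ⟨(p.ev h).order.toNat + N, fun z => ?_⟩
  obtain ⟨g, hg⟩ := hN (w * z)
  refine ⟨g, ?_⟩
  rw [map_mul, hg, pow_add]
  linear_combination (-X ^ N * z) * hw

/-- An element of I outside I' vanishes on the first branch only, and one of I' outside I on the
second only. Their multiples fill a power of t in each component separately. -/
theorem exists_evPi_pair_eq (hp : p.Parametrizes I) (hp' : p'.Parametrizes I') (hI : I.IsPrime)
    (hI' : I'.IsPrime) (hm : ¬ I.IsMaximal) (hm' : ¬ I'.IsMaximal) (hne : I ≠ I') :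
    ∃ N : ℕ, ∀ z : Fin 2 → K⟦X⟧, ∃ g, evPi ![p, p'] g = fun i => X ^ N * z i := by
  obtain ⟨h, hI1, hI2⟩ := SetLike.not_le_iff_exists.1
    (fun hle => hne (hp.eq_of_le hI' hm' hle))
  obtain ⟨h', hI1', hI2'⟩ := SetLike.not_le_iff_exists.1
    (fun hle => hne (hp'.eq_of_le hI hm hle).symm)
  rw [hp.mem_iff] at hI1 hI2'
  rw [hp'.mem_iff] at hI2 hI1'
  obtain ⟨N, hN⟩ := hp.exists_ev_eq hI2'
  obtain ⟨N', hN'⟩ := hp'.exists_ev_eq hI2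
  refine ⟨N + N', fun z => ?_⟩
  obtain ⟨g, hg⟩ := hN (X ^ N' * z 0)
  obtain ⟨g', hg'⟩ := hN' (X ^ N * z 1)
  refine ⟨h' * g + h * g', ?_⟩
  ext1 i
  fin_cases i
  · change p.ev (h' * g + h * g') = X ^ (N + N') * z 0
    rw [map_add, hg, map_mul, hI1]
    ring
  · change p'.ev (h' * g + h * g') = X ^ (N + N') * z 1
    rw [map_add, hg', map_mul, hI1']
    ring

theorem exists_equiv_of_ne (hp : p.Parametrizes I) (hp' : p'.Parametrizes I') (hI : I.IsPrime)
    (hI' : I'.IsPrime) (hm : ¬ I.IsMaximal) (hm' : ¬ I'.IsMaximal) (hne : I ≠ I') :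
    ∃ e : FractionRing (MvPowerSeries (Fin 2) K ⧸ I ⊓ I') ≃+* (Fin 2 → FractionRing K⟦X⟧),
      ∀ g, e (algebraMap _ _ (Ideal.Quotient.mk (I ⊓ I') g)) =
        emb K (Fin 2) (evPi ![p, p'] g) := by
  refine exists_equiv_of_evPi (fun g => ?_) (exists_evPi_pair_eq hp hp' hI hI' hm hm' hne)
  rw [Ideal.mem_inf, hp.mem_iff, hp'.mem_iff]
  constructor
  · rintro ⟨h, h'⟩
    ext1 i
    fin_cases i
    exacts [h, h']
  · exact fun h => ⟨congrFun h 0, congrFun h 1⟩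

theorem le_iterate_blowup {Q : Type*} [CommRing Q] (S : Subring Q) (n : ℕ) :
    S ≤ blowup^[n] S := by
  induction n with
  | zero => exact le_rfl
  | succ n ih =>
    rw [Function.iterate_succ_apply']
    exact ih.trans (le_blowup _)

variable {P P' : ℕ → Param K} {s s' : ℕ → Option K}

/-- Common tangents keep the ring an image of K[[X,Y]]. After the first difference an element with
two different residues is present. All later rings contain it, and by the conductor they stay inside
K[[t]] × K[[t]], where such an element contradicts locality. -/
theorem isLocalRing_neighbourhood_of_step [Infinite K] (hp : (P 0).Parametrizes I) (hp' : (P' 0).Parametrizes I')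
    (hI : I.IsPrime) (hI' : I'.IsPrime) (hm' : ¬ I.IsMaximal) (hm'' : ¬ I'.IsMaximal) (hne : I ≠ I')
    (hs : ∀ j, Step (s j) (P j) (P (j + 1))) (hs' : ∀ j, Step (s' j) (P' j) (P' (j + 1))) :
    (∀ n, (∀ j < n, s j = s' j) →
      IsLocalRing (neighbourhood (MvPowerSeries (Fin 2) K ⧸ I ⊓ I') n)) ∧
    (∀ n, (∀ j < n, s j = s' j) → s n ≠ s' n → ∀ m, n < m →
      ¬ IsLocalRing (neighbourhood (MvPowerSeries (Fin 2) K ⧸ I ⊓ I') m)) := by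
  obtain ⟨e, he⟩ := exists_equiv_of_ne hp hp' hI hI' hm' hm'' hne
  have key : ∀ n, (∀ j < n, s j = s' j) →
      (neighbourhood (MvPowerSeries (Fin 2) K ⧸ I ⊓ I') n).map (e : _ →+* _) =
        Param.ring ![P n, P' n] ∧ ∀ i, (![P n, P' n] i).Nondeg := by
    intro n hn
    refine neighbourhood_map_eq_ring (P := fun j => ![P j, P' j]) he ?_ (n := n) ?_ le_rfl
    · rw [Fin.forall_fin_two]
      exact ⟨hp.nondeg, hp'.nondeg⟩
    · intro j hj
      refine ⟨s j, ?_⟩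
      rw [Fin.forall_fin_two]
      exact ⟨hs j, hn j hj ▸ hs' j⟩
  refine ⟨fun n hn => ?_, fun n hn hn' m hm => ?_⟩
  · rw [isLocalRing_neighbourhood_iff e, (key n hn).1]
    exact isLocalRing_ring _
  · rw [isLocalRing_neighbourhood_iff e, neighbourhood_map]
    obtain ⟨k, rfl⟩ := Nat.exists_eq_add_of_lt hm
    obtain ⟨h1, h2⟩ := key n hn
    rw [neighbourhood_map] at h1
    rw [show n + k + 1 = k + (n + 1) by omega, Function.iterate_add_apply,
      Function.iterate_succ_apply' _ n, h1]
    have hc : HasConductor (Param.ring ![P n, P' n]) := by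
      obtain ⟨h3, -⟩ := key 0 (by simp)
      rw [neighbourhood_map, Function.iterate_zero_apply] at h3
      obtain ⟨N, hN⟩ := exists_evPi_pair_eq hp hp' hI hI' hm' hm'' hne
      refine HasConductor.mono (S := Param.ring ![P 0, P' 0]) ⟨N, fun z => ?_⟩ ?_
      · obtain ⟨g, hg⟩ := hN z
        exact ⟨g, by rw [← hg]; rfl⟩
      · rw [← h1, ← h3]
        exact le_iterate_blowup _ n
    have hle := blowup_le_range (ring_le_range _) hc
    have hc' := hc.mono (le_blowup _)
    obtain ⟨h4, h5⟩ := iterate_blowup_le_range hle hc' k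
    obtain ⟨d, hd, hd'⟩ := exists_mem_blowup_of_step_ne (P := ![P n, P' n])
      (Q := ![P (n + 1), P' (n + 1)]) (s := ![s n, s' n])
      (by rw [Fin.forall_fin_two]; exact ⟨hs n, hs' n⟩) h2 (i := 0) (j := 1) hn'
    exact not_isLocalRing_of_mem h4 (fun c => h5 (le_blowup _ (algebraMap_mem_ring _ c))) (h5 hd) hd'

end TwoBranches

end PlaneCurve

namespace PlaneCurve

universe u
variable {K : Type u} [Field K]

open PowerSeries

/-! ### Expansion in a uniformizer, and linear dependence modulo x -/

section Normalization

/-- Nonzero coefficients are units of V, so the lowest term of a polynomial in t determines its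
t-adic order. -/
theorem X_pow_dvd_of_pow_dvd_eval₂ {V : Type*} [CommRing V] [IsDomain V] {κ : K →+* V} {t : V}
    (ht0 : t ≠ 0) (ht : ¬ IsUnit t) {N : ℕ} {p : Polynomial K} (h : t ^ N ∣ p.eval₂ κ t) :
    Polynomial.X ^ N ∣ p := by
  induction N generalizing p with
  | zero => simp
  | succ N ih =>
    have e : p.eval₂ κ t = p.divX.eval₂ κ t * t + κ (p.coeff 0) := by
      conv_lhs => rw [← Polynomial.divX_mul_X_add p]
      simp
    have h0 : p.coeff 0 = 0 := by
      by_contra h0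
      have h1 : t ∣ κ (p.coeff 0) := by
        rw [← dvd_add_right (dvd_mul_left t (p.divX.eval₂ κ t)), ← e]
        exact (dvd_pow_self t (by omega)).trans h
      exact ht (isUnit_of_dvd_unit h1 ((IsUnit.mk0 _ h0).map κ))
    rw [e, h0, map_zero, add_zero, pow_succ] at h
    obtain ⟨q, hq⟩ := ih ((mul_dvd_mul_iff_right ht0).1 h)
    refine ⟨q, ?_⟩
    conv_lhs => rw [← Polynomial.divX_mul_X_add p, hq, h0, map_zero, add_zero]
    ring

/-- A discrete valuation ring with coefficient field `K` embeds into `K[[X]]`. -/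
theorem exists_ringHom_powerSeries {V : Type*} [CommRing V] [IsDomain V] (κ : K →+* V) {t : V}
    (ht0 : t ≠ 0) (ht : ¬ IsUnit t) (hres : ∀ z, ∃ c w, z = κ c + t * w)
    (hsep : ∀ z, (∀ N : ℕ, t ^ N ∣ z) → z = 0) :
    ∃ β : V →+* K⟦X⟧, Function.Injective β ∧ (∀ c, β (κ c) = C c) ∧ β t = X := by
  -- An element z has the expansion f if to every order both are approximated by a common
  -- polynomial.
  let Rel : V → K⟦X⟧ → Prop := fun z f => ∀ N : ℕ, ∃ p : Polynomial K,
    t ^ N ∣ z - p.eval₂ κ t ∧ (X : K⟦X⟧) ^ N ∣ f - (p : K⟦X⟧)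
  have hpoly : ∀ p : Polynomial K, Rel (p.eval₂ κ t) (p : K⟦X⟧) := fun p N => ⟨p, by simp, by simp⟩
  have hadd : ∀ {z z' f f'}, Rel z f → Rel z' f' → Rel (z + z') (f + f') := by
    intro z z' f f' h h' N
    obtain ⟨p, hp, hp'⟩ := h N
    obtain ⟨q, hq, hq'⟩ := h' N
    refine ⟨p + q, ?_, ?_⟩
    · rw [Polynomial.eval₂_add, add_sub_add_comm]
      exact dvd_add hp hq
    · rw [Polynomial.coe_add, add_sub_add_comm]
      exact dvd_add hp' hq'
  have hmul : ∀ {z z' f f'}, Rel z f → Rel z' f' → Rel (z * z') (f * f') := by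
    intro z z' f f' h h' N
    obtain ⟨p, hp, hp'⟩ := h N
    obtain ⟨q, hq, hq'⟩ := h' N
    refine ⟨p * q, ?_, ?_⟩
    · rw [Polynomial.eval₂_mul]
      exact dvd_mul_sub_mul hp hq
    · rw [Polynomial.coe_mul]
      exact dvd_mul_sub_mul hp' hq'
  have hz0 : ∀ {z}, Rel z 0 → z = 0 := by
    intro z h
    refine hsep z fun N => ?_
    obtain ⟨p, hp, hp'⟩ := h N
    rw [zero_sub, dvd_neg, PowerSeries.X_pow_dvd_iff] at hp'
    have h1 : Polynomial.X ^ N ∣ p := Polynomial.X_pow_dvd_iff.2 fun d hd => by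
      simpa using hp' d hd
    obtain ⟨q, rfl⟩ := h1
    rw [Polynomial.eval₂_mul, Polynomial.eval₂_pow, Polynomial.eval₂_X] at hp
    exact (dvd_sub_left (dvd_mul_right _ _)).1 hp
  have hf0 : ∀ {f}, Rel 0 f → f = 0 := by
    intro f h
    refine eq_of_forall_X_pow_dvd fun N => ?_
    obtain ⟨p, hp, hp'⟩ := h N
    rw [zero_sub, dvd_neg] at hp
    obtain ⟨q, rfl⟩ := X_pow_dvd_of_pow_dvd_eval₂ ht0 ht hp
    rw [Polynomial.coe_mul, Polynomial.coe_pow, Polynomial.coe_X] at hp'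
    rw [sub_zero]
    exact (dvd_sub_left (dvd_mul_right _ _)).1 hp'
  have hneg : ∀ {z f}, Rel z f → Rel (-z) (-f) := fun h => by
    have h1 := hmul (hpoly (-1)) h
    simpa using h1
  have huniq : ∀ {z f f'}, Rel z f → Rel z f' → f = f' := fun h h' => by
    have h1 := hadd h (hneg h')
    rw [add_neg_cancel] at h1
    exact eq_of_sub_eq_zero (by rw [sub_eq_add_neg]; exact hf0 h1)
  have hex : ∀ z, ∃ f, Rel z f := by
    intro z
    have h1 : ∀ (N : ℕ) (z : V), ∃ p : Polynomial K, t ^ N ∣ z - p.eval₂ κ t := by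
      intro N
      induction N with
      | zero => exact fun z => ⟨0, by simp⟩
      | succ N ih =>
        intro z
        obtain ⟨c, w, rfl⟩ := hres z
        obtain ⟨p, q, hq⟩ := ih w
        refine ⟨Polynomial.C c + Polynomial.X * p, q, ?_⟩
        simp only [Polynomial.eval₂_add, Polynomial.eval₂_C, Polynomial.eval₂_mul,
          Polynomial.eval₂_X]
        linear_combination t * hq
    choose p hp using fun N => h1 N z
    have h2 : ∀ {N M : ℕ}, N ≤ M → Polynomial.X ^ N ∣ p M - p N := by
      intro N M hNM
      apply X_pow_dvd_of_pow_dvd_eval₂ (κ := κ) ht0 ht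
      have := dvd_sub (hp N) ((pow_dvd_pow t hNM).trans (hp M))
      rw [Polynomial.eval₂_sub]
      convert this using 1
      ring
    refine ⟨PowerSeries.mk fun n => (p (n + 1)).coeff n, fun N => ⟨p N, hp N, ?_⟩⟩
    rw [PowerSeries.X_pow_dvd_iff]
    intro d hd
    rw [map_sub, PowerSeries.coeff_mk, Polynomial.coeff_coe]
    have := Polynomial.X_pow_dvd_iff.1 (h2 (show d + 1 ≤ N from hd)) d (by omega)
    rw [Polynomial.coeff_sub] at this
    linear_combination -this
  choose β hβ using hex
  have hκ : ∀ c, β (κ c) = C c := fun c => huniq (hβ _) (by simpa using hpoly (Polynomial.C c))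
  have hinj : ∀ z, β z = 0 → z = 0 := fun z h => hz0 (h ▸ hβ z)
  refine ⟨⟨⟨⟨β, by simpa using hκ 1⟩, fun a b => huniq (hβ _) (hmul (hβ a) (hβ b))⟩,
    by simpa using hκ 0, fun a b => huniq (hβ _) (hadd (hβ a) (hβ b))⟩, ?_, hκ, ?_⟩
  · exact (injective_iff_map_eq_zero _).2 hinj
  · exact huniq (hβ _) (by simpa using hpoly Polynomial.X)

variable {R : Type*} [CommRing R] {ρ : K⟦X⟧ →+* R}

theorem exists_dvd_map_X_pow [IsDomain R] (hinj : Function.Injective ρ) (hfin : ρ.Finite) {r : R} (hr : r ≠ 0) :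
    ∃ n : ℕ, r ∣ ρ X ^ n := by
  let := ρ.toAlgebra
  have : Module.Finite K⟦X⟧ R := hfin
  have : FaithfulSMul K⟦X⟧ R := (faithfulSMul_iff_algebraMap_injective _ _).2 hinj
  obtain ⟨a, ha, h⟩ := (Algebra.IsIntegral.isIntegral (R := K⟦X⟧) r).isAlgebraic.exists_nonzero_dvd
    (mem_nonZeroDivisors_of_ne_zero hr)
  refine ⟨a.order.toNat, h.trans ?_⟩
  rw [← map_pow]
  exact map_dvd ρ (X_pow_dvd_of_ne_zero ha)

/-- This bounds the dimension of V/xV by m: after clearing denominators, m + 1 elements of V lie in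
a module spanned by m elements over K[[x]], hence are dependent. Once the relation is divided by the
common power of x, its constant terms give a nontrivial relation over K modulo x. -/
theorem exists_dvd_sum (hinj : Function.Injective ρ) {m : ℕ} {y : Fin m → R}
    (hy : ∀ z, ∃ a : Fin m → K⟦X⟧, z = ∑ i, ρ (a i) * y i) {V : Type*} [CommRing V] [IsDomain V]
    {θ : R →+* V} (hθ : Function.Injective θ)
    (hfrac : ∀ z : V, ∃ (n : ℕ) (r : R), z * θ (ρ X) ^ n = θ r) {w : Fin (m + 1) → V} :
    ∃ c : Fin (m + 1) → K, c ≠ 0 ∧ θ (ρ X) ∣ ∑ i, θ (ρ (C (c i))) * w i := by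
  have hx0 : θ (ρ X) ≠ 0 := by
    rw [Ne, map_eq_zero_iff _ hθ, map_eq_zero_iff _ hinj]
    exact X_ne_zero
  choose n r hr using fun i => hfrac (w i)
  choose a ha using fun i => hy (r i)
  let A : Fin (m + 1) → Fin m → K⟦X⟧ := fun i l => X ^ (∑ k, n k - n i) * a i l
  have hA : ¬ LinearIndependent K⟦X⟧ A := fun h => by
    have := h.fintype_card_le_finrank
    simp at this
  rw [Fintype.not_linearIndependent_iff] at hA
  obtain ⟨b, hb, i₀, hi₀⟩ := hA
  have h0 : ∑ i, θ (ρ (b i)) * w i = 0 := by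
    have h1 : ∀ i, w i * θ (ρ X) ^ (∑ k, n k) = θ (∑ l, ρ (A i l) * y l) := by
      intro i
      rw [← Nat.sub_add_cancel (Finset.single_le_sum (f := n) (fun _ _ => Nat.zero_le _)
        (Finset.mem_univ i)), pow_add, mul_left_comm, hr, ha i, ← map_pow, ← map_mul,
        Finset.mul_sum]
      congr 1
      refine Finset.sum_congr rfl fun l _ => ?_
      simp only [A, map_mul, map_pow, mul_assoc]
    have h2 : (∑ i, θ (ρ (b i)) * w i) * θ (ρ X) ^ (∑ k, n k) = 0 := by
      rw [Finset.sum_mul]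
      simp_rw [mul_assoc, h1, ← map_mul, ← map_sum, Finset.mul_sum]
      rw [Finset.sum_comm]
      have h3 : ∀ l, ∑ i, ρ (b i) * (ρ (A i l) * y l) = 0 := fun l => by
        simp_rw [← mul_assoc, ← Finset.sum_mul, ← map_mul, ← map_sum]
        have := congrFun hb l
        simp only [Finset.sum_apply, Pi.smul_apply, smul_eq_mul, Pi.zero_apply] at this
        rw [this, map_zero, zero_mul]
      simp [h3]
    exact (mul_eq_zero.1 h2).resolve_right (pow_ne_zero _ hx0)
  clear hb
  -- Removing a common factor X lowers the order of one fixed nonzero coefficient, so this process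
  -- ends.
  obtain ⟨k, hk⟩ : ∃ k, (b i₀).order.toNat = k := ⟨_, rfl⟩
  induction k using Nat.strong_induction_on generalizing b with
  | _ k ih =>
    by_cases hc : ∃ i, constantCoeff (b i) ≠ 0
    · obtain ⟨i, hi⟩ := hc
      refine ⟨fun i => constantCoeff (b i), fun h => hi (congrFun h i), ?_⟩
      have h4 : ∀ i, ∃ q, b i = C (constantCoeff (b i)) + X * q := fun i => by
        obtain ⟨q, hq⟩ := PowerSeries.X_dvd_iff.2
          (show constantCoeff (b i - C (constantCoeff (b i))) = 0 by simp)
        exact ⟨q, by rw [← hq]; ring⟩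
      choose q hq using h4
      refine ⟨-∑ i, θ (ρ (q i)) * w i, ?_⟩
      rw [mul_neg, Finset.mul_sum, eq_neg_iff_add_eq_zero, ← Finset.sum_add_distrib, ← h0]
      refine Finset.sum_congr rfl fun i _ => ?_
      conv_rhs => rw [hq i]
      simp only [map_add, map_mul]
      ring
    · push Not at hc
      choose q hq using fun i => PowerSeries.X_dvd_iff.2 (hc i)
      have hq0 : q i₀ ≠ 0 := fun h => hi₀ (by rw [hq, h, mul_zero])
      refine ih (q i₀).order.toNat ?_ q hq0 ?_ rfl
      · rw [← hk, hq i₀, PowerSeries.order_mul, PowerSeries.order_X,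
          ENat.toNat_add (by simp) (PowerSeries.order_eq_top.not.2 hq0)]
        simp
      · have h5 : θ (ρ X) * ∑ i, θ (ρ (q i)) * w i = 0 := by
          rw [← h0, Finset.mul_sum]
          refine Finset.sum_congr rfl fun i _ => ?_
          rw [hq i, map_mul, map_mul]
          ring
        exact (mul_eq_zero.1 h5).resolve_left hx0

end Normalization

end PlaneCurve

namespace PlaneCurve

universe u
variable {K : Type u} [Field K]

open PowerSeries Param

/-! ### Existence of primitive parametrizations -/

section Normalization

variable {R : Type*} [CommRing R] [IsDomain R] {ρ : K⟦X⟧ →+* R}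

/-- By `exists_dvd_sum` V/xV is finite over K, and V is x-adically separated, so V is finite over
K[[x]] and Noetherian. A Noetherian valuation ring has a principal maximal ideal (t). Its residue
field is finite over K, hence equal to K, and expansion in t gives the embedding. Writing t as a
fraction with denominator x^n yields r, which will produce the conductor. -/
theorem exists_ringHom_of_valuationRing [IsAlgClosed K] (hinj : Function.Injective ρ) {m : ℕ}
    {y : Fin m → R} (hy : ∀ z, ∃ a : Fin m → K⟦X⟧, z = ∑ i, ρ (a i) * y i) {V : Type*}
    [CommRing V] [IsDomain V] [ValuationRing V] {θ : R →+* V} (hθ : Function.Injective θ)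
    (hx : ¬ IsUnit (θ (ρ X))) (hfrac : ∀ z : V, ∃ (n : ℕ) (r : R), z * θ (ρ X) ^ n = θ r) :
    ∃ β : R →+* K⟦X⟧, Function.Injective β ∧ (∀ c, β (ρ (C c)) = C c) ∧
      ∃ (r : R) (n : ℕ), β r = X * β (ρ X) ^ n := by
  set x := θ (ρ X) with hxdef
  have hx0 : x ≠ 0 := by
    rw [Ne, map_eq_zero_iff _ hθ, map_eq_zero_iff _ hinj]
    exact X_ne_zero
  let κ : K →+* V := (θ.comp ρ).comp C
  let := κ.toAlgebra
  let M := V ⧸ Ideal.span {x}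
  have hfinM : Module.Finite K M := by
    rw [← Module.rank_lt_aleph0_iff]
    refine lt_of_le_of_lt (rank_le (n := m) fun s hs => ?_) (Cardinal.natCast_lt_aleph0 (n := m))
    by_contra hlt
    push Not at hlt
    obtain ⟨f⟩ : Nonempty (Fin (m + 1) ↪ s) :=
      Function.Embedding.nonempty_of_card_le (by simpa using hlt)
    choose w hw using fun i => Ideal.Quotient.mk_surjective ((f i : s) : M)
    obtain ⟨c, hc, hc'⟩ := exists_dvd_sum hinj hy hθ hfrac (w := w)
    have hli := hs.comp f f.injective
    rw [Fintype.linearIndependent_iff] at hli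
    refine hc (funext (hli c ?_))
    have h1 := Ideal.Quotient.eq_zero_iff_mem.2 (Ideal.mem_span_singleton.2 hc')
    rw [map_sum] at h1
    rw [← h1]
    refine Finset.sum_congr rfl fun i _ => ?_
    rw [map_mul, hw, Algebra.smul_def]
    rfl
  have hsep : ∀ z : V, (∀ N : ℕ, x ^ N ∣ z) → z = 0 := by
    intro z hz
    by_contra hz0
    obtain ⟨n, r, hr⟩ := hfrac z
    have hr0 : r ≠ 0 := by
      rintro rfl
      rw [map_zero] at hr
      exact mul_ne_zero hz0 (pow_ne_zero _ hx0) hr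
    obtain ⟨k, hk⟩ := exists_dvd_map_X_pow hinj (.of_forall_exists_sum y hy) hr0
    have h1 : x ^ (k + 1) ∣ x ^ k := by
      refine ((hz (k + 1)).trans ⟨_, hr.symm⟩).trans ?_
      rw [hxdef, ← map_pow]
      exact map_dvd θ hk
    obtain ⟨w, hw⟩ := h1
    refine hx (IsUnit.of_mul_eq_one w (mul_left_cancel₀ (pow_ne_zero k hx0) ?_))
    rw [mul_one, ← mul_assoc, ← pow_succ]
    exact hw.symm
  have hVfin : (θ.comp ρ).Finite := by
    let b := Module.finBasis K M
    choose v hv using fun i => Ideal.Quotient.mk_surjective (b i)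
    refine .of_forall_exists_sum v (exists_sum_mul_of_separated _ hsep v fun z => ?_)
    have h1 : Ideal.Quotient.mk (Ideal.span {x})
        (z - ∑ i, κ (b.repr (Ideal.Quotient.mk _ z) i) * v i) = 0 := by
      rw [map_sub, map_sum, sub_eq_zero]
      conv_lhs => rw [← b.sum_repr (Ideal.Quotient.mk (Ideal.span {x}) z)]
      refine Finset.sum_congr rfl fun i _ => ?_
      rw [map_mul, hv, Algebra.smul_def]
      rfl
    obtain ⟨w, hw⟩ := Ideal.mem_span_singleton.1 (Ideal.Quotient.eq_zero_iff_mem.1 h1)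
    exact ⟨_, w, eq_add_of_sub_eq' hw⟩
  have hnoeth : IsNoetherianRing V := by
    let := (θ.comp ρ).toAlgebra
    have : Module.Finite K⟦X⟧ V := hVfin
    exact IsNoetherianRing.of_finite K⟦X⟧ V
  obtain ⟨t, ht⟩ := IsBezout.isPrincipal_of_FG (IsLocalRing.maximalIdeal V)
    (IsNoetherian.noetherian _)
  rw [Ideal.submodule_span_eq] at ht
  have htmem : ∀ z, ¬ IsUnit z ↔ t ∣ z := fun z => by
    rw [← Ideal.mem_span_singleton, ← ht, IsLocalRing.mem_maximalIdeal, mem_nonunits_iff]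
  have htu : ¬ IsUnit t := (htmem t).2 dvd_rfl
  have ht0 : t ≠ 0 := by
    rintro rfl
    exact hx0 (zero_dvd_iff.1 ((htmem x).1 hx))
  have hres : ∀ z, ∃ c w, z = κ c + t * w := by
    intro z
    have hle : Ideal.span {x} ≤ IsLocalRing.maximalIdeal V := by
      rw [Ideal.span_singleton_le_iff_mem]
      exact hx
    let q : M →ₐ[K] V ⧸ IsLocalRing.maximalIdeal V := Ideal.Quotient.factorₐ K hle
    have : Module.Finite K (V ⧸ IsLocalRing.maximalIdeal V) :=
      Module.Finite.of_surjective q.toLinearMap (Ideal.Quotient.factor_surjective hle)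
    have : Algebra.IsIntegral K (V ⧸ IsLocalRing.maximalIdeal V) := .of_finite _ _
    obtain ⟨c, hc⟩ := (IsAlgClosed.algebraMap_bijective_of_isIntegral (k := K)
      (K := V ⧸ IsLocalRing.maximalIdeal V)).2 (Ideal.Quotient.mk _ z)
    have h1 : Ideal.Quotient.mk (IsLocalRing.maximalIdeal V) (z - κ c) = 0 := by
      rw [map_sub, ← hc, sub_eq_zero]
      rfl
    rw [Ideal.Quotient.eq_zero_iff_mem, ht] at h1
    obtain ⟨w, hw⟩ := Ideal.mem_span_singleton.1 h1
    exact ⟨c, w, eq_add_of_sub_eq' hw⟩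
  obtain ⟨β, hβ, hβC, hβX⟩ := exists_ringHom_powerSeries κ ht0 htu hres fun z hz => by
    have h1 := Ideal.iInf_pow_eq_bot_of_isLocalRing (IsLocalRing.maximalIdeal V)
      (Ideal.IsPrime.ne_top inferInstance)
    rw [← Ideal.mem_bot, ← h1, Ideal.mem_iInf]
    intro N
    rw [ht, Ideal.span_singleton_pow]
    exact Ideal.mem_span_singleton.2 (hz N)
  obtain ⟨n, r, hr⟩ := hfrac t
  refine ⟨β.comp θ, hβ.comp hθ, hβC, r, n, ?_⟩
  rw [RingHom.comp_apply, ← hr, map_mul, hβX, map_pow]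
  rfl

/-- Choose a valuation ring of the fraction field dominating R. Domination keeps x a non-unit; since
every nonzero element of R divides a power of x, all denominators may be taken to be powers of x. -/
theorem exists_ringHom_of_finite [IsAlgClosed K] [IsLocalRing R] (hinj : Function.Injective ρ)
    {m : ℕ} {y : Fin m → R} (hy : ∀ z, ∃ a : Fin m → K⟦X⟧, z = ∑ i, ρ (a i) * y i)
    (hx : ¬ IsUnit (ρ X)) :
    ∃ β : R →+* K⟦X⟧, Function.Injective β ∧ (∀ c, β (ρ (C c)) = C c) ∧
      ∃ (r : R) (n : ℕ), β r = X * β (ρ X) ^ n := by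
  have hinjL := IsFractionRing.injective R (FractionRing R)
  obtain ⟨V, hV⟩ := LocalSubring.exists_le_valuationSubring
    (LocalSubring.range (algebraMap R (FractionRing R)))
  obtain ⟨hle, hloc⟩ := LocalSubring.le_def.1 hV
  have hmem : ∀ r, algebraMap R (FractionRing R) r ∈ V := fun r => hle ⟨r, rfl⟩
  let θ : R →+* V := (algebraMap R (FractionRing R)).codRestrict V hmem
  have hθ : Function.Injective θ := fun a b h => hinjL (congrArg Subtype.val h)
  refine exists_ringHom_of_valuationRing hinj hy hθ (fun hu => hx ?_) fun z => ?_
  · let g : (algebraMap R (FractionRing R)).range →+* V := Subring.inclusion hle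
    let s := (algebraMap R (FractionRing R)).rangeRestrict
    have h1 : IsUnit (Subring.inclusion hle (s (ρ X))) := hu
    have h2 : IsUnit (s (ρ X)) := hloc.map_nonunit _ h1
    obtain ⟨b, hb⟩ := h2.exists_right_inv
    obtain ⟨r, rfl⟩ := (algebraMap R (FractionRing R)).rangeRestrict_surjective b
    refine IsUnit.of_mul_eq_one r (hinjL ?_)
    rw [map_mul, map_one]
    exact congrArg Subtype.val hb
  · obtain ⟨a, b, hb, e⟩ := IsFractionRing.div_surjective (A := R) (z : FractionRing R)
    have hb0 : b ≠ 0 := nonZeroDivisors.ne_zero hb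
    obtain ⟨n, w, hw⟩ := exists_dvd_map_X_pow hinj (.of_forall_exists_sum y hy) hb0
    refine ⟨n, a * w, Subtype.ext ?_⟩
    change (z : FractionRing R) * algebraMap R (FractionRing R) (ρ X) ^ n =
      algebraMap R (FractionRing R) (a * w)
    have hb1 : algebraMap R (FractionRing R) b ≠ 0 := by
      rwa [Ne, map_eq_zero_iff _ hinjL]
    rw [← e, ← map_pow, hw, map_mul, map_mul]
    field_simp

/-- A prime ideal not containing `X i` has an element that is not divisible by `X i`. -/
theorem exists_mem_not_dvd {I : Ideal (MvPowerSeries (Fin 2) K)} (hI : I.IsPrime) (hbot : I ≠ ⊥)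
    {i : Fin 2} (hi : MvPowerSeries.X i ∉ I) : ∃ g ∈ I, ¬ MvPowerSeries.X i ∣ g := by
  by_contra! h
  apply hbot
  -- Nakayama: if X_i divides every element of the prime I but is not in I, then I = X_i I.
  refine Submodule.eq_bot_of_le_smul_of_le_jacobson_bot (Ideal.span {MvPowerSeries.X i}) I
    (IsNoetherian.noetherian _) (fun g hg => ?_) ?_
  · obtain ⟨g', rfl⟩ := h g hg
    rw [smul_eq_mul]
    exact Ideal.mul_mem_mul (Ideal.mem_span_singleton_self _)
      ((hI.mem_or_mem hg).resolve_left hi)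
  · rw [Ideal.jacobson_bot, IsLocalRing.ringJacobson_eq_maximalIdeal,
      Ideal.span_singleton_le_iff_mem]
    exact X_mem_maxIdeal i

/-- Every branch has a primitive parametrization. -/
theorem Branch.exists_parametrizes [IsAlgClosed K] (B : Branch K) :
    ∃ p : Param K, p.Parametrizes B.ideal := by
  have hB := B.isPrime
  obtain ⟨i, hi⟩ : ∃ i : Fin 2, MvPowerSeries.X i ∉ B.ideal := by
    by_contra! h
    apply B.not_isMaximal
    have : B.ideal = maxIdeal K := by
      refine le_antisymm (IsLocalRing.le_maximalIdeal hB.ne_top) ?_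
      rw [maxIdeal_eq_span, Ideal.span_le]
      rintro x (rfl | rfl) <;> exact h _
    rw [this]
    infer_instance
  obtain ⟨j, hij⟩ : ∃ j : Fin 2, i ≠ j := ⟨i + 1, by fin_cases i <;> simp⟩
  have : IsLocalRing B.Ring := IsLocalRing.of_surjective' (Ideal.Quotient.mk B.ideal)
    Ideal.Quotient.mk_surjective
  have hloc : ∀ g ∈ maxIdeal K, ¬ IsUnit (Ideal.Quotient.mk B.ideal g) := by
    intro g hg hu
    obtain ⟨r, hr⟩ := hu.exists_right_inv
    obtain ⟨g', rfl⟩ := Ideal.Quotient.mk_surjective r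
    rw [← map_mul, ← map_one (Ideal.Quotient.mk B.ideal), Ideal.Quotient.eq] at hr
    have h1 := IsLocalRing.le_maximalIdeal hB.ne_top hr
    have h2 := Ideal.sub_mem _ (Ideal.mul_mem_right g' _ hg) h1
    rw [sub_sub_cancel] at h2
    exact (Ideal.ne_top_iff_one _).1 (Ideal.IsPrime.ne_top inferInstance) h2
  let ρ : K⟦X⟧ →+* B.Ring := (Ideal.Quotient.mk B.ideal).comp
    (toMvPowerSeries i : K⟦X⟧ →ₐ[K] MvPowerSeries (Fin 2) K)
  have hρ : ∀ a, ρ a = Ideal.Quotient.mk B.ideal (a.toMvPowerSeries i) := fun _ => rfl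
  have hρX : ρ X = Ideal.Quotient.mk B.ideal (MvPowerSeries.X i) := by
    rw [hρ, toMvPowerSeries_X]
  have hx : ¬ IsUnit (ρ X) := hρX ▸ hloc _ (X_mem_maxIdeal i)
  have hinj : Function.Injective ρ := by
    rw [injective_iff_map_eq_zero]
    intro a ha
    by_contra h0
    have h1 := map_dvd ρ (X_pow_dvd_of_ne_zero h0)
    rw [ha, zero_dvd_iff, map_pow, hρX] at h1
    exact hi (Ideal.Quotient.eq_zero_iff_mem.1 (IsReduced.eq_zero _ ⟨_, h1⟩))
  obtain ⟨g, hg, hgX⟩ := exists_mem_not_dvd hB B.ne_bot hi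
  obtain ⟨g₀, g₁, hg₀, -⟩ := exists_eq_toMvPowerSeries_add_X_mul hij g
  have hg₀0 : g₀ ≠ 0 := by
    rintro rfl
    rw [map_zero, zero_add] at hg₀
    exact hgX ⟨_, hg₀⟩
  have hsep : ∀ z : B.Ring, (∀ N : ℕ, ρ X ^ N ∣ z) → z = 0 := by
    intro z hz
    have h1 := Ideal.iInf_pow_eq_bot_of_isLocalRing (Ideal.span {ρ X})
      (by rwa [Ne, Ideal.span_singleton_eq_top])
    rw [← Ideal.mem_bot, ← h1, Ideal.mem_iInf]
    intro N
    rw [Ideal.span_singleton_pow]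
    exact Ideal.mem_span_singleton.2 (hz N)
  obtain ⟨w, hw⟩ := X_pow_dvd_of_ne_zero hg₀0
  set m := g₀.order.toNat
  -- Weierstrass division: modulo X_i the element g of the ideal is a series of order m in X_j, so
  -- the powers of X_j below m span the quotient modulo X_i.
  have hy := exists_sum_mul_of_separated ρ hsep
    (fun l : Fin m => Ideal.Quotient.mk B.ideal (MvPowerSeries.X j) ^ (l : ℕ)) fun z => by
      obtain ⟨h, rfl⟩ := Ideal.Quotient.mk_surjective z
      obtain ⟨h₀, h₁, hh, -⟩ := exists_eq_toMvPowerSeries_add_X_mul hij h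
      obtain ⟨q, hq⟩ : X ^ m ∣ h₀ - ∑ l : Fin m, C (coeff (l : ℕ) h₀) * X ^ (l : ℕ) := by
        rw [PowerSeries.X_pow_dvd_iff]
        intro k hk
        rw [map_sub, map_sum, Finset.sum_eq_single (⟨k, hk⟩ : Fin m)]
        · simp
        · intro b _ hb
          simp only [PowerSeries.coeff_C_mul, PowerSeries.coeff_X_pow]
          rw [if_neg, mul_zero]
          rintro rfl
          exact hb rfl
        · simp
      refine ⟨fun l => coeff (l : ℕ) h₀,
        Ideal.Quotient.mk B.ideal (h₁ - g₁ * (w * q).toMvPowerSeries j), ?_⟩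
      have h2 : Ideal.Quotient.mk B.ideal g = 0 := Ideal.Quotient.eq_zero_iff_mem.2 hg
      have h3 := congrArg (fun a => Ideal.Quotient.mk B.ideal (a.toMvPowerSeries j))
        (eq_add_of_sub_eq' hq)
      rw [hw] at h3
      rw [hg₀] at h2
      simp only [map_add, map_mul, map_sum, map_pow, toMvPowerSeries_X, toMvPowerSeries_C] at h2 h3
      rw [hh]
      simp only [map_add, map_mul, map_sub, hρ, toMvPowerSeries_X, toMvPowerSeries_C]
      linear_combination h3 + Ideal.Quotient.mk B.ideal (w.toMvPowerSeries j) *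
        Ideal.Quotient.mk B.ideal (q.toMvPowerSeries j) * h2
  obtain ⟨β, hβ, hβC, r, n, hr⟩ := exists_ringHom_of_finite hinj hy hx
  obtain ⟨h, rfl⟩ := Ideal.Quotient.mk_surjective r
  let φ : MvPowerSeries (Fin 2) K →ₐ[K] K⟦X⟧ :=
    { β.comp (Ideal.Quotient.mk B.ideal) with
      commutes' := fun c => by
        have := hβC c
        rw [hρ, toMvPowerSeries_C] at this
        exact this }
  have hφ : ∀ a, φ a = β (Ideal.Quotient.mk B.ideal a) := fun _ => rfl
  let p : Param K := ⟨φ (MvPowerSeries.X 0), φ (MvPowerSeries.X 1),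
    constantCoeff_algHom φ (X_mem_maxIdeal 0), constantCoeff_algHom φ (X_mem_maxIdeal 1)⟩
  have hp : p.ev = φ := algHom_ext_of_X (by simp [p]) (by simp [p])
  let ρ' : K⟦X⟧ →ₐ[K] K⟦X⟧ := φ.comp (toMvPowerSeries i)
  have hρ' : ∀ a, ρ' a = β (ρ a) := fun _ => rfl
  have h0 : ρ' X ≠ 0 := by
    rw [hρ', Ne, map_eq_zero_iff _ hβ, map_eq_zero_iff _ hinj]
    exact X_ne_zero
  have hc0 : constantCoeff (ρ' X) = 0 := by
    rw [AlgHom.comp_apply, toMvPowerSeries_X]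
    exact constantCoeff_algHom φ (X_mem_maxIdeal i)
  refine ⟨p, fun a => ?_, ?_⟩
  · rw [hp, hφ, map_eq_zero_iff _ hβ, Ideal.Quotient.eq_zero_iff_mem]
  -- The powers t^l with l < d span K[[t]] over K[[x]]. As t x^n is in the image, so is x^(nd) t^l =
  -- x^(n(d-l)) (t x^n)^l, and x^(nd) is a conductor element.
  · set d := (ρ' X).order.toNat with hd
    obtain ⟨v, hv⟩ := X_pow_dvd_of_ne_zero (pow_ne_zero (n * d) h0)
    refine ⟨(ρ' X ^ (n * d)).order.toNat, fun z => ?_⟩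
    rw [hv, hp]
    obtain ⟨a, ha⟩ := exists_sum_mul_X_pow hc0 h0 (v * z)
    refine ⟨∑ l : Fin d, (a l).toMvPowerSeries i *
      (MvPowerSeries.X i ^ (n * (d - l)) * h ^ (l : ℕ)), ?_⟩
    rw [mul_assoc, ha, map_sum, Finset.mul_sum]
    refine Finset.sum_congr rfl fun l _ => ?_
    have h4 : φ h = X * (ρ' X) ^ n := by rw [hφ, hr, hρ']
    have h5 : φ (MvPowerSeries.X i) = ρ' X := by rw [hφ, hρ', hρX]
    have h6 : φ ((a l).toMvPowerSeries i) = ρ' (a l) := rfl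
    have h7 : n * d = n * (d - l) + n * l := by
      rw [← Nat.mul_add, Nat.sub_add_cancel l.2.le]
    rw [map_mul, map_mul, map_pow, map_pow, h4, h5, h6, h7, pow_add, pow_mul (ρ' X) n l]
    ring

end Normalization

end PlaneCurve

namespace PlaneCurve

/-! ### Plane sequences, contact numbers and restriction numbers -/

section Numerics

/-- The intersection number of a curve with multiplicities `e` at its `j`-th infinitely near point
with the exceptional divisor through this point other than the latest one; `0` if there is none. -/
def contact (e : ℕ → ℕ) : ℕ → ℕ
  | 0 => 0
  | 1 => 0
  | j + 2 => if e (j + 1) < e j then e j - e (j + 1) else contact e (j + 1) - e (j + 1)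

variable {e : ℕ → ℕ}

theorem contact_of_lt {j : ℕ} (h : e (j + 1) < e j) : contact e (j + 2) = e j - e (j + 1) :=
  if_pos h

theorem contact_of_not_lt {j : ℕ} (h : ¬ e (j + 1) < e j) :
    contact e (j + 2) = contact e (j + 1) - e (j + 1) := if_neg h

namespace IsPlaneSequence

variable (he : IsPlaneSequence e)
include he

theorem eq_of_not_lt {j : ℕ} (h : ¬ e (j + 1) < e j) : e (j + 1) = e j :=
  le_antisymm (he.antitone (Nat.le_succ j)) (not_lt.1 h)

/-- A nonzero contact records the position in the euclidean division of e_i by e_{i+1} begun at the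
last drop. Once the quotient is used up, the contact is the remainder, and if that is nonzero the
next multiplicity equals it: a new drop. -/
theorem exists_contact_eq (j : ℕ) (h : contact e (j + 1) ≠ 0) :
    ∃ i l, e (i + 1) < e i ∧ j = i + l ∧ 1 ≤ l ∧ l ≤ e i / e (i + 1) ∧
      contact e (j + 1) = e i - l * e (i + 1) := by
  induction j with
  | zero => exact absurd rfl h
  | succ j ih =>
    by_cases hlt : e (j + 1) < e j
    · refine ⟨j, 1, hlt, rfl, le_rfl, ?_, by rw [contact_of_lt hlt, one_mul]⟩
      exact (Nat.one_le_div_iff (he.pos _)).2 hlt.le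
    · rw [contact_of_not_lt hlt] at h ⊢
      obtain ⟨i, l, hi, rfl, hl, hlq, hb⟩ := ih (by omega)
      obtain ⟨h1, h2⟩ := he.proximity i hi
      have hlq' : l ≠ e i / e (i + 1) := by
        rintro rfl
        have hr : contact e (i + e i / e (i + 1) + 1) = e i % e (i + 1) := by
          rw [hb, Nat.mod_eq_sub_div_mul]
        have h3 := h2 (by omega)
        have h4 := h1 _ hl le_rfl
        have h5 := Nat.mod_lt (e i) (he.pos (i + 1))
        omega
      have h3 : e (i + l + 1) = e (i + 1) := h1 (l + 1) (by omega) (by omega)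
      refine ⟨i, l + 1, hi, rfl, by omega, by omega, ?_⟩
      rw [hb, h3, Nat.sub_sub, Nat.succ_mul]

/-- The proximity relation in terms of contact numbers. -/
theorem eq_min_contact (j : ℕ) (h : contact e (j + 1) ≠ 0) :
    e (j + 1) = min (contact e (j + 1)) (e j) := by
  obtain ⟨i, l, hi, rfl, hl, hlq, hb⟩ := he.exists_contact_eq j h
  obtain ⟨h1, h2⟩ := he.proximity i hi
  have h3 := h1 l hl hlq
  rcases hlq.lt_or_eq with hlt | rfl
  · have h4 : e (i + l + 1) = e (i + 1) := h1 (l + 1) (by omega) (by omega)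
    have h5 : (l + 1) * e (i + 1) ≤ e i :=
      (Nat.mul_le_mul_right _ hlt).trans (Nat.div_mul_le_self _ _)
    rw [Nat.succ_mul] at h5
    omega
  · have hr : contact e (i + e i / e (i + 1) + 1) = e i % e (i + 1) := by
      rw [hb, Nat.mod_eq_sub_div_mul]
    have h4 := h2 (by omega)
    have h5 := Nat.mod_lt (e i) (he.pos (i + 1))
    omega

omit he in
theorem tsub_sum_succ (i m : ℕ) : e i - ∑ l ∈ Finset.Icc 1 (m + 1), e (i + l) =
    e i - ∑ l ∈ Finset.Icc 1 m, e (i + l) - e (i + m + 1) := by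
  rw [Finset.sum_Icc_succ_top (by omega), Nat.sub_sub, add_assoc]

/-- The divisors through an infinitely near point. -/
theorem residual (j : ℕ) :
    (contact e (j + 1) = 0 ∧
      ∀ i m, i + m = j → m ≠ 0 → e i - ∑ l ∈ Finset.Icc 1 m, e (i + l) = 0) ∨
    (contact e (j + 1) ≠ 0 ∧ ∃ a k, a + k = j ∧ k ≠ 0 ∧
      e a - ∑ l ∈ Finset.Icc 1 k, e (a + l) = contact e (j + 1) ∧
      ∀ i m, i + m = j → m ≠ 0 → i ≠ a → e i - ∑ l ∈ Finset.Icc 1 m, e (i + l) = 0) := by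
  -- The truncated difference is the intersection number at the point j+1 with the exceptional
  -- divisor created at the point i. At a drop the newest divisor becomes the second one, and the
  -- former second divisor is left, its contact being equal to e_{j+1}.
  induction j with
  | zero => exact Or.inl ⟨rfl, fun i m h hm => by omega⟩
  | succ j ih =>
    by_cases hlt : e (j + 1) < e j
    · refine Or.inr ⟨by rw [contact_of_lt hlt]; omega, j, 1, rfl, by simp, ?_, ?_⟩
      · rw [contact_of_lt hlt]; simp
      · intro i m him hm hij
        obtain ⟨m, rfl⟩ := Nat.exists_eq_succ_of_ne_zero hm
        have hm0 : m ≠ 0 := by rintro rfl; omega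
        have hij' : i + m = j := by omega
        rw [tsub_sum_succ, hij']
        rcases ih with ⟨-, h⟩ | ⟨hb, a, k, hak, hk, ha, h⟩
        · rw [h i m hij' hm0, Nat.zero_sub]
        · rcases eq_or_ne i a with rfl | hia
          · obtain rfl : m = k := by omega
            have := he.eq_min_contact j hb
            rw [ha]
            omega
          · rw [h i m hij' hm0 hia, Nat.zero_sub]
    · have heq := he.eq_of_not_lt hlt
      rw [contact_of_not_lt hlt]
      have hzero : ∀ i m, i + m = j + 1 → m ≠ 0 →
          (∀ n, m = n + 1 → n ≠ 0 → e i - ∑ l ∈ Finset.Icc 1 n, e (i + l) ≤ e (j + 1)) →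
          e i - ∑ l ∈ Finset.Icc 1 m, e (i + l) = 0 := by
        intro i m him hm hn
        obtain ⟨m, rfl⟩ := Nat.exists_eq_succ_of_ne_zero hm
        have hij' : i + m = j := by omega
        rw [tsub_sum_succ, hij']
        rcases eq_or_ne m 0 with rfl | hm0
        · obtain rfl : i = j := by omega
          simp [heq]
        · have := hn m rfl hm0
          omega
      rcases ih with ⟨hb, h⟩ | ⟨hb, a, k, hak, hk, ha, h⟩
      · refine Or.inl ⟨by omega, fun i m him hm => hzero i m him hm fun n hn hn0 => ?_⟩
        rw [h i n (by omega) hn0]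
        exact Nat.zero_le _
      · rcases eq_or_ne (contact e (j + 1) - e (j + 1)) 0 with hb' | hb'
        · refine Or.inl ⟨hb', fun i m him hm => hzero i m him hm fun n hn hn0 => ?_⟩
          rcases eq_or_ne i a with rfl | hia
          · obtain rfl : n = k := by omega
            rw [ha]
            omega
          · rw [h i n (by omega) hn0 hia]
            exact Nat.zero_le _
        · refine Or.inr ⟨hb', a, k + 1, by omega, by omega, ?_, fun i m him hm hia =>
            hzero i m him hm fun n hn hn0 => ?_⟩
          · rw [tsub_sum_succ, hak, ha]
          · rw [h i n (by omega) hn0 hia]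
            exact Nat.zero_le _

/-- The next multiplicity never exceeds a nonzero residual; hence the partial sums cannot jump over
e_i and must hit it exactly. -/
theorem le_tsub_sum (i m : ℕ) (h : e i - ∑ l ∈ Finset.Icc 1 m, e (i + l) ≠ 0) :
    e (i + m + 1) ≤ e i - ∑ l ∈ Finset.Icc 1 m, e (i + l) := by
  rcases eq_or_ne m 0 with rfl | hm
  · simpa using he.antitone (Nat.le_succ i)
  · rcases he.residual (i + m) with ⟨-, h'⟩ | ⟨hb, a, k, hak, hk, ha, h'⟩
    · exact absurd (h' i m rfl hm) h
    · rcases eq_or_ne i a with rfl | hia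
      · obtain rfl : m = k := by omega
        have := he.eq_min_contact _ hb
        omega
      · exact absurd (h' i m rfl hm hia) h

theorem sum_strictMono (i : ℕ) : StrictMono fun m => ∑ l ∈ Finset.Icc 1 m, e (i + l) :=
  strictMono_nat_of_lt_succ fun m => by
    rw [Finset.sum_Icc_succ_top (by omega)]
    exact Nat.lt_add_of_pos_right (he.pos _)

theorem exists_eq_sum (i : ℕ) : ∃ h, e i = ∑ l ∈ Finset.Icc 1 h, e (i + l) := by
  classical
  have hex : ∃ m, e i ≤ ∑ l ∈ Finset.Icc 1 m, e (i + l) := ⟨e i, (he.sum_strictMono i).id_le _⟩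
  refine ⟨Nat.find hex, le_antisymm (Nat.find_spec hex) ?_⟩
  obtain ⟨m, hm⟩ : ∃ m, Nat.find hex = m + 1 := Nat.exists_eq_succ_of_ne_zero fun h0 => by
    have := Nat.find_spec hex
    rw [h0] at this
    have := he.pos i
    simp at *
    omega
  have h1 := Nat.find_min hex (m := m) (by omega)
  have h2 := he.le_tsub_sum i m (by omega)
  rw [hm, Finset.sum_Icc_succ_top (by omega), ← add_assoc]
  omega

theorem mem_iff_tsub_ne_zero (i m : ℕ) :
    (∃ h : ℕ, e i = ∑ l ∈ Finset.Icc 1 h, e (i + l) ∧ i < i + m + 1 ∧ i + m + 1 ≤ i + h) ↔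
      e i - ∑ l ∈ Finset.Icc 1 m, e (i + l) ≠ 0 := by
  constructor
  · rintro ⟨h, h1, -, h2⟩
    have := he.sum_strictMono i (show m < h by omega)
    simp only at this
    omega
  · intro h
    obtain ⟨k, hk⟩ := he.exists_eq_sum i
    have : m < k := (he.sum_strictMono i).lt_iff_lt.1 (by omega)
    exact ⟨k, hk, by omega, by omega⟩

/-- An index i is counted iff its residual is nonzero. The index j always is, and by `residual` one
further index is counted exactly when the contact is nonzero. -/
theorem restrictionNumber_succ (j : ℕ) :
    restrictionNumber e (j + 1) = if contact e (j + 1) = 0 then 1 else 2 := by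
  have key : {i : ℕ | ∃ h : ℕ, e i = ∑ l ∈ Finset.Icc 1 h, e (i + l) ∧ i < j + 1 ∧ j + 1 ≤ i + h} =
      {i | ∃ m, i + m = j ∧ e i - ∑ l ∈ Finset.Icc 1 m, e (i + l) ≠ 0} := by
    ext i
    constructor
    · rintro ⟨h, h1, h2, h3⟩
      obtain ⟨m, rfl⟩ := Nat.exists_eq_add_of_le (Nat.lt_succ_iff.1 h2)
      exact ⟨m, rfl, (he.mem_iff_tsub_ne_zero i m).1 ⟨h, h1, h2, h3⟩⟩
    · rintro ⟨m, rfl, hm⟩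
      exact (he.mem_iff_tsub_ne_zero i m).2 hm
  have hj : ∀ i m, i + m = j → m = 0 → e i - ∑ l ∈ Finset.Icc 1 m, e (i + l) ≠ 0 := by
    rintro i m - rfl
    simpa using (he.pos i).ne'
  rw [restrictionNumber, key]
  rcases he.residual j with ⟨hb, h⟩ | ⟨hb, a, k, hak, hk, ha, h⟩
  · rw [if_pos hb, Set.ncard_eq_one]
    refine ⟨j, Set.ext fun i => ⟨?_, ?_⟩⟩
    · rintro ⟨m, hm, hm'⟩
      rcases eq_or_ne m 0 with rfl | hm0
      · simpa using hm
      · exact absurd (h i m hm hm0) hm'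
    · rintro rfl
      exact ⟨0, rfl, hj _ 0 rfl rfl⟩
  · rw [if_neg hb, Set.ncard_eq_two]
    refine ⟨a, j, by omega, Set.ext fun i => ⟨?_, ?_⟩⟩
    · rintro ⟨m, hm, hm'⟩
      rcases eq_or_ne m 0 with rfl | hm0
      · exact Or.inr (by simpa using hm)
      · by_contra hia
        exact hm' (h i m hm hm0 fun h0 => hia (Or.inl h0))
    · rintro (rfl | rfl)
      · exact ⟨k, hak, by rwa [ha]⟩
      · exact ⟨0, rfl, hj _ 0 rfl rfl⟩

theorem restrictionNumber_succ_eq_two_iff (j : ℕ) :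
    restrictionNumber e (j + 1) = 2 ↔ contact e (j + 1) ≠ 0 := by
  rw [he.restrictionNumber_succ]
  split_ifs with h <;> simp [h]

omit he in
theorem _root_.PlaneCurve.restrictionNumber_zero (e : ℕ → ℕ) : restrictionNumber e 0 = 0 := by
  have h : {i : ℕ | ∃ h : ℕ, e i = ∑ l ∈ Finset.Icc 1 h, e (i + l) ∧ i < 0 ∧ 0 ≤ i + h} = ∅ :=
    Set.eq_empty_of_forall_notMem fun i ⟨_, _, h, _⟩ => absurd h (by omega)
  rw [restrictionNumber, h, Set.ncard_empty]

theorem restrictionNumber_eq_iff {e' : ℕ → ℕ} (he' : IsPlaneSequence e') (n : ℕ) :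
    (∀ j ≤ n, restrictionNumber e j = restrictionNumber e' j) ↔
      ∀ j ≤ n, contact e j = 0 ↔ contact e' j = 0 := by
  refine forall₂_congr fun j _ => ?_
  cases j with
  | zero => simp [restrictionNumber_zero, contact]
  | succ j =>
    rw [he.restrictionNumber_succ, he'.restrictionNumber_succ]
    split_ifs with h1 h2 h2 <;> simp [h1, h2]

/-- Once all multiplicities are 1, every step lowers the contact by one until it is 0. -/
theorem exists_contact_eq_zero : ∃ N, ∀ j, N ≤ j → e j = 1 ∧ contact e (j + 1) = 0 := by
  obtain ⟨n, hn⟩ := he.eventually_one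
  have hsub : ∀ k, contact e (n + 1 + k) ≤ contact e (n + 1) - k := by
    intro k
    induction k with
    | zero => simp
    | succ k ih =>
      have h1 := hn (n + k) (by omega)
      have h2 := hn (n + k + 1) (by omega)
      rw [show n + 1 + (k + 1) = n + k + 2 by omega, contact_of_not_lt (by omega),
        show n + k + 1 = n + 1 + k by omega]
      rw [show n + k + 1 = n + 1 + k by omega] at h2
      omega
  refine ⟨n + contact e (n + 1), fun j hj => ⟨hn j (by omega), ?_⟩⟩
  have := hsub (j - n)
  rw [show n + 1 + (j - n) = j + 1 by omega] at this
  omega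

end IsPlaneSequence

end Numerics

end PlaneCurve

namespace PlaneCurve

universe u
variable {K : Type u} [Field K]

/-! ### Tangents of a chain of blow-ups in terms of its multiplicities -/

section Chains

open PowerSeries Param

theorem dvd_of_order_le {x y : K⟦X⟧} (hx : x ≠ 0) (h : x.order ≤ y.order) : x ∣ y := by
  rcases eq_or_ne y 0 with rfl | hy
  · exact dvd_zero x
  refine (X_pow_dvd_of_ne_zero hx).trans ((pow_dvd_pow _ ?_).trans X_pow_order_dvd)
  exact ENat.toNat_le_toNat h (order_eq_top.not.2 hy)

theorem Param.exists_step {p : Param K} (hp : p.Nondeg) : ∃ s q, Step s p q := by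
  by_cases h : p.v.order < p.u.order
  · have hv : p.v ≠ 0 := order_eq_top.not.1 h.ne_top
    obtain ⟨w, hw⟩ := dvd_of_order_le hv h.le
    refine ⟨none, ⟨p.v, w, p.hv, ?_⟩, rfl, hw⟩
    rw [← one_le_order_iff_constCoeff_eq_zero, Order.one_le_iff_ne_zero]
    intro h0
    rw [hw, order_mul, h0, add_zero] at h
    exact h.false
  · have hu : p.u ≠ 0 := by
      rintro h0
      rw [h0, order_zero, lt_top_iff_ne_top, not_not, order_eq_top] at h
      exact hp.elim (· h0) (· h)
    obtain ⟨w, hw⟩ := dvd_of_order_le hu (not_lt.1 h)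
    exact ⟨some (constantCoeff w), ⟨p.u, w - C (constantCoeff w), p.hu, by simp⟩, rfl, by simpa⟩

/-- Blowing up repeatedly. -/
theorem Param.exists_chain {p : Param K} (hp : p.Nondeg) : ∃ (P : ℕ → Param K) (s : ℕ → Option K),
    P 0 = p ∧ ∀ j, Step (s j) (P j) (P (j + 1)) := by
  have h : ∀ p : {p : Param K // p.Nondeg}, ∃ (s : Option K) (q : {p : Param K // p.Nondeg}),
      Step s p.1 q.1 := fun p => by
    obtain ⟨s, q, h⟩ := exists_step p.2
    exact ⟨s, ⟨q, h.nondeg p.2⟩, h⟩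
  choose s q hq using h
  refine ⟨fun j => (q^[j] ⟨p, hp⟩).1, fun j => s (q^[j] ⟨p, hp⟩), rfl, fun j => ?_⟩
  simp only [Function.iterate_succ_apply']
  exact hq _

theorem Param.Step.order_u {s : Option K} {p q : Param K} (h : Step s p q) :
    q.u.order = min p.u.order p.v.order := by
  cases s with
  | none =>
    rw [h.1, min_eq_right]
    rw [h.2, order_mul]
    exact le_self_add
  | some c =>
    rw [h.1, min_eq_left]
    rw [h.2, order_mul]
    exact le_self_add

/-- The chain of blow-ups `P` with tangents `s` has multiplicities `e`. -/
structure IsChain (P : ℕ → Param K) (s : ℕ → Option K) (e : ℕ → ℕ) : Prop where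
  step : ∀ j, Step (s j) (P j) (P (j + 1))
  order : ∀ j, min (P j).u.order (P j).v.order = e j

namespace IsChain

variable {P : ℕ → Param K} {s : ℕ → Option K} {e : ℕ → ℕ} (h : IsChain P s e)
include h

theorem order_u (j : ℕ) : (P (j + 1)).u.order = e j := by
  rw [(h.step j).order_u, h.order]

theorem nondeg (j : ℕ) : (P j).Nondeg := by
  rw [Nondeg, ← not_and_or]
  rintro ⟨h1, h2⟩
  have := h.order j
  rw [h1, h2] at this
  simp at this

/-- The first coordinate at the point j+1 has order e_j; the tangent is ∞ iff the second coordinate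
has smaller order, which is then e_{j+1}. -/
theorem eq_none_iff (j : ℕ) : s (j + 1) = none ↔ e (j + 1) < e j := by
  rw [(h.step (j + 1)).eq_none_iff (h.nondeg _), h.order_u]
  have := h.order (j + 1)
  rw [h.order_u] at this
  constructor
  · intro hlt
    rw [min_eq_right hlt.le] at this
    rw [this] at hlt
    exact_mod_cast hlt
  · intro hlt
    by_contra hle
    rw [min_eq_left (not_lt.1 hle)] at this
    exact hlt.ne' (by exact_mod_cast this)

theorem order_v_of_lt (j : ℕ) (hj : e (j + 1) < e j) : (P (j + 1)).v.order = e (j + 1) := by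
  rw [← h.order_u (j + 1)]
  have := h.step (j + 1)
  rw [(h.eq_none_iff j).2 hj] at this
  rw [this.1]

/-- The tangent ∞ turns the newest divisor into v = 0, and the tangent 0 keeps the older divisor as
v = 0; in both cases the order of v follows the recursion for contacts. A nonzero finite tangent
leaves the older divisor. When the contact is 0 nothing is claimed about v, which need not define an
exceptional divisor. -/
theorem order_v_succ (he : IsPlaneSequence e) (j : ℕ)
    (hj : contact e (j + 1) ≠ 0 → (P (j + 1)).v.order = contact e (j + 1)) :
    (contact e (j + 2) ≠ 0 → (P (j + 2)).v.order = contact e (j + 2)) ∧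
    (contact e (j + 2) ≠ 0 ↔
      s (j + 1) = none ∨ (contact e (j + 1) ≠ 0 ∧ s (j + 1) = some 0)) := by
  have hs := h.step (j + 1)
  have hu := h.order_u j
  by_cases hlt : e (j + 1) < e j
  · have hn := (h.eq_none_iff j).2 hlt
    have hv := h.order_v_of_lt j hlt
    have hc := contact_of_lt hlt
    refine ⟨fun _ => ?_, iff_of_true (by omega) (Or.inl hn)⟩
    rw [hn] at hs
    rw [hs.2, order_mul, hv] at hu
    rw [hc, ENat.natCast_sub, ← hu, (ENat.addLECancellable_natCast _).add_tsub_cancel_left]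
  · have hn := (h.eq_none_iff j).not.2 hlt
    have hc := contact_of_not_lt hlt
    have hej := he.eq_of_not_lt hlt
    obtain ⟨c, hc'⟩ := Option.ne_none_iff_exists'.1 hn
    rw [hc'] at hs ⊢
    have hv : (P (j + 1)).v.order = e j + ((P (j + 2)).v + C c).order := by
      rw [hs.2, order_mul, hu]
    have hv' : 1 ≤ (P (j + 2)).v.order := one_le_order_iff_constCoeff_eq_zero.2 (P (j + 2)).hv
    by_cases h1 : contact e (j + 1) = 0
    · have h2 : contact e (j + 2) = 0 := by omega
      simp [h1, h2]
    rw [hj h1] at hv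
    have hcc : contact e (j + 2) ≠ 0 ↔ c = 0 := by
      constructor
      · intro h2
        by_contra hc0
        rw [order_zero_of_unit, add_zero] at hv
        · have : contact e (j + 1) = e j := by exact_mod_cast hv
          omega
        · rw [isUnit_iff_constantCoeff]
          simpa [(P (j + 2)).hv] using hc0
      · rintro rfl
        rw [map_zero, add_zero] at hv
        have : e j + 1 ≤ contact e (j + 1) := by
          have : ((e j + 1 : ℕ) : ℕ∞) ≤ contact e (j + 1) := by
            rw [hv]; push_cast; gcongr
          exact_mod_cast this
        omega
    refine ⟨fun h2 => ?_, by simp [hcc, h1]⟩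
    rw [hcc.1 h2, map_zero, add_zero] at hv
    rw [hc, ENat.natCast_sub, hv, hej, (ENat.addLECancellable_natCast _).add_tsub_cancel_left]

theorem order_v (he : IsPlaneSequence e) (j : ℕ) (hj : contact e (j + 1) ≠ 0) :
    (P (j + 1)).v.order = contact e (j + 1) := by
  induction j with
  | zero => exact absurd rfl hj
  | succ j ih => exact (h.order_v_succ he j ih).1 hj

theorem contact_ne_zero_iff (he : IsPlaneSequence e) (j : ℕ) : contact e (j + 2) ≠ 0 ↔
    s (j + 1) = none ∨ (contact e (j + 1) ≠ 0 ∧ s (j + 1) = some 0) :=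
  (h.order_v_succ he j (h.order_v he j)).2

end IsChain

end Chains

end PlaneCurve

namespace PlaneCurve

universe u
variable {K : Type u} [Field K]

/-! ### Compatible tangents, admissibility, and branches with prescribed tangents -/

section Construction

open PowerSeries Param

/-- `t` can be the `j`-th tangent of a curve with multiplicities `e`. -/
def StepCompat (e : ℕ → ℕ) : ℕ → Option K → Prop
  | 0, _ => True
  | j + 1, t => (t = none ↔ e (j + 1) < e j) ∧
      (contact e (j + 2) ≠ 0 ↔ t = none ∨ (contact e (j + 1) ≠ 0 ∧ t = some 0))

variable {e e' : ℕ → ℕ} {s s' : ℕ → Option K}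

theorem IsChain.stepCompat {P : ℕ → Param K} (h : IsChain P s e) (he : IsPlaneSequence e) :
    ∀ j, StepCompat e j (s j)
  | 0 => trivial
  | j + 1 => ⟨h.eq_none_iff j, h.contact_ne_zero_iff he j⟩

/-- Equal tangents give equal drops and equal vanishing of contacts. At n the tangents differ, so
they are neither both ∞, which is (3), nor both 0, which is (4). -/
theorem isAdmissible_of_stepCompat (he : IsPlaneSequence e) (he' : IsPlaneSequence e')
    (hs : ∀ j, StepCompat e j (s j)) (hs' : ∀ j, StepCompat e' j (s' j)) {n : ℕ}
    (hn : ∀ j < n, s j = s' j) (hne : s n ≠ s' n) : IsAdmissible e e' n := by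
  -- The tangent at j+1 decides the contact at j+2, so agreement strictly below n controls the
  -- contacts up to n inclusive.
  have hc : ∀ j ≤ n, contact e j = 0 ↔ contact e' j = 0 := by
    intro j hj
    induction j with
    | zero => simp [contact]
    | succ j ih =>
      cases j with
      | zero => simp [contact]
      | succ j =>
        rw [← not_iff_not, ← ne_eq, ← ne_eq, (hs (j + 1)).2, (hs' (j + 1)).2, ne_eq, ne_eq,
          ih (by omega), hn _ (by omega)]
  refine Or.inr ⟨n, rfl, fun i hi => ?_, (he.restrictionNumber_eq_iff he' n).2 hc, ?_, ?_⟩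
  · have h1 := (hs (i + 1)).1
    rw [hn _ hi, (hs' (i + 1)).1] at h1
    have h2 := he.antitone (Nat.le_succ i)
    have h3 := he'.antitone (Nat.le_succ i)
    rw [Nat.succ_eq_add_one] at h2 h3
    omega
  · rintro l rfl hl
    rw [← (hs (l + 1)).1] at hl
    have := (hs' (l + 1)).1.not.1 (hl ▸ hne.symm)
    exact (he'.eq_of_not_lt this).symm
  · rintro l rfl h1 h2 h3 h4 hl
    rw [he.restrictionNumber_succ_eq_two_iff] at h1 h3
    rw [he'.restrictionNumber_succ_eq_two_iff] at h2 h4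
    rw [← (hs' (l + 1)).1]
    by_contra hnone
    have h5 : s (l + 1) ≠ none := (hs (l + 1)).1.not.2 hl.not_gt
    exact hne ((((hs (l + 1)).2.1 h3).resolve_left h5).2.trans
      (((hs' (l + 1)).2.1 h4).resolve_left hnone).2.symm)

/-- Take ∞ at a drop, 1 where an older divisor has to be left, and 0 everywhere else; eventually
only 0 remains. -/
theorem IsPlaneSequence.exists_stepCompat (he : IsPlaneSequence e) :
    ∃ s : ℕ → Option K, (∀ j, StepCompat e j (s j)) ∧ ∃ N, ∀ j, N ≤ j → s j = some 0 := by
  refine ⟨fun j => j.casesOn (some 0) fun j => if e (j + 1) < e j then none else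
    if contact e (j + 2) ≠ 0 ∨ contact e (j + 1) = 0 then some 0 else some 1, fun j => ?_, ?_⟩
  · cases j with
    | zero => trivial
    | succ j =>
      by_cases hlt : e (j + 1) < e j
      · have := contact_of_lt hlt
        simp only [StepCompat, hlt, if_true, true_or, iff_true, true_and]
        omega
      · have := contact_of_not_lt hlt
        simp only [StepCompat, hlt, if_false, iff_false]
        split_ifs with h
        · simp only [not_false_eq_true, false_or, and_true, true_and]
          omega
        · rw [not_or, not_not] at h
          simp [h.1]
  · obtain ⟨N, hN⟩ := he.exists_contact_eq_zero
    refine ⟨N + 1, fun j hj => ?_⟩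
    obtain ⟨j, rfl⟩ := Nat.exists_eq_add_of_le' hj
    have h1 := hN (j + N) (by omega)
    have h2 := hN (j + N + 1) (by omega)
    simp [h1, h2, ← add_assoc]

/-- Copy the given tangents below n, which (1) and (2) allow. At n the new tangent is ∞ at a drop of
e', where (3) prevents a coincidence; generic if the next contact of e' vanishes; otherwise 0, where
(4) prevents it. -/
theorem IsPlaneSequence.exists_stepCompat_of_isAdmissible [Infinite K]
    (he : IsPlaneSequence e) (he' : IsPlaneSequence e') (hs : ∀ j, StepCompat e j (s j)) {n : ℕ}
    (h : IsAdmissible e e' n) : ∃ s' : ℕ → Option K, (∀ j, StepCompat e' j (s' j)) ∧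
      (∃ N, ∀ j, N ≤ j → s' j = some 0) ∧ (∀ j < n, s j = s' j) ∧ s n ≠ s' n := by
  obtain h | ⟨n', hn, h1, h2, h3, h4⟩ := h
  · omega
  obtain rfl : n = n' := by exact_mod_cast hn
  have hc := (he.restrictionNumber_eq_iff he' n).1 h2
  obtain ⟨t, ht, hne⟩ : ∃ t, StepCompat e' n t ∧ s n ≠ t := by
    classical
    obtain ⟨c, hcc⟩ := Infinite.exists_notMem_finset ({0, (s n).getD 0} : Finset K)
    simp only [Finset.mem_insert, Finset.mem_singleton, not_or] at hcc
    have hsc : s n ≠ some c := by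
      intro h
      simp [h] at hcc
    cases n with
    | zero => exact ⟨some c, trivial, hsc⟩
    | succ l =>
      have hsl := hs (l + 1)
      by_cases hlt : e' (l + 1) < e' l
      · refine ⟨none, ⟨by simp [hlt], ?_⟩, fun hl => ?_⟩
        · have := contact_of_lt hlt
          simp only [true_or, iff_true]
          omega
        · have := h3 l rfl (hsl.1.1 hl)
          omega
      · have hct := contact_of_not_lt hlt
        by_cases h0 : contact e' (l + 2) = 0
        · exact ⟨some c, ⟨by simp [hlt], by simp [h0, hcc.1]⟩, hsc⟩
        · have h5 : contact e' (l + 1) ≠ 0 := by omega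
          refine ⟨some 0, ⟨by simp [hlt], by simp [h0, h5]⟩, fun hl => hlt ?_⟩
          have h6 : contact e (l + 1) ≠ 0 := (hc (l + 1) le_rfl).not.2 h5
          refine h4 l rfl ?_ ?_ ?_ ?_ ?_
          · rwa [he.restrictionNumber_succ_eq_two_iff]
          · rwa [he'.restrictionNumber_succ_eq_two_iff]
          · rw [he.restrictionNumber_succ_eq_two_iff, hsl.2]
            exact Or.inr ⟨h6, hl⟩
          · rwa [he'.restrictionNumber_succ_eq_two_iff]
          · refine (he.eq_of_not_lt (hsl.1.not.1 ?_)).symm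
            simp [hl]
  obtain ⟨s', hs', N, hN⟩ := he'.exists_stepCompat (K := K)
  -- Compatibility concerns each tangent separately, so the pieces can be joined freely.
  refine ⟨fun j => if j < n then s j else if j = n then t else s' j, fun j => ?_,
    ⟨max N (n + 1), fun j hj => ?_⟩, fun j hj => by simp [hj], by simpa using hne⟩
  · beta_reduce
    split_ifs with hj hj'
    · cases j with
      | zero => trivial
      | succ j =>
        obtain ⟨h5, h6⟩ := hs (j + 1)
        refine ⟨?_, ?_⟩
        · have h7 := h1 j hj
          have h8 := he.antitone (Nat.le_succ j)
          have h9 := he'.antitone (Nat.le_succ j)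
          rw [Nat.succ_eq_add_one] at h8 h9
          rw [h5]
          omega
        · rwa [ne_eq, ne_eq, ← (hc (j + 2) (by omega)).not, ← (hc (j + 1) (by omega)).not]
    · exact hj' ▸ ht
    · exact hs' j
  · rw [max_le_iff] at hj
    beta_reduce
    rw [if_neg (by omega), if_neg (by omega), hN j hj.1]

variable (K) in
/-- The first coordinate axis. -/
noncomputable def Param.axis : Param K := ⟨X, 0, constantCoeff_X, map_zero _⟩

theorem Param.exists_step_to (t : Option K) (q : Param K) : ∃ p, Step t p q := by
  cases t with
  | none => exact ⟨⟨q.u * q.v, q.u, by simp [q.hu], q.hu⟩, rfl, rfl⟩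
  | some c => exact ⟨⟨q.u, q.u * (q.v + C c), q.hu, by simp [q.hu]⟩, rfl, rfl⟩

/-- Blowing down repeatedly. -/
theorem Param.exists_chain_to_axis (N : ℕ) : ∀ s : ℕ → Option K, (∀ j, N ≤ j → s j = some 0) →
    ∃ P : ℕ → Param K, (∀ j, Step (s j) (P j) (P (j + 1))) ∧ ∀ j, N ≤ j → P j = axis K := by
  induction N with
  | zero =>
    refine fun s hs => ⟨fun _ => axis K, fun j => ?_, fun _ _ => rfl⟩
    rw [hs j (Nat.zero_le j)]
    exact ⟨rfl, by simp [axis]⟩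
  | succ N ih =>
    intro s hs
    obtain ⟨P, hP, hPN⟩ := ih (fun j => s (j + 1)) fun j hj => hs _ (by omega)
    obtain ⟨p, hp⟩ := exists_step_to (s 0) (P 0)
    refine ⟨fun j => j.casesOn p P, fun j => ?_, fun j hj => ?_⟩
    · cases j with
      | zero => exact hp
      | succ j => exact hP j
    · obtain ⟨j, rfl⟩ := Nat.exists_eq_add_of_le' (Nat.one_le_of_lt hj)
      exact hPN j (by omega)

/-- Far out the chain is the axis, with multiplicity 1 and contact 0. The orders are then recovered
by descending through the blow-downs, with `IsPlaneSequence.eq_min_contact` identifying the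
multiplicities. -/
theorem isChain_of_stepCompat (he : IsPlaneSequence e) (hs : ∀ j, StepCompat e j (s j))
    {P : ℕ → Param K} (hP : ∀ j, Step (s j) (P j) (P (j + 1))) {N : ℕ}
    (hN : ∀ j, N ≤ j → P j = axis K) : IsChain P s e := by
  obtain ⟨M, hM⟩ := he.exists_contact_eq_zero
  -- Descending induction on j, with d bounding the distance to the stable range.
  have key : ∀ d j, N + M ≤ j + d → (P (j + 1)).u.order = e j ∧
      min (P (j + 1)).u.order (P (j + 1)).v.order = e (j + 1) ∧
      (contact e (j + 1) ≠ 0 → (P (j + 1)).v.order = contact e (j + 1)) := by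
    intro d
    induction d with
    | zero =>
      intro j hj
      rw [hN (j + 1) (by omega), (hM j (by omega)).1, (hM (j + 1) (by omega)).1,
        (hM j (by omega)).2]
      simp [axis, order_X]
    | succ d ih =>
      intro j hj
      obtain ⟨h1, h2, h3 : contact e (j + 2) ≠ 0 → (P (j + 2)).v.order = contact e (j + 2)⟩ :=
        ih (j + 1) (by omega)
      have hst := hP (j + 1)
      obtain ⟨h4, h5⟩ := hs (j + 1)
      by_cases hlt : e (j + 1) < e j
      · have hc := contact_of_lt hlt
        rw [h4.2 hlt] at hst
        have hv : (P (j + 1)).v.order = e (j + 1) := by rw [← hst.1, h1]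
        have hu : (P (j + 1)).u.order = e j := by
          rw [hst.2, order_mul, hv, h3 (by omega), hc, ← Nat.cast_add]
          congr 1
          omega
        refine ⟨hu, by rw [hu, hv, min_eq_right (by exact_mod_cast hlt.le)], fun h6 => ?_⟩
        have := he.eq_min_contact j h6
        rw [hv]
        congr 1
        omega
      · have hc := contact_of_not_lt hlt
        have hej := he.eq_of_not_lt hlt
        obtain ⟨c, hc'⟩ := Option.ne_none_iff_exists'.1 (h4.not.2 hlt)
        rw [hc'] at hst h5
        have hu : (P (j + 1)).u.order = e j := by rw [← hst.1, h1, hej]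
        have hv : (P (j + 1)).v.order = e j + ((P (j + 2)).v + C c).order := by
          rw [hst.2, order_mul, hu]
        refine ⟨hu, by rw [hu, hv, min_eq_left le_self_add, hej], fun h6 => ?_⟩
        rw [hv]
        by_cases h7 : contact e (j + 2) = 0
        · have hc0 : c ≠ 0 := by
            rintro rfl
            simp [h7, h6] at h5
          rw [order_zero_of_unit, add_zero]
          · have := he.eq_min_contact j h6
            congr 1
            omega
          · rw [isUnit_iff_constantCoeff]
            simpa [(P (j + 2)).hv] using hc0
        · have hc0 : c = 0 := by simpa [h6] using h5.1 h7
          rw [hc0, map_zero, add_zero, h3 h7, ← Nat.cast_add]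
          congr 1
          omega
  refine ⟨hP, fun j => ?_⟩
  cases j with
  | zero => rw [← (hP 0).order_u, (key (N + M) 0 (by omega)).1]
  | succ j => exact (key (N + M) j (by omega)).2.1

/-- A power of the exceptional coordinate multiplies the blown-up ring into the original one, so
conductors survive blowing down. The tangent ∞ is reduced to 0 by interchanging coordinates. -/
theorem Param.Step.exists_conductor {t : Option K} {p q : Param K} (h : Step t p q)
    (hp : p.Nondeg) (hq : ∃ N : ℕ, ∀ z : K⟦X⟧, ∃ g, q.ev g = X ^ N * z) :
    ∃ N : ℕ, ∀ z : K⟦X⟧, ∃ g, p.ev g = X ^ N * z := by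
  have key : ∀ {p : Param K} {c : K}, p.u ≠ 0 → q.u = p.u → p.v = p.u * (q.v + C c) →
      ∃ N : ℕ, ∀ z : K⟦X⟧, ∃ g, p.ev g = X ^ N * z := by
    intro p c hp0 hu hv
    obtain ⟨N, hN⟩ := hq
    obtain ⟨m, hm⟩ := exists_pow_mul_mem (P := fun _ : Unit => p) (fun _ => hp0)
      (z := fun _ => q.v + C c) fun _ => hv
    obtain ⟨r, hr⟩ := X_pow_dvd_of_ne_zero (pow_ne_zero m hp0)
    refine ⟨(p.u ^ m).order.toNat + N, fun z => ?_⟩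
    obtain ⟨g, hg⟩ := hN (r * z)
    obtain ⟨g', -, hg'⟩ := hm (evPi (fun _ => q) g) (by
      rw [← range_evPi_eq_adjoin (P := fun _ : Unit => p) (Q := fun _ => q) (fun _ => hp0)
        (fun _ => hu) (fun _ => rfl)]
      exact ⟨g, rfl⟩)
    refine ⟨g', ?_⟩
    have h1 := congrFun hg' ()
    simp only [evPi_apply, Pi.mul_apply, Pi.pow_apply, hg] at h1
    rw [h1, pow_add, hr]
    ring
  have hq0 := h.u_ne_zero hp
  cases t with
  | some c => exact key (h.1 ▸ hq0) h.1 h.2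
  | none =>
    obtain ⟨N, hN⟩ := key (p := p.swap) (c := 0) (show p.v ≠ 0 from h.1 ▸ hq0) h.1
      (show p.u = p.v * _ by simpa using h.2)
    refine ⟨N, fun z => ?_⟩
    obtain ⟨g, hg⟩ := hN z
    obtain ⟨g', hg'⟩ : emb K Unit (evPi (fun _ => p.swap) g) ∈ ring (fun _ : Unit => p) := by
      rw [← ring_swap]
      exact ⟨g, rfl⟩
    refine ⟨g', ?_⟩
    rw [← hg]
    exact congrFun (emb_injective hg') ()

theorem Param.ker_not_isMaximal {p : Param K} (hp : p.Nondeg) :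
    ¬ (RingHom.ker p.ev).IsMaximal := by
  intro h
  have h1 : RingHom.ker p.ev = maxIdeal K := IsLocalRing.eq_maximalIdeal h
  have h2 : ∀ i, p.ev (MvPowerSeries.X i) = 0 := fun i => by
    rw [← RingHom.mem_ker, h1]
    exact X_mem_maxIdeal i
  rcases hp with hp | hp
  · exact hp (by simpa using h2 0)
  · exact hp (by simpa using h2 1)

theorem exists_branch_of_stepCompat (he : IsPlaneSequence e) (hs : ∀ j, StepCompat e j (s j))
    (hs0 : ∃ N, ∀ j, N ≤ j → s j = some 0) :
    ∃ (B : Branch K) (P : ℕ → Param K), IsChain P s e ∧ (P 0).Parametrizes B.ideal := by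
  obtain ⟨N, hN⟩ := hs0
  obtain ⟨P, hP, hPN⟩ := exists_chain_to_axis N s hN
  have hch := isChain_of_stepCompat he hs hP hPN
  have hcond : ∀ d j, N ≤ j + d → ∃ M : ℕ, ∀ z : K⟦X⟧, ∃ g, (P j).ev g = X ^ M * z := by
    intro d
    induction d with
    | zero =>
      intro j hj
      refine ⟨0, fun z => ⟨z.toMvPowerSeries 0, ?_⟩⟩
      rw [ev_toMvPowerSeries_zero, hPN j hj, pow_zero, one_mul]
      exact X_subst z
    | succ d ih =>
      intro j hj
      exact (hP j).exists_conductor (hch.nondeg j) (ih (j + 1) (by omega))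
  have hpar : (P 0).Parametrizes (RingHom.ker (P 0).ev) := ⟨fun g => Iff.rfl, hcond N 0 (by omega)⟩
  refine ⟨⟨RingHom.ker (P 0).ev, RingHom.ker_isPrime _, fun h0 => ?_,
    ker_not_isMaximal (hch.nondeg 0)⟩, P, hch, hpar⟩
  -- If the kernel were zero it would lie in the kernel of the other axis (0,t), hence equal it; but
  -- that kernel contains the nonzero series X_0.
  have h1 := hpar.eq_of_le (RingHom.ker_isPrime (⟨0, X, map_zero _, constantCoeff_X⟩ : Param K).ev)
    (ker_not_isMaximal (Or.inr X_ne_zero)) (h0 ▸ bot_le)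
  have h2 : MvPowerSeries.X 0 ∈ RingHom.ker (⟨0, X, map_zero _, constantCoeff_X⟩ : Param K).ev := by
    rw [RingHom.mem_ker, ev_X_zero]
  rw [← h1, h0, Ideal.mem_bot] at h2
  have h3 := congrArg (axis K).ev h2
  rw [ev_X_zero, map_zero] at h3
  exact X_ne_zero h3

end Construction

end PlaneCurve

namespace PlaneCurve

universe u
variable {K : Type u} [Field K]

/-! ### Splitting numbers and the theorem -/

section Splitting

open Param

variable {e e' : ℕ → ℕ} {s s' : ℕ → Option K} {P P' : ℕ → Param K} {C C' : Branch K}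

theorem Branch.HasMultiplicitySequence.exists_isChain [IsAlgClosed K]
    (h : C.HasMultiplicitySequence e) :
    ∃ (P : ℕ → Param K) (s : ℕ → Option K), IsChain P s e ∧ (P 0).Parametrizes C.ideal := by
  obtain ⟨p, hp⟩ := C.exists_parametrizes
  obtain ⟨P, s, rfl, hs⟩ := exists_chain hp.nondeg
  exact ⟨P, s, ⟨hs, fun j => (hp.multiplicity_eq hs j).symm.trans (h j)⟩, hp⟩

theorem IsChain.hasMultiplicitySequence (h : IsChain P s e) (hp : (P 0).Parametrizes C.ideal) :
    C.HasMultiplicitySequence e := fun j => by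
  exact (hp.multiplicity_eq h.step j).trans (h.order j)

theorem Branch.isLocalRing_inf (C C' : Branch K) :
    IsLocalRing (MvPowerSeries (Fin 2) K ⧸ (C.ideal ⊓ C'.ideal)) := by
  have : Nontrivial (MvPowerSeries (Fin 2) K ⧸ (C.ideal ⊓ C'.ideal)) :=
    Ideal.Quotient.nontrivial_iff.2
      (ne_top_of_le_ne_top C.isPrime.ne_top inf_le_left)
  exact IsLocalRing.of_surjective' (Ideal.Quotient.mk _) Ideal.Quotient.mk_surjective

theorem Branch.not_isLocalRing_prod (C C' : Branch K) : ¬ IsLocalRing (C.Ring × C'.Ring) := by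
  intro h
  have := C.isPrime
  have := C'.isPrime
  rcases IsLocalRing.isUnit_or_isUnit_of_add_one (a := ((1, 0) : C.Ring × C'.Ring)) (b := (0, 1))
    (by simp) with h | h
  · exact not_isUnit_zero (h.map (RingHom.snd C.Ring C'.Ring))
  · exact not_isUnit_zero (h.map (RingHom.fst C.Ring C'.Ring))

theorem isPairSplittingNumber_neg_one (C C' : Branch K) : IsPairSplittingNumber C C' (-1) :=
  Or.inr (Or.inl ⟨C.not_isLocalRing_prod C', rfl⟩)

theorem isGreatest_of_branch [Infinite K] (hne : C.ideal ≠ C'.ideal) (h : IsChain P s e)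
    (h' : IsChain P' s' e') (hp : (P 0).Parametrizes C.ideal) (hp' : (P' 0).Parametrizes C'.ideal)
    {n : ℕ} (hn : ∀ j < n, s j = s' j) (hsn : s n ≠ s' n) :
    IsGreatest {j : ℕ | IsLocalRing (neighbourhood (_ ⧸ (C.ideal ⊓ C'.ideal)) j)} n := by
  obtain ⟨h1, h2⟩ := isLocalRing_neighbourhood_of_step hp hp' C.isPrime C'.isPrime C.not_isMaximal
    C'.not_isMaximal hne h.step h'.step
  refine ⟨h1 n hn, fun m hm => not_lt.1 fun hlt => h2 n hn hsn m hlt hm⟩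

theorem isAdmissible_of_isPairSplittingNumber [IsAlgClosed K] (he : IsPlaneSequence e)
    (he' : IsPlaneSequence e') (hC : C.HasMultiplicitySequence e)
    (hC' : C'.HasMultiplicitySequence e') {k : ℤ} (hk : IsPairSplittingNumber C C' k) :
    IsAdmissible e e' k := by
  rcases hk with ⟨hne, ⟨-, rfl⟩ | ⟨-, n, rfl, hn⟩⟩ | ⟨-, rfl⟩ | ⟨h, -⟩
  · exact Or.inl rfl
  · obtain ⟨P, s, h, hp⟩ := hC.exists_isChain
    obtain ⟨P', s', h', hp'⟩ := hC'.exists_isChain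
    obtain ⟨m, hm, hsm⟩ : ∃ m, (∀ j < m, s j = s' j) ∧ s m ≠ s' m := by
      classical
      -- If all tangents agreed, the blow-up with index n+1 would still be local, against the
      -- maximality of n.
      have hex : ∃ m, s m ≠ s' m := by
        by_contra! hall
        have := hn.2 ((isLocalRing_neighbourhood_of_step hp hp' C.isPrime C'.isPrime C.not_isMaximal
          C'.not_isMaximal hne h.step h'.step).1 (n + 1) fun j _ => hall j)
        omega
      exact ⟨Nat.find hex, fun j hj => not_not.1 (Nat.find_min hex hj), Nat.find_spec hex⟩
    rw [hn.unique (isGreatest_of_branch hne h h' hp hp' hm hsm)]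
    exact isAdmissible_of_stepCompat he he' (h.stepCompat he) (h'.stepCompat he') hm hsm
  · exact Or.inl rfl
  · exact absurd h (C.not_isLocalRing_prod C')

theorem IsPlaneSequence.exists_branch (he : IsPlaneSequence e) :
    ∃ C : Branch K, C.HasMultiplicitySequence e := by
  obtain ⟨s, hs, hs0⟩ := he.exists_stepCompat (K := K)
  obtain ⟨C, P, h, hp⟩ := exists_branch_of_stepCompat he hs hs0
  exact ⟨C, h.hasMultiplicitySequence hp⟩

theorem exists_isPairSplittingNumber [IsAlgClosed K] (he : IsPlaneSequence e)
    (he' : IsPlaneSequence e') {k : ℤ} (hk : IsAdmissible e e' k)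
    (hC : C.HasMultiplicitySequence e) :
    ∃ C' : Branch K, C'.HasMultiplicitySequence e' ∧ IsPairSplittingNumber C C' k := by
  by_cases hk1 : k = -1
  · obtain ⟨C', hC'⟩ := he'.exists_branch (K := K)
    exact ⟨C', hC', hk1 ▸ isPairSplittingNumber_neg_one C C'⟩
  obtain ⟨n, rfl⟩ : ∃ n : ℕ, k = n := (hk.resolve_left hk1).imp fun n h => h.1
  obtain ⟨P, s, h, hp⟩ := hC.exists_isChain
  obtain ⟨s', hs', hs0, hn, hsn⟩ :=
    he.exists_stepCompat_of_isAdmissible he' (h.stepCompat he) hk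
  obtain ⟨C', P', h', hp'⟩ := exists_branch_of_stepCompat he' hs' hs0
  -- Tangents depend only on the ideal, so a difference at n forces distinct branches.
  have hne : C.ideal ≠ C'.ideal := fun hI =>
    hsn (congrFun (hp.step_eq h.step (hI ▸ hp') h'.step) n)
  exact ⟨C', h'.hasMultiplicitySequence hp', Or.inl ⟨hne, Or.inr ⟨C.isLocalRing_inf C', n, rfl,
    isGreatest_of_branch hne h h' hp hp' hn hsn⟩⟩⟩

end Splitting

end PlaneCurve

theorem mainTheorem8 {K : Type*} [Field K] [IsAlgClosed K] (e e' : ℕ → ℕ)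
    (he : PlaneCurve.IsPlaneSequence e) (he' : PlaneCurve.IsPlaneSequence e') (k : ℤ) :
    (PlaneCurve.IsAdmissible e e' k →
      ∀ C : PlaneCurve.Branch K, C.HasMultiplicitySequence e →
        ∃ C' : PlaneCurve.Branch K, C'.HasMultiplicitySequence e' ∧
          PlaneCurve.IsPairSplittingNumber C C' k) ∧
    ((∃ C C' : PlaneCurve.Branch K, C.HasMultiplicitySequence e ∧
        C'.HasMultiplicitySequence e' ∧ PlaneCurve.IsPairSplittingNumber C C' k) ↔
      PlaneCurve.IsAdmissible e e' k) := by
  refine ⟨fun hk C hC => PlaneCurve.exists_isPairSplittingNumber he he' hk hC, ?_, fun hk => ?_⟩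
  · rintro ⟨C, C', hC, hC', hk⟩
    exact PlaneCurve.isAdmissible_of_isPairSplittingNumber he he' hC hC' hk
  · obtain ⟨C, hC⟩ := he.exists_branch (K := K)
    obtain ⟨C', hC', hk'⟩ := PlaneCurve.exists_isPairSplittingNumber he he' hk hC
    exact ⟨C, C', hC, hC', hk'⟩
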